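/- Let $X$ be a complex Banach space and let $A$ be an injective sectorial operator on $X$: $A$ is a densely defined linear operator, $\sigma(A)\cap(-\infty,0)=\emptyset$ and $\sup_{s>0}\|(1+sA)^{-1}\|<\infty$. For $\omega\in(0,\pi)$ let $S_\omega=\{z\neq 0: |\arg z|<\omega\}$, and write $A\in\operatorname{Sect}(\omega)$ if $\sigma(A)\subset\overline{S}_\omega$ and $\sup_{z\notin\overline{S}_\omega}\|z(z-A)^{-1}\|<\infty$. For $s=0$, $(1+sA)^{-1}$ denotes the identity of $X$. Let $n\ge 1$ and let $f$ be a function on $\mathbb C\setminus(-\infty,0]$ of the form $$f(z)=a+\int_{[0,\infty)}\frac{z^n\,\mu(ds)}{(1+zs)^n},$$ where $a\in\mathbb C$ and $\mu$ is a complex Radon measure on $[0,\infty)$ with $\int_{[0,\infty)}(1+s)^{-n}\,|\mu|(ds)<\infty$ (that is, $f\in\tilde{\mathcal T}_n$). For $m\ge 1$ let $\tilde{\mathcal S}_{m,b}$ be the set of functions $g(z)=\int_{[0,\infty)}(1+zs)^{-m}\,\nu(ds)$ on $\mathbb C\setminus(-\infty,0]$ with $\nu$ a complex Radon measure of finite total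 variation; for such $g$ put $g(A)=\int_{[0,\infty)}(1+sA)^{-m}\,\nu(ds)\in\mathcal L(X)$ (this does not depend on $m$ and $\nu$). Let $\psi_n(z)=(1+z)^{-n}$ and $\tau(z)=z(1+z)^{-2}$. Then $\psi_n\in\tilde{\mathcal S}_{n,b}$, $f\psi_n\in\tilde{\mathcal S}_{2n,b}$ and $\psi_n(A)$ is injective, so that $$f_S(A):=\psi_n(A)^{-1}\,(f\psi_n)(A)$$ is defined (extended Stieltjes calculus). For every $x\in\operatorname{dom}(A^n)$ the integral in $$\hat f(A)x:=ax+\int_{[0,\infty)}A^n(1+sA)^{-n}x\,\mu(ds)$$ converges absolutely, and the operator $\hat f(A)$ with domain $\operatorname{dom}(A^n)$ is closable, so that $$f_H(A):=\overline{\hat f(A)}$$ is defined (Hirsch's definition). There is $\omega\in(0,\pi)$ with $A\in\operatorname{Sect}(\omega)$; and whenever $A\in\operatorname{Sect}(\omega)$ and $0<\omega<\theta<\varphi<\pi$, the functions $\tau$ and $\tau^{n+1}f$ are holomorphic on $S_\varphi$ and bounded there by $C\min(|z|^{\varepsilon},|z|^{-\varepsilon})$ for some $C,\varepsilon>0$,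 and, with $g(A)=\frac1{2\pi i}\int_{\Gamma}g(z)(z-A)^{-1}\,dz$ for such functions $g$, where $\Gamma$ is the downward oriented boundary of $S_\theta$, the operator $\tau(A)$ is injective, so that $$f_{hol}(A):=\tau(A)^{-(n+1)}\,(\tau^{n+1}f)(A)$$ is defined (extended holomorphic calculus). Moreover, with equality of domains included, $$f_S(A)=f_{hol}(A)=f_H(A).$$ -/

import Mathlib

open MeasureTheory Set
open scoped NNReal

noncomputable section

namespace SectorialCalculus

variable {X : Type*} [NormedAddCommGroup X] [NormedSpace ℂ X]

/-! ### Unbounded operators -/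

/-- The everywhere defined operator given by a bounded operator. -/
def ofBdd (T : X →L[ℂ] X) : X →ₗ.[ℂ] X := (T : X →ₗ[ℂ] X).toPMap ⊤

/-- The product `B A`, with domain `{x ∈ dom A : A x ∈ dom B}`. -/
def opComp (B A : X →ₗ.[ℂ] X) : X →ₗ.[ℂ] X where
  domain := (B.domain.comap A.toFun).map A.domain.subtype
  toFun :=
    { toFun := fun x => B ⟨A ⟨x, by
          obtain ⟨y, -, hy⟩ := x.2
          exact hy ▸ y.2⟩, by
          obtain ⟨x, y, hy, rfl⟩ := x
          exact hy⟩
      map_add' := fun x y => by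
        rw [← LinearPMap.map_add]
        congr 1
        apply Subtype.ext
        simp only [Submodule.coe_add]
        rw [← LinearPMap.map_add]
        rfl
      map_smul' := fun c x => by
        simp only [RingHom.id_apply]
        rw [← LinearPMap.map_smul]
        congr 1
        apply Subtype.ext
        simp only [Submodule.coe_smul]
        rw [← LinearPMap.map_smul]
        rfl }

theorem mem_opComp_domain {B A : X →ₗ.[ℂ] X} {x : X} :
    x ∈ (opComp B A).domain ↔ ∃ h : x ∈ A.domain, A ⟨x, h⟩ ∈ B.domain := by
  constructor
  · rintro ⟨y, hy, rfl⟩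
    exact ⟨y.2, hy⟩
  · rintro ⟨h, hx⟩
    exact ⟨⟨x, h⟩, hx, rfl⟩

theorem opComp_apply {B A : X →ₗ.[ℂ] X} (x : (opComp B A).domain) (h : (x : X) ∈ A.domain)
    (h' : A ⟨x, h⟩ ∈ B.domain) : opComp B A x = B ⟨A ⟨x, h⟩, h'⟩ := rfl

/-- The powers `A ^ n`, with their natural domains: `dom (A ^ 0) = X` and
`dom (A ^ (n + 1)) = {x ∈ dom A : A x ∈ dom (A ^ n)}`. -/
def opPow (A : X →ₗ.[ℂ] X) : ℕ → (X →ₗ.[ℂ] X)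
  | 0 => ofBdd 1
  | n + 1 => opComp (opPow A n) A

/-- `R` is the bounded, everywhere defined, two-sided inverse of the operator `B`. -/
def IsBddInverse (B : X →ₗ.[ℂ] X) (R : X →L[ℂ] X) : Prop :=
  (∀ y : X, ∃ h : R y ∈ B.domain, B ⟨R y, h⟩ = y) ∧ ∀ x : B.domain, R (B x) = x

open Classical in
/-- The (unique) bounded inverse of `B` if there is one, and `0` otherwise. -/
def bddInv (B : X →ₗ.[ℂ] X) : X →L[ℂ] X :=
  if h : ∃ R, IsBddInverse B R then h.choose else 0

/-- The operator `c + d A` with domain `dom A`. -/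
def affineOp (A : X →ₗ.[ℂ] X) (c d : ℂ) : X →ₗ.[ℂ] X :=
  (c • LinearMap.id : X →ₗ[ℂ] X) +ᵥ (d • A)

/-- The resolvent set of `A`. -/
def resolventSet (A : X →ₗ.[ℂ] X) : Set ℂ := {z | ∃ R, IsBddInverse (affineOp A z (-1)) R}

/-- The resolvent `(z - A)⁻¹`, for `z` in the resolvent set. -/
def resolvent (A : X →ₗ.[ℂ] X) (z : ℂ) : X →L[ℂ] X := bddInv (affineOp A z (-1))

/-- `(1 + s A)⁻¹` for `s ≥ 0`. For `s = 0` this is the identity of `X` (not only of `dom A`). -/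
def stRes (A : X →ₗ.[ℂ] X) (s : ℝ≥0) : X →L[ℂ] X :=
  if s = 0 then 1 else bddInv (affineOp A 1 ((s : ℝ) : ℂ))

/-- Sectorial (non-negative) operators: densely defined, spectrum disjoint from `(-∞, 0)` and
`sup_{s > 0} ‖(1 + s A)⁻¹‖ < ∞`. -/
structure IsSectorial (A : X →ₗ.[ℂ] X) : Prop where
  dense : Dense (A.domain : Set X)
  neg_mem : ∀ t : ℝ, t < 0 → (t : ℂ) ∈ resolventSet A
  bound : ∃ M : ℝ, ∀ s : ℝ≥0, 0 < s → ‖stRes A s‖ ≤ M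

/-- The open sector of half-angle `φ`, symmetric about the positive real axis. -/
def sector (φ : ℝ) : Set ℂ := {z | z ≠ 0 ∧ |z.arg| < φ}

/-- The closed sector of half-angle `ω ∈ (0, π)`; it contains `0` because `arg 0 = 0`. -/
def closedSector (ω : ℝ) : Set ℂ := {z | |z.arg| ≤ ω}

/-- `A ∈ Sect(ω)`: the spectrum lies in the closed sector of half-angle `ω`, and
`z (z - A)⁻¹` is uniformly bounded for `z` outside it. -/
def IsSect (A : X →ₗ.[ℂ] X) (ω : ℝ) : Prop :=
  (∀ z : ℂ, z ∉ closedSector ω → z ∈ resolventSet A) ∧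
    ∃ M : ℝ, ∀ z : ℂ, z ∉ closedSector ω → ‖z • resolvent A z‖ ≤ M

/-! ### Complex Radon measures on `[0, ∞)` -/

/-- A complex Radon measure on `[0, ∞)`, written as `μ₀ + i μ₁ - μ₂ - i μ₃` with positive Radon
measures `μ₀, μ₁, μ₂, μ₃` (its total variation measure is then at most `μ₀ + μ₁ + μ₂ + μ₃`; by
the Jordan decomposition of the real and the imaginary part, every complex Radon measure
has such a form, with `μₖ ≤ |μ|`). -/
structure ComplexRadon where
  part : Fin 4 → Measure ℝ≥0
  radon : ∀ k, IsLocallyFiniteMeasure (part k)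

/-- The integral `∫ g(s) μ(ds)` against a complex Radon measure. -/
def ComplexRadon.integral {E : Type*} [NormedAddCommGroup E] [NormedSpace ℂ E]
    (μ : ComplexRadon) (g : ℝ≥0 → E) : E :=
  ∑ k : Fin 4, Complex.I ^ (k : ℕ) • ∫ s, g s ∂(μ.part k)

/-- `∫ |g(s)| |μ|(ds) < ∞`. -/
def ComplexRadon.Integrable {E : Type*} [NormedAddCommGroup E]
    (μ : ComplexRadon) (g : ℝ≥0 → E) : Prop :=
  ∀ k, MeasureTheory.Integrable g (μ.part k)

/-- Finite total variation. -/
def ComplexRadon.IsFinite (μ : ComplexRadon) : Prop := ∀ k, IsFiniteMeasure (μ.part k)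

/-! ### The Stieltjes calculus -/

/-- `g(z) = ∫ ν(ds) / (1 + z s) ^ m` on `ℂ \ (-∞, 0]`, with `ν` of finite total variation. -/
def IsStieltjesRep (m : ℕ) (g : ℂ → ℂ) (ν : ComplexRadon) : Prop :=
  ν.IsFinite ∧ ∀ z ∈ Complex.slitPlane,
    g z = ν.integral fun s => 1 / (1 + z * ((s : ℝ) : ℂ)) ^ m

/-- The complex linear span of the bounded generalised Stieltjes functions of order `m`. The
values of `g` outside `ℂ \ (-∞, 0]` are irrelevant. -/
def stieltjesB (m : ℕ) : Set (ℂ → ℂ) := {g | ∃ ν, IsStieltjesRep m g ν}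

/-- The bounded operator `∫ (1 + s A)^(-m) ν(ds)`. -/
def stieltjesIntegral (A : X →ₗ.[ℂ] X) (m : ℕ) (ν : ComplexRadon) : X →L[ℂ] X :=
  ν.integral fun s => stRes A s ^ m

open Classical in
/-- The Stieltjes calculus on the bounded Stieltjes algebra: `∫ (1 + s A)^(-m) ν(ds)` for a
function `g(z) = ∫ ν(ds) / (1 + z s) ^ m`, `m ≥ 1`, where some such `m`, `ν` are chosen (the
operator does not depend on the choice). The junk value is `0`. -/
def stieltjesCalc (A : X →ₗ.[ℂ] X) (g : ℂ → ℂ) : X →L[ℂ] X :=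
  if h : ∃ p : ℕ × ComplexRadon, 1 ≤ p.1 ∧ IsStieltjesRep p.1 g p.2 then
    stieltjesIntegral A h.choose.1 h.choose.2
  else 0

/-- The regulariser `ψₙ(z) = (1 + z)^(-n)`. -/
def psi (n : ℕ) (z : ℂ) : ℂ := 1 / (1 + z) ^ n

/-- The extended Stieltjes calculus: `f_S(A) = ψₙ(A)⁻¹ (f ψₙ)(A)`. -/
def stieltjesOp (A : X →ₗ.[ℂ] X) (n : ℕ) (f : ℂ → ℂ) : X →ₗ.[ℂ] X :=
  opComp (ofBdd (stieltjesCalc A (psi n))).inverse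
    (ofBdd (stieltjesCalc A fun z => f z * psi n z))

/-! ### The complete Bernstein algebra and the Hirsch definition -/

/-- `f(z) = a + ∫ z ^ n μ(ds) / (1 + z s) ^ n` on `ℂ \ (-∞, 0]`, where `μ` is a complex Radon
measure with `∫ |μ|(ds) / (1 + s) ^ n < ∞`. -/
def IsBernsteinRep (n : ℕ) (f : ℂ → ℂ) (a : ℂ) (μ : ComplexRadon) : Prop :=
  (μ.Integrable fun s => 1 / (1 + (s : ℝ)) ^ n) ∧ ∀ z ∈ Complex.slitPlane,
    f z = a + μ.integral fun s => z ^ n / (1 + z * ((s : ℝ) : ℂ)) ^ n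

theorem stRes_pow_mem (A : X →ₗ.[ℂ] X) (n : ℕ) (s : ℝ≥0) (x : X)
    (hx : x ∈ (opPow A n).domain) : (stRes A s ^ n) x ∈ (opPow A n).domain := by
  by_cases hs : s = 0
  · simpa [stRes, hs] using hx
  have hs' : (((s : ℝ) : ℂ)) ≠ 0 := by exact_mod_cast hs
  by_cases h : ∃ R, IsBddInverse (affineOp A 1 ((s : ℝ) : ℂ)) R
  · have hR : stRes A s = h.choose := by simp only [stRes, hs, if_false, bddInv, h, dif_pos]
    have hspec := h.choose_spec
    rw [hR]
    generalize h.choose = R at hspec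
    clear hx
    induction n generalizing x with
    | zero => trivial
    | succ k ih =>
      obtain ⟨hd, he⟩ := hspec.1 ((R ^ k) x)
      have hd' : R ((R ^ k) x) ∈ A.domain := hd
      have he' : R ((R ^ k) x) + ((s : ℝ) : ℂ) • A ⟨R ((R ^ k) x), hd'⟩ = (R ^ k) x := by
        have h1 : affineOp A 1 ((s : ℝ) : ℂ) ⟨R ((R ^ k) x), hd⟩ =
            ((1 : ℂ) • R ((R ^ k) x)) + ((s : ℝ) : ℂ) • A ⟨R ((R ^ k) x), hd'⟩ := rfl
        rw [h1, one_smul] at he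
        exact he
      have e1 : (R ^ (k + 1)) x = R ((R ^ k) x) := by rw [pow_succ']; rfl
      have e2 : (R ^ (k + 1)) x = (R ^ k) (R x) := by rw [pow_succ]; rfl
      rw [e1]
      refine mem_opComp_domain.2 ⟨hd', ?_⟩
      have h3 : A ⟨R ((R ^ k) x), hd'⟩ =
          (((s : ℝ) : ℂ))⁻¹ • ((R ^ k) x - (R ^ k) (R x)) := by
        rw [← e2, e1, eq_inv_smul_iff₀ hs', eq_sub_iff_add_eq, add_comm]
        exact he'
      rw [h3]
      exact Submodule.smul_mem _ _ (Submodule.sub_mem _ (ih x) (ih (R x)))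
  · have hR : stRes A s = 0 := by simp only [stRes, hs, if_false, bddInv, h, dif_neg, not_false_eq_true]
    rw [hR]
    cases n with
    | zero => trivial
    | succ k => simp

/-- The map `x ↦ A ^ n (1 + s A)^(-n) x` on `dom (A ^ n)`. -/
def hirschIntegrand (A : X →ₗ.[ℂ] X) (n : ℕ) (s : ℝ≥0) : (opPow A n).domain →ₗ[ℂ] X :=
  (opPow A n).toFun ∘ₗ
    ((stRes A s ^ n : X →L[ℂ] X) : X →ₗ[ℂ] X).restrict fun x hx => stRes_pow_mem A n s x hx

/-- The operator `x ↦ a x + ∫ A ^ n (1 + s A)^(-n) x μ(ds)`, defined for those `x ∈ dom (A ^ n)`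
for which the integral converges absolutely. -/
def hirschOp (A : X →ₗ.[ℂ] X) (n : ℕ) (a : ℂ) (μ : ComplexRadon) : X →ₗ.[ℂ] X where
  domain :=
    { carrier := {x | ∃ h : x ∈ (opPow A n).domain,
        μ.Integrable fun s => hirschIntegrand A n s ⟨x, h⟩}
      zero_mem' := ⟨Submodule.zero_mem _, fun k => by
        have e : (fun s => hirschIntegrand A n s ⟨0, Submodule.zero_mem _⟩) = fun _ => (0 : X) := by
          funext s
          exact map_zero (hirschIntegrand A n s)
        rw [e]
        exact integrable_zero _ _ _⟩
      add_mem' := fun {x y} hx hy => by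
        obtain ⟨hx, ix⟩ := hx
        obtain ⟨hy, iy⟩ := hy
        refine ⟨Submodule.add_mem _ hx hy, fun k => ?_⟩
        have e : (fun s => hirschIntegrand A n s ⟨x + y, Submodule.add_mem _ hx hy⟩) =
            fun s => hirschIntegrand A n s ⟨x, hx⟩ + hirschIntegrand A n s ⟨y, hy⟩ := by
          funext s
          exact map_add (hirschIntegrand A n s) ⟨x, hx⟩ ⟨y, hy⟩
        rw [e]
        exact (ix k).add (iy k)
      smul_mem' := fun c x hx => by
        obtain ⟨hx, ix⟩ := hx
        refine ⟨Submodule.smul_mem _ c hx, fun k => ?_⟩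
        have e : (fun s => hirschIntegrand A n s ⟨c • x, Submodule.smul_mem _ c hx⟩) =
            fun s => c • hirschIntegrand A n s ⟨x, hx⟩ := by
          funext s
          exact map_smul (hirschIntegrand A n s) c ⟨x, hx⟩
        rw [e]
        exact (ix k).smul c }
  toFun :=
    { toFun := fun x => a • (x : X) + μ.integral fun s => hirschIntegrand A n s ⟨x, x.2.1⟩
      map_add' := fun x y => by
        have e : (fun s => hirschIntegrand A n s ⟨((x + y : _) : X), (x + y).2.1⟩) =
            fun s => hirschIntegrand A n s ⟨x, x.2.1⟩ + hirschIntegrand A n s ⟨y, y.2.1⟩ := by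
          funext s
          exact map_add (hirschIntegrand A n s) ⟨x, x.2.1⟩ ⟨y, y.2.1⟩
        have e' : (μ.integral fun s => hirschIntegrand A n s ⟨((x + y : _) : X), (x + y).2.1⟩) =
            (μ.integral fun s => hirschIntegrand A n s ⟨x, x.2.1⟩) +
              μ.integral fun s => hirschIntegrand A n s ⟨y, y.2.1⟩ := by
          rw [e, ComplexRadon.integral, ComplexRadon.integral, ComplexRadon.integral,
            ← Finset.sum_add_distrib]
          refine Finset.sum_congr rfl fun k _ => ?_
          rw [integral_add (x.2.2 k) (y.2.2 k), smul_add]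
        rw [e', Submodule.coe_add, smul_add]
        abel
      map_smul' := fun c x => by
        have e : (fun s => hirschIntegrand A n s ⟨((c • x : _) : X), (c • x).2.1⟩) =
            fun s => c • hirschIntegrand A n s ⟨x, x.2.1⟩ := by
          funext s
          exact map_smul (hirschIntegrand A n s) c ⟨x, x.2.1⟩
        have e' : (μ.integral fun s => hirschIntegrand A n s ⟨((c • x : _) : X), (c • x).2.1⟩) =
            c • μ.integral fun s => hirschIntegrand A n s ⟨x, x.2.1⟩ := by
          rw [e, ComplexRadon.integral, ComplexRadon.integral, Finset.smul_sum]
          refine Finset.sum_congr rfl fun k _ => ?_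
          rw [integral_smul, smul_comm]
        rw [e', Submodule.coe_smul, smul_add, smul_comm a c]
        rfl }

/-! ### The holomorphic calculus -/

/-- The class `H₀^∞` of the sector of half-angle `φ`. -/
def H0 (φ : ℝ) : Set (ℂ → ℂ) :=
  {g | DifferentiableOn ℂ g (sector φ) ∧ ∃ C s : ℝ, 0 < s ∧
    ∀ z ∈ sector φ, ‖g z‖ ≤ C * min (‖z‖ ^ s) (‖z‖ ^ (-s))}

/-- `(2πi)⁻¹ ∫_Γ g(z) (z - A)⁻¹ dz`, where `Γ` is the boundary of the sector of half-angle `θ`,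
oriented downward: in along the ray `arg z = θ` and out along the ray `arg z = -θ`. -/
def holCalc (A : X →ₗ.[ℂ] X) (θ : ℝ) (g : ℂ → ℂ) : X →L[ℂ] X :=
  let e : ℂ := Complex.exp (θ * Complex.I)
  let e' : ℂ := Complex.exp (-(θ * Complex.I))
  (1 / (2 * Real.pi * Complex.I) : ℂ) •
    ((∫ r in Ioi (0 : ℝ), (g (r * e') * e') • resolvent A (r * e')) -
      ∫ r in Ioi (0 : ℝ), (g (r * e) * e) • resolvent A (r * e))

/-- `τ(z) = z (1 + z)^(-2)`. -/
def tau (z : ℂ) : ℂ := z / (1 + z) ^ 2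

/-- The extended holomorphic calculus: `f_hol(A) = τ(A)^(-(n+1)) (τ^(n+1) f)(A)`, where `τ(A)` and
`(τ^(n+1) f)(A)` are contour integrals over the boundary of the sector of half-angle `θ`. -/
def holOp (A : X →ₗ.[ℂ] X) (θ : ℝ) (n : ℕ) (f : ℂ → ℂ) : X →ₗ.[ℂ] X :=
  opComp (ofBdd (holCalc A θ tau ^ (n + 1))).inverse
    (ofBdd (holCalc A θ fun z => tau z ^ (n + 1) * f z))

end SectorialCalculus

end

open SectorialCalculus

noncomputable section

namespace SectorialCalculus

open Filter Topology

section Operators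

variable {X : Type*} [NormedAddCommGroup X] [NormedSpace ℂ X] {A : X →ₗ.[ℂ] X}

/-! ### Resolvents -/

theorem IsBddInverse.unique {B : X →ₗ.[ℂ] X} {R S : X →L[ℂ] X} (hR : IsBddInverse B R)
    (hS : IsBddInverse B S) : R = S := by
  ext y
  obtain ⟨h, hy⟩ := hS.1 y
  have := hR.2 ⟨S y, h⟩
  rwa [hy] at this

theorem IsBddInverse.bddInv_eq {B : X →ₗ.[ℂ] X} {R : X →L[ℂ] X} (hR : IsBddInverse B R) :
    bddInv B = R := by
  have h : ∃ R, IsBddInverse B R := ⟨R, hR⟩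
  rw [bddInv, dif_pos h]
  exact h.choose_spec.unique hR

theorem isBddInverse_affineOp_iff {c d : ℂ} {R : X →L[ℂ] X} :
    IsBddInverse (affineOp A c d) R ↔
      (∀ y, ∃ h : R y ∈ A.domain, c • R y + d • A ⟨R y, h⟩ = y) ∧
        ∀ x : A.domain, R (c • (x : X) + d • A x) = x := Iff.rfl

theorem resolvent_spec {z : ℂ} (hz : z ∈ resolventSet A) :
    IsBddInverse (affineOp A z (-1)) (resolvent A z) := by
  obtain ⟨R, hR⟩ := hz
  rw [resolvent, hR.bddInv_eq]
  exact hR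

theorem resolvent_mem {z : ℂ} (hz : z ∈ resolventSet A) (y : X) :
    resolvent A z y ∈ A.domain :=
  ((isBddInverse_affineOp_iff.1 (resolvent_spec hz)).1 y).1

theorem apply_resolvent {z : ℂ} (hz : z ∈ resolventSet A) (y : X) :
    A ⟨resolvent A z y, resolvent_mem hz y⟩ = z • resolvent A z y - y := by
  obtain ⟨h, e⟩ := (isBddInverse_affineOp_iff.1 (resolvent_spec hz)).1 y
  rw [neg_one_smul, ← sub_eq_add_neg] at e
  rw [eq_sub_iff_add_eq, add_comm, ← eq_sub_iff_add_eq]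
  exact e.symm

theorem resolvent_apply_sub {z : ℂ} (hz : z ∈ resolventSet A) (x : A.domain) :
    resolvent A z (z • (x : X) - A x) = x := by
  have := (isBddInverse_affineOp_iff.1 (resolvent_spec hz)).2 x
  rwa [neg_one_smul, ← sub_eq_add_neg] at this

/-- The resolvent identity. -/
theorem resolvent_sub_resolvent {z w : ℂ} (hz : z ∈ resolventSet A) (hw : w ∈ resolventSet A) :
    resolvent A z - resolvent A w = (w - z) • (resolvent A z * resolvent A w) := by
  ext y
  have h := resolvent_apply_sub hz ⟨resolvent A w y, resolvent_mem hw y⟩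
  rw [apply_resolvent hw] at h
  simp only [map_sub, map_smul] at h
  simp only [sub_apply, smul_apply,
    mul_apply_eq_comp]
  rw [sub_smul]
  linear_combination (norm := module) h

theorem commute_resolvent {z w : ℂ} (hz : z ∈ resolventSet A) (hw : w ∈ resolventSet A) :
    Commute (resolvent A z) (resolvent A w) := by
  by_cases h : z = w
  · rw [h]
  have h1 := resolvent_sub_resolvent hz hw
  have h2 := resolvent_sub_resolvent hw hz
  have h3 : (w - z) • (resolvent A z * resolvent A w) =
      (w - z) • (resolvent A w * resolvent A z) := by
    rw [← h1, ← neg_sub z w, neg_smul, ← h2, neg_sub]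
  exact smul_right_injective _ (sub_ne_zero.2 (Ne.symm h)) h3

variable [CompleteSpace X]

theorem isBddInverse_of_norm_lt {z w : ℂ} (hz : z ∈ resolventSet A)
    (h : ‖(w - z) • resolvent A z‖ < 1) :
    IsBddInverse (affineOp A w (-1))
      (resolvent A z * Ring.inverse (1 + (w - z) • resolvent A z)) := by
  have hu : IsUnit (1 + (w - z) • resolvent A z) := by
    have := isUnit_one_sub_of_norm_lt_one (x := -((w - z) • resolvent A z)) (by rwa [norm_neg])
    rwa [sub_neg_eq_add] at this
  obtain ⟨U, hU⟩ := hu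
  rw [← hU, Ring.inverse_unit]
  have hc : Commute (resolvent A z) (U : X →L[ℂ] X) := by
    rw [hU]
    exact (Commute.one_right _).add_right ((Commute.refl _).smul_right _)
  have hc' : resolvent A z * (↑U⁻¹ : X →L[ℂ] X) = ↑U⁻¹ * resolvent A z := hc.units_inv_right
  refine isBddInverse_affineOp_iff.2 ⟨fun y => ?_, fun x => ?_⟩
  · refine ⟨resolvent_mem hz _, ?_⟩
    have e := apply_resolvent hz ((↑U⁻¹ : X →L[ℂ] X) y)
    have e2 : (U : X →L[ℂ] X) ((↑U⁻¹ : X →L[ℂ] X) y) = y := by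
      rw [← mul_apply_eq_comp, Units.mul_inv]; rfl
    rw [hU] at e2
    simp only [add_apply, one_apply_eq_self,
      smul_apply] at e2
    simp only [mul_apply_eq_comp]
    rw [e]
    linear_combination (norm := module) e2
  · rw [hc']
    have e : resolvent A z (w • (x : X) + (-1 : ℂ) • A x) = (U : X →L[ℂ] X) x := by
      have h1 := resolvent_apply_sub hz x
      rw [hU]
      simp only [map_sub, map_smul, map_add] at h1 ⊢
      simp only [add_apply, one_apply_eq_self,
        smul_apply]
      linear_combination (norm := module) h1
    rw [mul_apply_eq_comp, e, ← mul_apply_eq_comp, Units.inv_mul]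
    rfl

theorem differentiableAt_resolvent {z : ℂ} (hz : z ∈ resolventSet A) :
    DifferentiableAt ℂ (resolvent A) z := by
  have hc : Continuous fun w : ℂ => ‖(w - z) • resolvent A z‖ := by fun_prop
  have hev : ∀ᶠ w in 𝓝 z, ‖(w - z) • resolvent A z‖ < 1 :=
    hc.continuousAt.eventually_lt_const (by simp)
  have he : resolvent A =ᶠ[𝓝 z]
      fun w => resolvent A z * Ring.inverse (1 + (w - z) • resolvent A z) := by
    filter_upwards [hev] with w hw
    exact (isBddInverse_of_norm_lt hz hw).bddInv_eq
  refine DifferentiableAt.congr_of_eventuallyEq ?_ he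
  refine (differentiableAt_const _).mul ?_
  have h1 : DifferentiableAt ℂ (Ring.inverse : (X →L[ℂ] X) → _)
      (1 + (z - z) • resolvent A z) := by
    simpa using differentiableAt_inverse (𝕜 := ℂ) (isUnit_one (M := X →L[ℂ] X))
  exact DifferentiableAt.comp (g := (Ring.inverse : (X →L[ℂ] X) → _))
    (f := fun w : ℂ => 1 + (w - z) • resolvent A z) z h1 (by fun_prop)

theorem norm_resolvent_le_two_mul {z w : ℂ} (hz : z ∈ resolventSet A)
    (h : ‖w - z‖ * ‖resolvent A z‖ ≤ 1 / 2) :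
    w ∈ resolventSet A ∧ ‖resolvent A w‖ ≤ 2 * ‖resolvent A z‖ := by
  have hw : w ∈ resolventSet A :=
    ⟨_, isBddInverse_of_norm_lt hz (by rw [norm_smul]; linarith)⟩
  refine ⟨hw, ?_⟩
  have h1 := resolvent_sub_resolvent hz hw
  have h2 : ‖resolvent A w‖ ≤ ‖resolvent A z‖ + ‖resolvent A z - resolvent A w‖ := by
    have := norm_sub_le (resolvent A z) (resolvent A z - resolvent A w)
    rwa [sub_sub_cancel] at this
  have h3 : ‖resolvent A z - resolvent A w‖ ≤ 1 / 2 * ‖resolvent A w‖ := by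
    rw [h1, norm_smul]
    calc ‖w - z‖ * ‖resolvent A z * resolvent A w‖
        ≤ ‖w - z‖ * (‖resolvent A z‖ * ‖resolvent A w‖) := by gcongr; exact norm_mul_le _ _
      _ = (‖w - z‖ * ‖resolvent A z‖) * ‖resolvent A w‖ := by ring
      _ ≤ _ := by gcongr
  linarith

end Operators

/-! ### The operators `(1 + s A)⁻¹` -/

section StieltjesResolvent

variable {X : Type*} [NormedAddCommGroup X] [NormedSpace ℂ X] {A : X →ₗ.[ℂ] X}

theorem IsSectorial.neg_inv_mem (hA : IsSectorial A) {s : ℝ≥0} (hs : s ≠ 0) :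
    (-((s : ℝ) : ℂ)⁻¹) ∈ resolventSet A := by
  have := hA.neg_mem (-(s : ℝ)⁻¹) (by
    have : (0 : ℝ) < s := by positivity
    simpa using this)
  simpa using this

theorem stRes_zero : stRes A 0 = 1 := by simp [stRes]

theorem IsSectorial.isBddInverse_smul_resolvent (hA : IsSectorial A) {s : ℝ≥0} (hs : s ≠ 0) :
    IsBddInverse (affineOp A 1 ((s : ℝ) : ℂ))
      ((-((s : ℝ) : ℂ)⁻¹) • resolvent A (-((s : ℝ) : ℂ)⁻¹)) := by
  have hz := hA.neg_inv_mem hs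
  have hs' : ((s : ℝ) : ℂ) ≠ 0 := by exact_mod_cast hs
  refine (isBddInverse_affineOp_iff.2 ⟨fun y => ?_, fun x => ?_⟩)
  · have hd := resolvent_mem hz y
    refine ⟨A.domain.smul_mem _ hd, ?_⟩
    have e : A ⟨(-((s : ℝ) : ℂ)⁻¹) • resolvent A (-((s : ℝ) : ℂ)⁻¹) y, A.domain.smul_mem _ hd⟩ =
        (-((s : ℝ) : ℂ)⁻¹) • A ⟨resolvent A (-((s : ℝ) : ℂ)⁻¹) y, hd⟩ := A.map_smul _ ⟨_, hd⟩
    simp only [smul_apply]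
    rw [e, apply_resolvent hz]
    match_scalars <;> field_simp
    ring
  · have h := resolvent_apply_sub hz x
    simp only [map_sub, map_add, map_smul, smul_apply] at h ⊢
    rw [one_smul, smul_smul, mul_neg, mul_inv_cancel₀ hs', neg_one_smul,
      ← sub_eq_add_neg]
    exact h

theorem IsSectorial.stRes_eq (hA : IsSectorial A) {s : ℝ≥0} (hs : s ≠ 0) :
    stRes A s = (-((s : ℝ) : ℂ)⁻¹) • resolvent A (-((s : ℝ) : ℂ)⁻¹) := by
  rw [stRes, if_neg hs]
  exact (hA.isBddInverse_smul_resolvent hs).bddInv_eq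

theorem IsSectorial.stRes_mem (hA : IsSectorial A) {s : ℝ≥0} (hs : s ≠ 0) (y : X) :
    stRes A s y ∈ A.domain := by
  rw [hA.stRes_eq hs]
  exact A.domain.smul_mem _ (resolvent_mem (hA.neg_inv_mem hs) y)

theorem IsSectorial.isBddInverse_stRes (hA : IsSectorial A) {s : ℝ≥0} (hs : s ≠ 0) :
    IsBddInverse (affineOp A 1 ((s : ℝ) : ℂ)) (stRes A s) := by
  rw [hA.stRes_eq hs]
  exact hA.isBddInverse_smul_resolvent hs

theorem IsSectorial.smul_apply_stRes (hA : IsSectorial A) {s : ℝ≥0} (hs : s ≠ 0) (y : X)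
    (h : stRes A s y ∈ A.domain) :
    ((s : ℝ) : ℂ) • A ⟨stRes A s y, h⟩ = y - stRes A s y := by
  obtain ⟨_, e⟩ := (isBddInverse_affineOp_iff.1 (hA.isBddInverse_stRes hs)).1 y
  rw [one_smul] at e
  rw [eq_sub_iff_add_eq, add_comm]
  exact e

theorem IsSectorial.smul_stRes_apply (hA : IsSectorial A) {s : ℝ≥0} (hs : s ≠ 0)
    (x : A.domain) : ((s : ℝ) : ℂ) • stRes A s (A x) = x - stRes A s x := by
  have e := (isBddInverse_affineOp_iff.1 (hA.isBddInverse_stRes hs)).2 x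
  rw [one_smul, map_add, map_smul] at e
  rw [eq_sub_iff_add_eq, add_comm]
  exact e

theorem IsSectorial.apply_stRes_comm (hA : IsSectorial A) (s : ℝ≥0) (x : X) (hx : x ∈ A.domain) :
    ∃ h : stRes A s x ∈ A.domain, A ⟨stRes A s x, h⟩ = stRes A s (A ⟨x, hx⟩) := by
  by_cases hs : s = 0
  · subst hs
    simp only [stRes_zero]
    exact ⟨hx, rfl⟩
  have hs' : ((s : ℝ) : ℂ) ≠ 0 := by exact_mod_cast hs
  refine ⟨hA.stRes_mem hs x, ?_⟩
  apply smul_right_injective X hs'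
  simp only
  rw [hA.smul_apply_stRes hs, hA.smul_stRes_apply hs]

theorem IsSectorial.stRes_injective (hA : IsSectorial A) (s : ℝ≥0) :
    Function.Injective (stRes A s) := by
  by_cases hs : s = 0
  · subst hs
    rw [stRes_zero]
    exact Function.injective_id
  rw [injective_iff_map_eq_zero]
  intro x hx
  have h := hA.smul_apply_stRes hs x (hA.stRes_mem hs x)
  have e : (⟨stRes A s x, hA.stRes_mem hs x⟩ : A.domain) = 0 := Subtype.ext hx
  rw [e, LinearPMap.map_zero, smul_zero, hx, sub_zero] at h
  exact h.symm

theorem IsSectorial.one_sub_stRes_injective (hA : IsSectorial A) (hinj : Function.Injective A)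
    {s : ℝ≥0} (hs : s ≠ 0) : Function.Injective ⇑(1 - stRes A s) := by
  rw [injective_iff_map_eq_zero]
  intro x hx
  have hs' : ((s : ℝ) : ℂ) ≠ 0 := by exact_mod_cast hs
  have hx' : x - stRes A s x = 0 := hx
  have h := hA.smul_apply_stRes hs x (hA.stRes_mem hs x)
  rw [hx', smul_eq_zero_iff_right hs'] at h
  have h2 := hinj (h.trans (LinearPMap.map_zero A).symm)
  have h3 : stRes A s x = 0 := congrArg Subtype.val h2
  rw [h3, sub_zero] at hx'
  exact hx'

theorem IsSectorial.exists_norm_stRes_le (hA : IsSectorial A) :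
    ∃ M : ℝ, 1 ≤ M ∧ ∀ s, ‖stRes A s‖ ≤ M := by
  obtain ⟨M, hM⟩ := hA.bound
  refine ⟨max M 1, le_max_right _ _, fun s => ?_⟩
  by_cases hs : s = 0
  · subst hs
    rw [stRes_zero]
    exact ContinuousLinearMap.norm_id_le.trans (le_max_right _ _)
  · exact (hM s (pos_iff_ne_zero.2 hs)).trans (le_max_left _ _)

/-- The resolvent identity, for `(z - A)⁻¹` and `(1 + s A)⁻¹`. -/
theorem IsSectorial.resolvent_mul_stRes (hA : IsSectorial A) {z : ℂ} (hz : z ∈ resolventSet A)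
    (s : ℝ≥0) : (1 + z * ((s : ℝ) : ℂ)) • (resolvent A z * stRes A s) =
      resolvent A z + ((s : ℝ) : ℂ) • stRes A s := by
  by_cases hs : s = 0
  · subst hs
    simp [stRes_zero]
  have hs' : ((s : ℝ) : ℂ) ≠ 0 := by exact_mod_cast hs
  have h := resolvent_sub_resolvent hz (hA.neg_inv_mem hs)
  rw [hA.stRes_eq hs, mul_smul_comm, smul_smul, smul_smul]
  have e1 : (1 + z * ((s : ℝ) : ℂ)) * -((s : ℝ) : ℂ)⁻¹ = -((s : ℝ) : ℂ)⁻¹ - z := by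
    field_simp; ring
  have e2 : ((s : ℝ) : ℂ) * -((s : ℝ) : ℂ)⁻¹ = -1 := by field_simp
  rw [e1, e2, ← h, neg_one_smul, sub_eq_add_neg]

theorem IsSectorial.commute_resolvent_stRes (hA : IsSectorial A) {z : ℂ}
    (hz : z ∈ resolventSet A) (s : ℝ≥0) : Commute (resolvent A z) (stRes A s) := by
  by_cases hs : s = 0
  · subst hs
    rw [stRes_zero]
    exact Commute.one_right _
  · rw [hA.stRes_eq hs]
    exact (commute_resolvent hz (hA.neg_inv_mem hs)).smul_right _

theorem IsSectorial.commute_stRes (hA : IsSectorial A) (s t : ℝ≥0) :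
    Commute (stRes A s) (stRes A t) := by
  by_cases hs : s = 0
  · subst hs
    rw [stRes_zero]
    exact Commute.one_left _
  · rw [hA.stRes_eq hs]
    exact (hA.commute_resolvent_stRes (hA.neg_inv_mem hs) t).smul_left _

/-! ### Powers of `A` -/

theorem opPow_apply_comm {S : X →L[ℂ] X}
    (hS : ∀ x (hx : x ∈ A.domain), ∃ h : S x ∈ A.domain, A ⟨S x, h⟩ = S (A ⟨x, hx⟩)) (n : ℕ) :
    ∀ x (hx : x ∈ (opPow A n).domain), ∃ h : S x ∈ (opPow A n).domain,
      opPow A n ⟨S x, h⟩ = S (opPow A n ⟨x, hx⟩) := by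
  induction n with
  | zero => exact fun x hx => ⟨trivial, rfl⟩
  | succ n ih =>
    intro x hx
    obtain ⟨h1, h2⟩ := mem_opComp_domain.1 hx
    obtain ⟨h3, h4⟩ := hS x h1
    obtain ⟨h5, h6⟩ := ih _ h2
    have h7 : A ⟨S x, h3⟩ ∈ (opPow A n).domain := by rw [h4]; exact h5
    refine ⟨mem_opComp_domain.2 ⟨h3, h7⟩, ?_⟩
    have e1 : opPow A (n + 1) ⟨S x, mem_opComp_domain.2 ⟨h3, h7⟩⟩ =
      opPow A n ⟨A ⟨S x, h3⟩, h7⟩ := rfl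
    have e2 : opPow A (n + 1) ⟨x, hx⟩ = opPow A n ⟨A ⟨x, h1⟩, h2⟩ := rfl
    rw [e1, e2, ← h6]
    congr 1
    exact Subtype.ext h4

theorem IsSectorial.apply_stRes_pow_comm (hA : IsSectorial A) (s : ℝ≥0) (m : ℕ) :
    ∀ x (hx : x ∈ A.domain), ∃ h : (stRes A s ^ m) x ∈ A.domain,
      A ⟨(stRes A s ^ m) x, h⟩ = (stRes A s ^ m) (A ⟨x, hx⟩) := by
  induction m with
  | zero => exact fun x hx => ⟨hx, rfl⟩
  | succ m ih =>
    intro x hx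
    obtain ⟨h1, h2⟩ := ih x hx
    obtain ⟨h3, h4⟩ := hA.apply_stRes_comm s _ h1
    rw [pow_succ']
    exact ⟨h3, h4.trans (congrArg _ h2)⟩

theorem IsSectorial.hirschIntegrand_eq (hA : IsSectorial A) (n : ℕ) (s : ℝ≥0)
    (x : (opPow A n).domain) :
    hirschIntegrand A n s x = (stRes A s ^ n) (opPow A n x) :=
  (opPow_apply_comm (hA.apply_stRes_pow_comm s n) n x x.2).2

theorem IsSectorial.stRes_pow_opPow (hA : IsSectorial A) {s : ℝ≥0} (hs : s ≠ 0) (n : ℕ) :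
    ∀ x (hx : x ∈ (opPow A n).domain),
      ((s : ℝ) : ℂ) ^ n • (stRes A s ^ n) (opPow A n ⟨x, hx⟩) = ((1 - stRes A s) ^ n) x := by
  induction n with
  | zero =>
    intro x hx
    simp only [pow_zero, one_smul]
    rfl
  | succ n ih =>
    intro x hx
    obtain ⟨h1, h2⟩ := mem_opComp_domain.1 hx
    have e2 : opPow A (n + 1) ⟨x, hx⟩ = opPow A n ⟨A ⟨x, h1⟩, h2⟩ := rfl
    have hc : Commute (stRes A s) ((1 - stRes A s) ^ n) :=
      ((Commute.one_right _).sub_right (Commute.refl _)).pow_right n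
    calc ((s : ℝ) : ℂ) ^ (n + 1) • (stRes A s ^ (n + 1)) (opPow A (n + 1) ⟨x, hx⟩)
        = ((s : ℝ) : ℂ) • stRes A s
            (((s : ℝ) : ℂ) ^ n • (stRes A s ^ n) (opPow A n ⟨A ⟨x, h1⟩, h2⟩)) := by
          rw [e2, pow_succ' (stRes A s), mul_apply_eq_comp, map_smul, smul_smul,
            ← pow_succ']
      _ = ((s : ℝ) : ℂ) • stRes A s (((1 - stRes A s) ^ n) (A ⟨x, h1⟩)) := by rw [ih]
      _ = ((1 - stRes A s) ^ n) (((s : ℝ) : ℂ) • stRes A s (A ⟨x, h1⟩)) := by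
          rw [← mul_apply_eq_comp, hc.eq, mul_apply_eq_comp, map_smul]
      _ = _ := by rw [hA.smul_stRes_apply hs, pow_succ, mul_apply_eq_comp]; rfl

theorem IsSectorial.stRes_pow_mem_opPow (hA : IsSectorial A) {s : ℝ≥0} (hs : s ≠ 0) (n : ℕ)
    (x : X) : (stRes A s ^ n) x ∈ (opPow A n).domain := by
  induction n generalizing x with
  | zero => trivial
  | succ n ih =>
    have hs' : ((s : ℝ) : ℂ) ≠ 0 := by exact_mod_cast hs
    rw [pow_succ', mul_apply_eq_comp]
    refine mem_opComp_domain.2 ⟨hA.stRes_mem hs _, ?_⟩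
    have e : stRes A s ((stRes A s ^ n) x) = (stRes A s ^ n) (stRes A s x) := by
      rw [← mul_apply_eq_comp, ← mul_apply_eq_comp, ← pow_succ', ← pow_succ]
    have h : ((s : ℝ) : ℂ) • A ⟨stRes A s ((stRes A s ^ n) x), hA.stRes_mem hs _⟩ =
        (stRes A s ^ n) (x - stRes A s x) := by
      rw [hA.smul_apply_stRes hs, e, map_sub]
    have h' : A ⟨stRes A s ((stRes A s ^ n) x), hA.stRes_mem hs _⟩ =
        ((s : ℝ) : ℂ)⁻¹ • (stRes A s ^ n) (x - stRes A s x) := by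
      rw [← h, inv_smul_smul₀ hs']
    rw [h']
    exact Submodule.smul_mem _ _ (ih _)

/-! ### Strong convergence `(1 + s A)⁻¹ → 1` as `s → 0` -/

theorem IsSectorial.tendsto_stRes (hA : IsSectorial A) {s : ℕ → ℝ≥0}
    (hs : ∀ k, s k ≠ 0) (hs0 : Tendsto s atTop (𝓝 0)) (x : X) :
    Tendsto (fun k => stRes A (s k) x) atTop (𝓝 x) := by
  obtain ⟨M, hM1, hM⟩ := hA.exists_norm_stRes_le
  have hdom : ∀ y : A.domain, Tendsto (fun k => stRes A (s k) y) atTop (𝓝 (y : X)) := by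
    intro y
    rw [tendsto_iff_norm_sub_tendsto_zero]
    have hb : Tendsto (fun k => ((s k : ℝ≥0) : ℝ) * (M * ‖A y‖)) atTop (𝓝 0) := by
      have : Tendsto (fun k => ((s k : ℝ≥0) : ℝ)) atTop (𝓝 0) := (NNReal.continuous_coe.tendsto 0).comp hs0
      simpa using this.mul_const (M * ‖A y‖)
    refine squeeze_zero (fun _ => norm_nonneg _) (fun k => ?_) hb
    rw [norm_sub_rev, ← hA.smul_stRes_apply (hs k), norm_smul]
    have h1 : ‖(((s k : ℝ≥0) : ℝ) : ℂ)‖ = ((s k : ℝ≥0) : ℝ) := by simp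
    rw [h1]
    gcongr
    exact ((stRes A (s k)).le_opNorm _).trans (by gcongr; exact hM _)
  rw [Metric.tendsto_atTop]
  intro ε hε
  obtain ⟨y, hy, hxy⟩ := Metric.mem_closure_iff.1 (hA.dense x) (ε / (2 * (M + 1))) (by positivity)
  obtain ⟨N, hN⟩ := Metric.tendsto_atTop.1 (hdom ⟨y, hy⟩) (ε / 2) (by positivity)
  refine ⟨N, fun k hk => ?_⟩
  have h1 := hN k hk
  have h2 : dist (stRes A (s k) x) (stRes A (s k) y) ≤ M * dist x y := by
    rw [dist_eq_norm, dist_eq_norm, ← map_sub]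
    exact ((stRes A (s k)).le_opNorm _).trans (by gcongr; exact hM _)
  have h3 := dist_triangle4 (stRes A (s k) x) (stRes A (s k) y) y x
  have h4 : (M + 1) * dist x y < ε / 2 := by
    rw [lt_div_iff₀ (by positivity)] at hxy
    linarith
  rw [dist_comm y x] at h3
  simp only at h1
  linarith

theorem IsSectorial.tendsto_stRes_pow (hA : IsSectorial A) {s : ℕ → ℝ≥0}
    (hs : ∀ k, s k ≠ 0) (hs0 : Tendsto s atTop (𝓝 0)) (n : ℕ) (x : X) :
    Tendsto (fun k => (stRes A (s k) ^ n) x) atTop (𝓝 x) := by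
  obtain ⟨M, hM1, hM⟩ := hA.exists_norm_stRes_le
  induction n with
  | zero => exact tendsto_const_nhds
  | succ n ih =>
    have h1 := tendsto_iff_norm_sub_tendsto_zero.1 ih
    have h2 := tendsto_iff_norm_sub_tendsto_zero.1 (hA.tendsto_stRes hs hs0 x)
    rw [tendsto_iff_norm_sub_tendsto_zero]
    have h3 := (h1.const_mul M).add h2
    rw [mul_zero, add_zero] at h3
    refine squeeze_zero (fun _ => norm_nonneg _) (fun k => ?_) h3
    have e : (stRes A (s k) ^ (n + 1)) x - x =
        stRes A (s k) ((stRes A (s k) ^ n) x - x) + (stRes A (s k) x - x) := by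
      rw [pow_succ', mul_apply_eq_comp, map_sub]; abel
    rw [e]
    refine (norm_add_le _ _).trans (add_le_add_left ?_ _)
    exact ((stRes A (s k)).le_opNorm _).trans (by gcongr; exact hM _)

end StieltjesResolvent

/-! ### Sectors and rays -/

theorem mem_sector_iff {φ : ℝ} (h0 : 0 ≤ φ) (hπ : φ ≤ Real.pi) {z : ℂ} :
    z ∈ sector φ ↔ ‖z‖ * Real.cos φ < z.re := by
  by_cases hz : z = 0
  · simp [sector, hz]
  have hn : 0 < ‖z‖ := norm_pos_iff.2 hz
  have h1 : |z.arg| < φ ↔ Real.cos φ < Real.cos |z.arg| :=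
    (Real.strictAntiOn_cos.lt_iff_gt ⟨h0, hπ⟩ ⟨abs_nonneg _, Complex.abs_arg_le_pi z⟩).symm
  rw [Real.cos_abs, Complex.cos_arg hz, lt_div_iff₀ hn, mul_comm] at h1
  simp [sector, hz, h1]

theorem notMem_closedSector_iff {ω : ℝ} (h0 : 0 ≤ ω) (hπ : ω ≤ Real.pi) {z : ℂ} :
    z ∉ closedSector ω ↔ z.re < ‖z‖ * Real.cos ω := by
  by_cases hz : z = 0
  · simp [closedSector, hz, h0]
  have hn : 0 < ‖z‖ := norm_pos_iff.2 hz
  have h1 : ω < |z.arg| ↔ Real.cos |z.arg| < Real.cos ω :=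
    (Real.strictAntiOn_cos.lt_iff_gt ⟨abs_nonneg _, Complex.abs_arg_le_pi z⟩ ⟨h0, hπ⟩).symm
  rw [Real.cos_abs, Complex.cos_arg hz, div_lt_iff₀ hn, mul_comm] at h1
  simp [closedSector, h1]

theorem isOpen_sector {φ : ℝ} (h0 : 0 ≤ φ) (hπ : φ ≤ Real.pi) : IsOpen (sector φ) := by
  have : sector φ = {z | ‖z‖ * Real.cos φ < z.re} := Set.ext fun z => mem_sector_iff h0 hπ
  rw [this]
  exact isOpen_lt (by fun_prop) Complex.continuous_re

theorem sector_subset_slitPlane {φ : ℝ} (hπ : φ ≤ Real.pi) : sector φ ⊆ Complex.slitPlane :=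
  fun z hz => Complex.mem_slitPlane_iff_arg.2
    ⟨fun h => by
      have h2 := hz.2
      rw [h, abs_of_pos Real.pi_pos] at h2
      linarith, hz.1⟩

theorem norm_ray {r : ℝ} (hr : 0 < r) (η : ℝ) : ‖(r : ℂ) * Complex.exp (η * Complex.I)‖ = r := by
  rw [norm_mul, Complex.norm_exp_ofReal_mul_I, mul_one, Complex.norm_real, Real.norm_eq_abs,
    abs_of_pos hr]

theorem re_ray (r η : ℝ) : ((r : ℂ) * Complex.exp (η * Complex.I)).re = r * Real.cos η := by
  rw [Complex.re_ofReal_mul, Complex.exp_ofReal_mul_I_re]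

theorem ray_mem_sector {φ η r : ℝ} (h0 : 0 ≤ φ) (hπ : φ ≤ Real.pi) (hr : 0 < r)
    (h : Real.cos φ < Real.cos η) : (r : ℂ) * Complex.exp (η * Complex.I) ∈ sector φ := by
  rw [mem_sector_iff h0 hπ, norm_ray hr, re_ray]
  gcongr

theorem ray_notMem_closedSector {ω η r : ℝ} (h0 : 0 ≤ ω) (hπ : ω ≤ Real.pi) (hr : 0 < r)
    (h : Real.cos η < Real.cos ω) : (r : ℂ) * Complex.exp (η * Complex.I) ∉ closedSector ω := by
  rw [notMem_closedSector_iff h0 hπ, norm_ray hr, re_ray]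
  gcongr

theorem cos_half_mul_le_norm_one_add {φ : ℝ} (h0 : 0 ≤ φ) (hπ : φ ≤ Real.pi) {w : ℂ}
    (hw : ‖w‖ * Real.cos φ ≤ w.re) : Real.cos (φ / 2) * (1 + ‖w‖) ≤ ‖1 + w‖ := by
  have hc : 0 ≤ Real.cos (φ / 2) := Real.cos_nonneg_of_mem_Icc ⟨by linarith, by linarith⟩
  refine abs_le_of_sq_le_sq' ?_ (norm_nonneg _) |>.2
  have h1 : ‖1 + w‖ ^ 2 = 1 + 2 * w.re + ‖w‖ ^ 2 := by
    rw [← Complex.normSq_eq_norm_sq, ← Complex.normSq_eq_norm_sq, Complex.normSq_apply,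
      Complex.normSq_apply]
    simp
    ring
  have h2 : Real.cos (φ / 2) ^ 2 = (1 + Real.cos φ) / 2 := by
    rw [Real.cos_sq]; ring_nf
  rw [mul_pow, h1, h2]
  nlinarith [sq_nonneg (1 - ‖w‖), Real.cos_le_one φ, norm_nonneg w]

theorem cos_half_pos {φ : ℝ} (h0 : 0 ≤ φ) (hπ : φ < Real.pi) : 0 < Real.cos (φ / 2) :=
  Real.cos_pos_of_mem_Ioo ⟨by linarith [Real.pi_pos], by linarith⟩

theorem cos_half_mul_le_norm_one_add_mul {φ : ℝ} (h0 : 0 ≤ φ) (hπ : φ ≤ Real.pi) {z : ℂ}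
    (hz : z ∈ sector φ) (s : ℝ≥0) :
    Real.cos (φ / 2) * (1 + ‖z‖ * s) ≤ ‖1 + z * ((s : ℝ) : ℂ)‖ := by
  have hz' := (mem_sector_iff h0 hπ).1 hz
  have hn : ‖z * ((s : ℝ) : ℂ)‖ = ‖z‖ * s := by simp
  rw [← hn]
  refine cos_half_mul_le_norm_one_add h0 hπ ?_
  rw [hn, Complex.re_mul_ofReal]
  nlinarith [s.coe_nonneg]

theorem one_add_mul_ne_zero {z : ℂ} (hz : z ∈ Complex.slitPlane) (s : ℝ≥0) :
    1 + z * ((s : ℝ) : ℂ) ≠ 0 := by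
  intro h
  have hre := congrArg Complex.re h
  have him := congrArg Complex.im h
  simp only [Complex.add_re, Complex.one_re, Complex.re_mul_ofReal, Complex.zero_re,
    Complex.add_im, Complex.one_im, Complex.im_mul_ofReal, Complex.zero_im, zero_add] at hre him
  rcases hz with hz | hz
  · nlinarith [mul_nonneg hz.le s.coe_nonneg]
  · rcases mul_eq_zero.1 him with h1 | h1
    · exact hz h1
    · rw [h1] at hre
      simp at hre

/-! ### Integrals along rays -/

theorem min_rpow_nonneg {r : ℝ} (hr : 0 ≤ r) (ε : ℝ) : 0 ≤ min (r ^ ε) (r ^ (-ε)) :=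
  le_min (Real.rpow_nonneg hr _) (Real.rpow_nonneg hr _)

theorem measurable_min_rpow_div (ε : ℝ) :
    Measurable fun r : ℝ => min (r ^ ε) (r ^ (-ε)) / r := by
  fun_prop

theorem integrableOn_min_rpow_div {ε : ℝ} (hε : 0 < ε) :
    IntegrableOn (fun r : ℝ => min (r ^ ε) (r ^ (-ε)) / r) (Ioi 0) := by
  rw [← Ioc_union_Ioi_eq_Ioi (zero_le_one (α := ℝ))]
  have hm := measurable_min_rpow_div ε
  refine IntegrableOn.union ?_ ?_
  · have h1 : IntegrableOn (fun r : ℝ => r ^ (ε - 1)) (Ioc 0 1) :=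
      (intervalIntegrable_iff_integrableOn_Ioc_of_le zero_le_one).1
        (intervalIntegral.intervalIntegrable_rpow' (by linarith))
    refine Integrable.mono' h1 hm.aestronglyMeasurable ?_
    refine (ae_restrict_iff' measurableSet_Ioc).2 (Eventually.of_forall fun r hr => ?_)
    rw [Real.norm_of_nonneg (div_nonneg (min_rpow_nonneg hr.1.le _) hr.1.le),
      Real.rpow_sub_one hr.1.ne']
    exact div_le_div_of_nonneg_right (min_le_left _ _) hr.1.le
  · have h1 : IntegrableOn (fun r : ℝ => r ^ (-ε - 1)) (Ioi 1) :=
      integrableOn_Ioi_rpow_of_lt (by linarith) zero_lt_one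
    refine Integrable.mono' h1 hm.aestronglyMeasurable ?_
    refine (ae_restrict_iff' measurableSet_Ioi).2 (Eventually.of_forall fun r hr => ?_)
    have hr0 : (0 : ℝ) < r := zero_lt_one.trans hr
    rw [Real.norm_of_nonneg (div_nonneg (min_rpow_nonneg hr0.le _) hr0.le),
      Real.rpow_sub_one hr0.ne']
    exact div_le_div_of_nonneg_right (min_le_right _ _) hr0.le

section Ray

variable {E : Type*} [NormedAddCommGroup E] [NormedSpace ℂ E]

/-- The integral of `F` along the ray of angle `η`, oriented from `0` to `∞`. -/
def rayIntegral (η : ℝ) (F : ℂ → E) : E :=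
  ∫ r in Ioi (0 : ℝ), Complex.exp (η * Complex.I) • F (r * Complex.exp (η * Complex.I))

/-- Integrability along the ray of angle `η`. -/
def RayIntegrable (η : ℝ) (F : ℂ → E) : Prop :=
  IntegrableOn (fun r : ℝ => Complex.exp (η * Complex.I) • F (r * Complex.exp (η * Complex.I)))
    (Ioi 0)

theorem rayIntegrable_of_norm_le {η : ℝ} {F : ℂ → E} {C ε : ℝ} (hε : 0 < ε)
    (hc : ∀ r : ℝ, 0 < r → ContinuousAt F (r * Complex.exp (η * Complex.I)))
    (hb : ∀ r : ℝ, 0 < r →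
      r * ‖F (r * Complex.exp (η * Complex.I))‖ ≤ C * min (r ^ ε) (r ^ (-ε))) :
    RayIntegrable η F := by
  refine Integrable.mono' ((integrableOn_min_rpow_div hε).const_mul C) ?_ ?_
  · refine ContinuousOn.aestronglyMeasurable (fun r hr => ?_) measurableSet_Ioi
    refine ContinuousAt.continuousWithinAt ?_
    refine ContinuousAt.const_smul ?_ _
    exact ContinuousAt.comp (g := F)
      (f := fun r : ℝ => (r : ℂ) * Complex.exp (η * Complex.I)) (hc r hr) (by fun_prop)
  · refine (ae_restrict_iff' measurableSet_Ioi).2 (Eventually.of_forall fun r hr => ?_)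
    rw [norm_smul, Complex.norm_exp_ofReal_mul_I, one_mul, ← mul_div_assoc,
      le_div_iff₀ (mem_Ioi.1 hr), mul_comm]
    exact hb r hr

theorem rayIntegral_congr {η : ℝ} {F G : ℂ → E}
    (h : ∀ r : ℝ, 0 < r →
      F (r * Complex.exp (η * Complex.I)) = G (r * Complex.exp (η * Complex.I))) :
    rayIntegral η F = rayIntegral η G :=
  setIntegral_congr_fun measurableSet_Ioi fun r hr => by simp only [h r hr]

theorem rayIntegral_add {η : ℝ} {F G : ℂ → E} (hF : RayIntegrable η F) (hG : RayIntegrable η G) :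
    rayIntegral η (fun z => F z + G z) = rayIntegral η F + rayIntegral η G := by
  simp only [rayIntegral, smul_add]
  exact integral_add hF hG

theorem rayIntegral_sub {η : ℝ} {F G : ℂ → E} (hF : RayIntegrable η F) (hG : RayIntegrable η G) :
    rayIntegral η (fun z => F z - G z) = rayIntegral η F - rayIntegral η G := by
  simp only [rayIntegral, smul_sub]
  exact integral_sub hF hG

theorem rayIntegral_clm {E' : Type*} [NormedAddCommGroup E'] [NormedSpace ℂ E'] [CompleteSpace E]
    [CompleteSpace E'] {η : ℝ} {F : ℂ → E} (L : E →L[ℂ] E') (hF : RayIntegrable η F) :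
    rayIntegral η (fun z => L (F z)) = L (rayIntegral η F) := by
  simp only [rayIntegral, ← map_smul]
  exact L.integral_comp_comm hF

theorem RayIntegrable.clm {E' : Type*} [NormedAddCommGroup E'] [NormedSpace ℂ E']
    {η : ℝ} {F : ℂ → E} (L : E →L[ℂ] E') (hF : RayIntegrable η F) :
    RayIntegrable η (fun z => L (F z)) := by
  simp only [RayIntegrable, ← map_smul]
  exact L.integrable_comp hF

theorem exp_add_mul_I (x η : ℝ) : Complex.exp ((x : ℂ) + η * Complex.I) =
    ((Real.exp x : ℝ) : ℂ) * Complex.exp (η * Complex.I) := by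
  rw [Complex.exp_add, Complex.ofReal_exp]

theorem range_exp_eq_Ioi : Real.exp '' univ = Ioi 0 := by
  rw [image_univ, Real.range_exp]

theorem exp_smul_ray_eq (η : ℝ) (F : ℂ → E) (x : ℝ) :
    |Real.exp x| • (Complex.exp (η * Complex.I) •
      F ((Real.exp x : ℝ) * Complex.exp (η * Complex.I))) =
    Complex.exp ((x : ℂ) + η * Complex.I) • F (Complex.exp ((x : ℂ) + η * Complex.I)) := by
  rw [exp_add_mul_I, abs_of_pos (Real.exp_pos x), mul_smul, Complex.coe_smul]

theorem rayIntegral_eq_integral_exp (η : ℝ) (F : ℂ → E) :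
    rayIntegral η F = ∫ x : ℝ,
      Complex.exp ((x : ℂ) + η * Complex.I) • F (Complex.exp ((x : ℂ) + η * Complex.I)) := by
  have h := integral_image_eq_integral_abs_deriv_smul MeasurableSet.univ
    (fun x _ => (Real.hasDerivAt_exp x).hasDerivWithinAt) Real.exp_injective.injOn
    (fun r : ℝ => Complex.exp (η * Complex.I) • F (r * Complex.exp (η * Complex.I)))
  rw [range_exp_eq_Ioi] at h
  rw [rayIntegral, h, setIntegral_univ]
  simp only [exp_smul_ray_eq]

theorem RayIntegrable.integrable_exp {η : ℝ} {F : ℂ → E} (hF : RayIntegrable η F) :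
    Integrable fun x : ℝ =>
      Complex.exp ((x : ℂ) + η * Complex.I) • F (Complex.exp ((x : ℂ) + η * Complex.I)) := by
  have h := (integrableOn_image_iff_integrableOn_abs_deriv_smul MeasurableSet.univ
    (fun x _ => (Real.hasDerivAt_exp x).hasDerivWithinAt) Real.exp_injective.injOn
    (fun r : ℝ => Complex.exp (η * Complex.I) • F (r * Complex.exp (η * Complex.I))))
  rw [range_exp_eq_Ioi] at h
  have h2 := h.1 hF
  rw [integrableOn_univ] at h2
  simpa only [exp_smul_ray_eq] using h2

/-- Cauchy's theorem on a sector: the ray may be rotated. -/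
theorem rayIntegral_eq_of_differentiable [CompleteSpace E] {α β : ℝ} (hαβ : α ≤ β) {F : ℂ → E}
    {C ε : ℝ} (hε : 0 < ε)
    (hd : ∀ η ∈ Icc α β, ∀ r : ℝ, 0 < r →
      DifferentiableAt ℂ F (r * Complex.exp (η * Complex.I)))
    (hb : ∀ η ∈ Icc α β, ∀ r : ℝ, 0 < r →
      r * ‖F (r * Complex.exp (η * Complex.I))‖ ≤ C * min (r ^ ε) (r ^ (-ε))) :
    rayIntegral α F = rayIntegral β F := by
  have hi : ∀ η ∈ Icc α β, RayIntegrable η F := fun η hη =>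
    rayIntegrable_of_norm_le hε (fun r hr => (hd η hη r hr).continuousAt) (hb η hη)
  set G : ℂ → E := fun w => Complex.exp w • F (Complex.exp w) with hG
  have hC : 0 ≤ C := by
    have := (mul_nonneg zero_le_one (norm_nonneg _)).trans (hb α ⟨le_rfl, hαβ⟩ 1 one_pos)
    simpa using this
  have hGb : ∀ η ∈ Icc α β, ∀ x : ℝ, ‖G (x + η * Complex.I)‖ ≤ C * Real.exp (-(ε * |x|)) := by
    intro η hη x
    have h := hb η hη (Real.exp x) (Real.exp_pos x)
    rw [← exp_add_mul_I, ← Real.exp_mul, ← Real.exp_mul] at h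
    have h2 : ‖G (x + η * Complex.I)‖ = Real.exp x * ‖F (Complex.exp (x + η * Complex.I))‖ := by
      rw [hG]
      simp only
      rw [norm_smul]
      congr 1
      rw [exp_add_mul_I, norm_ray (Real.exp_pos x)]
    rw [h2]
    refine h.trans ?_
    gcongr
    rcases abs_cases x with ⟨h3, _⟩ | ⟨h3, _⟩ <;> rw [h3]
    · refine (min_le_right _ _).trans (le_of_eq ?_)
      ring_nf
    · refine (min_le_left _ _).trans (le_of_eq ?_)
      ring_nf
  have hrect : ∀ R : ℝ, (∫ x : ℝ in -R..R, G (x + α * Complex.I)) -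
      (∫ x : ℝ in -R..R, G (x + β * Complex.I)) +
      Complex.I • (∫ y : ℝ in α..β, G (R + y * Complex.I)) -
      Complex.I • (∫ y : ℝ in α..β, G ((-R : ℝ) + y * Complex.I)) = 0 := by
    intro R
    have h := Complex.integral_boundary_rect_eq_zero_of_differentiableOn G ⟨-R, α⟩ ⟨R, β⟩ (by
      intro w hw
      refine DifferentiableAt.differentiableWithinAt ?_
      have hη : w.im ∈ Icc α β := by
        have := hw.2
        simpa [uIcc_of_le hαβ] using this
      have hF := hd w.im hη (Real.exp w.re) (Real.exp_pos _)
      rw [← exp_add_mul_I, Complex.re_add_im] at hF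
      exact Complex.differentiableAt_exp.smul
        (DifferentiableAt.comp w hF Complex.differentiableAt_exp))
    simpa using h
  have hvert : ∀ R : ℝ → ℝ, (∀ x, |R x| = |x|) →
      Tendsto (fun x => ∫ y : ℝ in α..β, G ((R x : ℝ) + y * Complex.I)) atTop (𝓝 0) := by
    intro R hR
    rw [tendsto_zero_iff_norm_tendsto_zero]
    have h0 : Tendsto (fun x : ℝ => C * Real.exp (-(ε * |x|)) * |β - α|) atTop (𝓝 0) := by
      have h1 : Tendsto (fun x : ℝ => ε * |x|) atTop atTop :=
        tendsto_abs_atTop_atTop.const_mul_atTop hε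
      have h2 := Real.tendsto_exp_neg_atTop_nhds_zero.comp h1
      simpa using (h2.const_mul C).mul_const |β - α|
    refine squeeze_zero (fun _ => norm_nonneg _) (fun x => ?_) h0
    refine intervalIntegral.norm_integral_le_of_norm_le_const fun y hy => ?_
    rw [uIoc_of_le hαβ] at hy
    rw [← hR x]
    exact hGb y (Ioc_subset_Icc_self hy) (R x)
  have hlim : ∀ η ∈ Icc α β, Tendsto (fun R : ℝ => ∫ x : ℝ in -R..R, G (x + η * Complex.I)) atTop
      (𝓝 (rayIntegral η F)) := by
    intro η hη
    rw [rayIntegral_eq_integral_exp]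
    exact intervalIntegral_tendsto_integral (hi η hη).integrable_exp tendsto_neg_atTop_atBot
      tendsto_id
  have h1 := ((hlim α ⟨le_rfl, hαβ⟩).sub (hlim β ⟨hαβ, le_rfl⟩)).add
    ((hvert (fun x => x) fun _ => rfl).const_smul Complex.I)
  have h2 := h1.sub ((hvert (fun x => -x) fun x => abs_neg x).const_smul Complex.I)
  have h3 := tendsto_nhds_unique (h2.congr hrect) tendsto_const_nhds
  simpa [sub_eq_zero] using h3

end Ray

/-! ### Bounded holomorphic functions and the class `H₀^∞` -/

theorem one_mem_sector {φ : ℝ} (h0 : 0 < φ) : (1 : ℂ) ∈ sector φ := by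
  simp [sector, h0]

theorem H0.mul_bounded {φ : ℝ} (h0 : 0 < φ) {g u : ℂ → ℂ} (hg : g ∈ H0 φ)
    (hu : DifferentiableOn ℂ u (sector φ)) {K : ℝ} (hK : ∀ z ∈ sector φ, ‖u z‖ ≤ K) :
    (fun z => g z * u z) ∈ H0 φ := by
  obtain ⟨hd, C, ε, hε, hb⟩ := hg
  refine ⟨hd.mul hu, C * K, ε, hε, fun z hz => ?_⟩
  have hC : 0 ≤ C := by
    simpa using (norm_nonneg _).trans (hb 1 (one_mem_sector h0))
  rw [norm_mul]
  calc ‖g z‖ * ‖u z‖ ≤ (C * min (‖z‖ ^ ε) (‖z‖ ^ (-ε))) * K :=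
        mul_le_mul (hb z hz) (hK z hz) (norm_nonneg _)
          (mul_nonneg hC (min_rpow_nonneg (norm_nonneg _) _))
    _ = _ := by ring

/-- The function `z ↦ (1 + s z)⁻¹`. -/
def resFun (s : ℝ≥0) (z : ℂ) : ℂ := 1 / (1 + z * ((s : ℝ) : ℂ))

theorem resFun_zero (z : ℂ) : resFun 0 z = 1 := by simp [resFun]

theorem resFun_one (z : ℂ) : resFun 1 z = 1 / (1 + z) := by simp [resFun]

theorem differentiableOn_resFun (s : ℝ≥0) :
    DifferentiableOn ℂ (resFun s) Complex.slitPlane := by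
  unfold resFun
  exact (differentiableOn_const _).div (by fun_prop) fun z hz => one_add_mul_ne_zero hz s

theorem norm_resFun_le {φ : ℝ} (h0 : 0 ≤ φ) (hπ : φ < Real.pi) {z : ℂ} (hz : z ∈ sector φ)
    (s : ℝ≥0) : ‖resFun s z‖ ≤ (Real.cos (φ / 2))⁻¹ * (1 + ‖z‖ * s)⁻¹ := by
  have h := cos_half_mul_le_norm_one_add_mul h0 hπ.le hz s
  have hc := cos_half_pos h0 hπ
  rw [resFun, norm_div, norm_one, one_div, ← mul_inv]
  exact inv_anti₀ (by positivity) h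

theorem norm_resFun_le_inv_cos {φ : ℝ} (h0 : 0 ≤ φ) (hπ : φ < Real.pi) {z : ℂ}
    (hz : z ∈ sector φ) (s : ℝ≥0) : ‖resFun s z‖ ≤ (Real.cos (φ / 2))⁻¹ := by
  refine (norm_resFun_le h0 hπ hz s).trans ?_
  have hc := cos_half_pos h0 hπ
  refine mul_le_of_le_one_right (by positivity) (inv_le_one_of_one_le₀ ?_)
  have : 0 ≤ ‖z‖ * s := by positivity
  linarith

theorem H0.mul_resFun {φ : ℝ} (h0 : 0 < φ) (hπ : φ < Real.pi) {g : ℂ → ℂ} (hg : g ∈ H0 φ)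
    (s : ℝ≥0) : (fun z => g z * resFun s z) ∈ H0 φ :=
  H0.mul_bounded h0 hg ((differentiableOn_resFun s).mono (sector_subset_slitPlane hπ.le))
    fun _ hz => norm_resFun_le_inv_cos h0.le hπ hz s

theorem H0.mul_resFun_pow {φ : ℝ} (h0 : 0 < φ) (hπ : φ < Real.pi) {g : ℂ → ℂ} (hg : g ∈ H0 φ)
    (s : ℝ≥0) (m : ℕ) : (fun z => g z * resFun s z ^ m) ∈ H0 φ := by
  induction m with
  | zero => simpa using hg
  | succ m ih =>
    have := H0.mul_resFun h0 hπ ih s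
    simpa only [pow_succ, mul_assoc] using this

theorem H0.mul_one_sub_resFun {φ : ℝ} (h0 : 0 < φ) (hπ : φ < Real.pi) {g : ℂ → ℂ}
    (hg : g ∈ H0 φ) (s : ℝ≥0) : (fun z => g z * (1 - resFun s z)) ∈ H0 φ :=
  H0.mul_bounded h0 hg
    ((differentiableOn_const _).sub
      ((differentiableOn_resFun s).mono (sector_subset_slitPlane hπ.le)))
    fun _ hz => (norm_sub_le _ _).trans
      (add_le_add le_rfl (norm_resFun_le_inv_cos h0.le hπ hz s))

theorem tau_eq {z : ℂ} (hz : 1 + z ≠ 0) : tau z = resFun 1 z - resFun 1 z ^ 2 := by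
  rw [resFun_one, tau]
  field_simp
  ring

theorem one_add_ne_zero_of_mem {φ : ℝ} (hπ : φ ≤ Real.pi) {z : ℂ} (hz : z ∈ sector φ) :
    1 + z ≠ 0 := by
  simpa using one_add_mul_ne_zero (sector_subset_slitPlane hπ hz) 1

theorem inv_one_add_sq_le {r : ℝ} (hr : 0 < r) : r * ((1 + r)⁻¹) ^ 2 ≤ min r r⁻¹ := by
  refine le_min ?_ ?_
  · refine mul_le_of_le_one_right hr.le (pow_le_one₀ (by positivity) ?_)
    exact inv_le_one_of_one_le₀ (by linarith)
  · rw [inv_pow, ← div_eq_mul_inv, ← one_div, div_le_div_iff₀ (by positivity) hr]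
    nlinarith

theorem norm_tau_le {φ : ℝ} (h0 : 0 < φ) (hπ : φ < Real.pi) {z : ℂ} (hz : z ∈ sector φ) :
    ‖tau z‖ ≤ (Real.cos (φ / 2))⁻¹ ^ 2 * min ‖z‖ ‖z‖⁻¹ := by
  have hn : 0 < ‖z‖ := norm_pos_iff.2 hz.1
  have h1 := norm_resFun_le h0.le hπ hz 1
  have e : tau z = z * resFun 1 z ^ 2 := by
    rw [tau, resFun_one, div_pow, one_pow, mul_one_div]
  rw [e, norm_mul, norm_pow]
  calc ‖z‖ * ‖resFun 1 z‖ ^ 2 ≤ ‖z‖ * ((Real.cos (φ / 2))⁻¹ * (1 + ‖z‖ * (1 : ℝ≥0))⁻¹) ^ 2 := by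
        gcongr
    _ = (Real.cos (φ / 2))⁻¹ ^ 2 * (‖z‖ * ((1 + ‖z‖)⁻¹) ^ 2) := by
        simp only [NNReal.coe_one, mul_one]; ring
    _ ≤ _ := mul_le_mul_of_nonneg_left (inv_one_add_sq_le hn) (by positivity)

theorem tau_mem_H0 {φ : ℝ} (h0 : 0 < φ) (hπ : φ < Real.pi) : tau ∈ H0 φ := by
  refine ⟨?_, (Real.cos (φ / 2))⁻¹ ^ 2, 1, one_pos, fun z hz => ?_⟩
  · unfold tau
    exact differentiableOn_id.div (by fun_prop)
      fun z hz => pow_ne_zero _ (one_add_ne_zero_of_mem hπ.le hz)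
  · rw [Real.rpow_one, Real.rpow_neg_one]
    exact norm_tau_le h0 hπ hz

/-! ### Contour integrals -/

section Contour

variable {E : Type*} [NormedAddCommGroup E] [NormedSpace ℂ E]

/-- `(2πi)⁻¹ ∫ F(z) dz` over the downward oriented boundary of the sector of half-angle `θ`. -/
def contourIntegral (θ : ℝ) (F : ℂ → E) : E :=
  (1 / (2 * Real.pi * Complex.I) : ℂ) • (rayIntegral (-θ) F - rayIntegral θ F)

/-- Integrability along the boundary of the sector of half-angle `θ`. -/
def ContourIntegrable (θ : ℝ) (F : ℂ → E) : Prop := RayIntegrable (-θ) F ∧ RayIntegrable θ F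

theorem contourIntegral_congr {θ : ℝ} {F G : ℂ → E}
    (h : ∀ r : ℝ, 0 < r → ∀ η, (η = θ ∨ η = -θ) →
      F (r * Complex.exp (η * Complex.I)) = G (r * Complex.exp (η * Complex.I))) :
    contourIntegral θ F = contourIntegral θ G := by
  rw [contourIntegral, contourIntegral, rayIntegral_congr fun r hr => h r hr θ (Or.inl rfl),
    rayIntegral_congr fun r hr => h r hr (-θ) (Or.inr rfl)]

theorem contourIntegral_add {θ : ℝ} {F G : ℂ → E} (hF : ContourIntegrable θ F)
    (hG : ContourIntegrable θ G) :
    contourIntegral θ (fun z => F z + G z) = contourIntegral θ F + contourIntegral θ G := by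
  rw [contourIntegral, contourIntegral, contourIntegral, rayIntegral_add hF.1 hG.1,
    rayIntegral_add hF.2 hG.2, ← smul_add]
  congr 1
  abel

theorem contourIntegral_sub {θ : ℝ} {F G : ℂ → E} (hF : ContourIntegrable θ F)
    (hG : ContourIntegrable θ G) :
    contourIntegral θ (fun z => F z - G z) = contourIntegral θ F - contourIntegral θ G := by
  rw [contourIntegral, contourIntegral, contourIntegral, rayIntegral_sub hF.1 hG.1,
    rayIntegral_sub hF.2 hG.2, ← smul_sub]
  congr 1
  abel

theorem ContourIntegrable.add {θ : ℝ} {F G : ℂ → E} (hF : ContourIntegrable θ F)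
    (hG : ContourIntegrable θ G) : ContourIntegrable θ (fun z => F z + G z) := by
  refine ⟨?_, ?_⟩ <;> simp only [RayIntegrable, smul_add]
  · exact Integrable.add hF.1 hG.1
  · exact Integrable.add hF.2 hG.2

theorem contourIntegral_clm {E' : Type*} [NormedAddCommGroup E'] [NormedSpace ℂ E']
    [CompleteSpace E] [CompleteSpace E'] {θ : ℝ} {F : ℂ → E} (L : E →L[ℂ] E')
    (hF : ContourIntegrable θ F) :
    contourIntegral θ (fun z => L (F z)) = L (contourIntegral θ F) := by
  rw [contourIntegral, contourIntegral, rayIntegral_clm L hF.1, rayIntegral_clm L hF.2, map_smul,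
    map_sub]

theorem contourIntegral_smul_const [CompleteSpace E] {θ : ℝ} {F : ℂ → ℂ} (T : E)
    (hF : ContourIntegrable θ F) :
    contourIntegral θ (fun z => F z • T) = contourIntegral θ F • T :=
  contourIntegral_clm ((ContinuousLinearMap.id ℂ ℂ).smulRight T) hF

theorem ContourIntegrable.smul_const {θ : ℝ} {F : ℂ → ℂ} (T : E)
    (hF : ContourIntegrable θ F) : ContourIntegrable θ (fun z => F z • T) :=
  ⟨hF.1.clm ((ContinuousLinearMap.id ℂ ℂ).smulRight T),
    hF.2.clm ((ContinuousLinearMap.id ℂ ℂ).smulRight T)⟩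

theorem cos_eq_of_eq_or_eq_neg {η θ : ℝ} (h : η = θ ∨ η = -θ) : Real.cos η = Real.cos θ := by
  rcases h with rfl | rfl
  · rfl
  · exact Real.cos_neg θ

theorem cos_le_cos_of_mem_Icc {η θ : ℝ} (hπ : θ ≤ Real.pi) (h : η ∈ Icc (-θ) θ) :
    Real.cos θ ≤ Real.cos η := by
  rw [← Real.cos_abs η]
  exact Real.cos_le_cos_of_nonneg_of_le_pi (abs_nonneg _) hπ (abs_le.2 h)

theorem cos_le_cos_of_mem_Icc_compl {η θ : ℝ} (h0 : 0 ≤ θ)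
    (h : η ∈ Icc θ (2 * Real.pi - θ)) : Real.cos η ≤ Real.cos θ := by
  have h1 := cos_le_cos_of_mem_Icc (η := Real.pi - η) (θ := Real.pi - θ) (by linarith)
    ⟨by linarith [h.2], by linarith [h.1]⟩
  rw [Real.cos_pi_sub, Real.cos_pi_sub] at h1
  linarith

/-- Cauchy's theorem: a function on a sector with enough decay integrates to zero. -/
theorem contourIntegral_eq_zero [CompleteSpace E] {θ φ : ℝ} (h0 : 0 < θ) (hθφ : θ < φ)
    (hπ : φ ≤ Real.pi) {F : ℂ → E} (hd : DifferentiableOn ℂ F (sector φ)) {C ε : ℝ} (hε : 0 < ε)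
    (hb : ∀ z ∈ sector φ, ‖z‖ * ‖F z‖ ≤ C * min (‖z‖ ^ ε) (‖z‖ ^ (-ε))) :
    contourIntegral θ F = 0 := by
  have hmem : ∀ η ∈ Icc (-θ) θ, ∀ r : ℝ, 0 < r →
      (r : ℂ) * Complex.exp (η * Complex.I) ∈ sector φ := fun η hη r hr =>
    ray_mem_sector (by linarith) hπ hr (lt_of_lt_of_le
      (Real.cos_lt_cos_of_nonneg_of_le_pi h0.le hπ hθφ)
      (cos_le_cos_of_mem_Icc (by linarith) hη))
  rw [contourIntegral, rayIntegral_eq_of_differentiable (α := -θ) (β := θ) (by linarith) hε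
    (C := C) (F := F), sub_self, smul_zero]
  · intro η hη r hr
    exact hd.differentiableAt ((isOpen_sector (by linarith) hπ).mem_nhds (hmem η hη r hr))
  · intro η hη r hr
    have := hb _ (hmem η hη r hr)
    rwa [norm_ray hr] at this

/-- Cauchy's theorem in the complementary sector. -/
theorem contourIntegral_eq_zero_of_compl [CompleteSpace E] {θ : ℝ} (hπ : θ ≤ Real.pi)
    {F : ℂ → E} {C ε : ℝ} (hε : 0 < ε)
    (hd : ∀ η ∈ Icc θ (2 * Real.pi - θ), ∀ r : ℝ, 0 < r →
      DifferentiableAt ℂ F (r * Complex.exp (η * Complex.I)))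
    (hb : ∀ η ∈ Icc θ (2 * Real.pi - θ), ∀ r : ℝ, 0 < r →
      r * ‖F (r * Complex.exp (η * Complex.I))‖ ≤ C * min (r ^ ε) (r ^ (-ε))) :
    contourIntegral θ F = 0 := by
  have h := rayIntegral_eq_of_differentiable (by linarith) hε hd hb
  have e : Complex.exp (((2 * Real.pi - θ : ℝ) : ℂ) * Complex.I) =
      Complex.exp (((-θ : ℝ) : ℂ) * Complex.I) := by
    have : ((2 * Real.pi - θ : ℝ) : ℂ) * Complex.I =
        ((-θ : ℝ) : ℂ) * Complex.I + 2 * Real.pi * Complex.I := by push_cast; ring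
    rw [this, Complex.exp_periodic]
  have h2 : rayIntegral (2 * Real.pi - θ) F = rayIntegral (-θ) F := by
    simp only [rayIntegral, e]
  rw [contourIntegral, h, h2, sub_self, smul_zero]

theorem contourIntegrable_of_norm_le {θ φ : ℝ} (h0 : 0 < θ) (hθφ : θ < φ)
    (hπ : φ ≤ Real.pi) {F : ℂ → E} (hc : ContinuousOn F (sector φ)) {C ε : ℝ} (hε : 0 < ε)
    (hb : ∀ z ∈ sector φ, ‖z‖ * ‖F z‖ ≤ C * min (‖z‖ ^ ε) (‖z‖ ^ (-ε))) :
    ContourIntegrable θ F := by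
  have hmem : ∀ η, (η = θ ∨ η = -θ) → ∀ r : ℝ, 0 < r →
      (r : ℂ) * Complex.exp (η * Complex.I) ∈ sector φ := fun η hη r hr =>
    ray_mem_sector (by linarith) hπ hr (by
      rw [cos_eq_of_eq_or_eq_neg hη]
      exact Real.cos_lt_cos_of_nonneg_of_le_pi h0.le hπ hθφ)
  have key : ∀ η, (η = θ ∨ η = -θ) → RayIntegrable η F := by
    intro η hη
    refine rayIntegrable_of_norm_le hε (C := C) (fun r hr => ?_) fun r hr => ?_
    · exact hc.continuousAt ((isOpen_sector (by linarith) hπ).mem_nhds (hmem η hη r hr))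
    · have := hb _ (hmem η hη r hr)
      rwa [norm_ray hr] at this
  exact ⟨key _ (Or.inr rfl), key _ (Or.inl rfl)⟩

end Contour

/-! ### The scalar contour integral -/

theorem norm_one_sub_ge {ψ : ℝ} (h0 : 0 ≤ ψ) (hπ : ψ ≤ Real.pi) {z : ℂ}
    (h : z.re ≤ ‖z‖ * Real.cos ψ) :
    Real.cos ((Real.pi - ψ) / 2) * (1 + ‖z‖) ≤ ‖z - 1‖ := by
  have h1 := cos_half_mul_le_norm_one_add (φ := Real.pi - ψ) (w := -z) (by linarith)
    (by linarith) (by rw [Real.cos_pi_sub, norm_neg, Complex.neg_re]; linarith)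
  rw [norm_neg, ← sub_eq_add_neg, norm_sub_rev] at h1
  exact h1

/-- The function `(z - 1)⁻¹ - (z + 1)⁻¹`. -/
def poleDiff (z : ℂ) : ℂ := 1 / (z - 1) - resFun 1 z

theorem poleDiff_bound {ψ : ℝ} (h0 : 0 ≤ ψ) (hπ : ψ < Real.pi) {z : ℂ}
    (h1 : ‖z‖ * Real.cos ψ ≤ z.re) (h2 : z.re ≤ -(‖z‖ * Real.cos ψ)) :
    z - 1 ≠ 0 ∧ 1 + z ≠ 0 ∧
      ‖poleDiff z‖ ≤ 2 * (Real.cos (ψ / 2))⁻¹ ^ 2 * (1 + ‖z‖)⁻¹ ^ 2 := by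
  have hc := cos_half_pos h0 hπ
  have e1 := cos_half_mul_le_norm_one_add h0 hπ.le h1
  have e2 := norm_one_sub_ge (ψ := Real.pi - ψ) (z := z) (by linarith) (by linarith)
    (by rw [Real.cos_pi_sub]; linarith)
  rw [sub_sub_cancel] at e2
  have hpos : 0 < Real.cos (ψ / 2) * (1 + ‖z‖) := by positivity
  have n1 : 1 + z ≠ 0 := norm_pos_iff.1 (hpos.trans_le e1)
  have n2 : z - 1 ≠ 0 := norm_pos_iff.1 (hpos.trans_le e2)
  refine ⟨n2, n1, ?_⟩
  have e3 : poleDiff z = 2 * (z - 1)⁻¹ * (1 + z)⁻¹ := by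
    rw [poleDiff, resFun_one]
    field_simp
    ring
  rw [e3, norm_mul, norm_mul, norm_inv, norm_inv]
  calc ‖(2 : ℂ)‖ * ‖z - 1‖⁻¹ * ‖1 + z‖⁻¹
      ≤ ‖(2 : ℂ)‖ * (Real.cos (ψ / 2) * (1 + ‖z‖))⁻¹ * (Real.cos (ψ / 2) * (1 + ‖z‖))⁻¹ := by
        gcongr
    _ = _ := by
        rw [mul_inv, Complex.norm_ofNat]
        generalize (1 + ‖z‖)⁻¹ = t
        ring

theorem rayIntegral_poleDiff_eq {ψ α β : ℝ} (h0 : 0 ≤ ψ) (hπ : ψ < Real.pi) (hαβ : α ≤ β)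
    (h : ∀ η ∈ Icc α β, Real.cos ψ ≤ Real.cos η ∧ Real.cos η ≤ -Real.cos ψ) :
    RayIntegrable α poleDiff ∧ RayIntegrable β poleDiff ∧
      rayIntegral α poleDiff = rayIntegral β poleDiff := by
  have key : ∀ η ∈ Icc α β, ∀ r : ℝ, 0 < r →
      DifferentiableAt ℂ poleDiff (r * Complex.exp (η * Complex.I)) ∧
      r * ‖poleDiff (r * Complex.exp (η * Complex.I))‖ ≤
        (2 * (Real.cos (ψ / 2))⁻¹ ^ 2) * min (r ^ (1 : ℝ)) (r ^ (-1 : ℝ)) := by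
    intro η hη r hr
    obtain ⟨c1, c2⟩ := h η hη
    obtain ⟨n1, n2, hb⟩ := poleDiff_bound h0 hπ
      (z := r * Complex.exp (η * Complex.I)) (by rw [norm_ray hr, re_ray]; gcongr)
      (by rw [norm_ray hr, re_ray, ← mul_neg]; gcongr)
    constructor
    · have hp : poleDiff = fun z => 1 / (z - 1) - 1 / (1 + z) := by
        funext z; rw [poleDiff, resFun_one]
      rw [hp]
      have d1 : Differentiable ℂ fun z : ℂ => z - 1 := by fun_prop
      have d2 : Differentiable ℂ fun z : ℂ => 1 + z := by fun_prop
      exact ((differentiableAt_const _).div (d1 _) n1).sub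
        ((differentiableAt_const _).div (d2 _) n2)
    · rw [norm_ray hr] at hb
      rw [Real.rpow_one, Real.rpow_neg_one]
      calc r * ‖poleDiff (r * Complex.exp (η * Complex.I))‖
          ≤ r * (2 * (Real.cos (ψ / 2))⁻¹ ^ 2 * (1 + r)⁻¹ ^ 2) := by gcongr
        _ = (2 * (Real.cos (ψ / 2))⁻¹ ^ 2) * (r * (1 + r)⁻¹ ^ 2) := by ring
        _ ≤ _ := mul_le_mul_of_nonneg_left (inv_one_add_sq_le hr) (by positivity)
  have hint : ∀ η ∈ Icc α β, RayIntegrable η poleDiff := fun η hη =>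
    rayIntegrable_of_norm_le one_pos (fun r hr => (key η hη r hr).1.continuousAt)
      fun r hr => (key η hη r hr).2
  exact ⟨hint α ⟨le_rfl, hαβ⟩, hint β ⟨hαβ, le_rfl⟩,
    rayIntegral_eq_of_differentiable hαβ one_pos (fun η hη r hr => (key η hη r hr).1)
    fun η hη r hr => (key η hη r hr).2⟩

theorem poleDiff_of_sq {z : ℂ} {r : ℝ} (hz : z ^ 2 = -((r : ℂ) ^ 2)) :
    poleDiff z = -2 * (((1 + r ^ 2)⁻¹ : ℝ) : ℂ) := by
  have hne : (1 + (r : ℂ) ^ 2) ≠ 0 := by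
    have : (1 + r ^ 2 : ℝ) ≠ 0 := by positivity
    exact_mod_cast this
  have hp : (z - 1) * (1 + z) = -(1 + (r : ℂ) ^ 2) := by linear_combination hz
  have hne' : (z - 1) * (1 + z) ≠ 0 := by rw [hp]; exact neg_ne_zero.2 hne
  have n1 := left_ne_zero_of_mul hne'
  have n2 := right_ne_zero_of_mul hne'
  rw [poleDiff, resFun_one]
  push_cast
  rw [div_sub_div _ _ n1 n2, hp]
  field_simp
  ring

theorem integral_Ioi_inv_one_add_sq_zero : ∫ r in Ioi (0 : ℝ), (1 + r ^ 2)⁻¹ = Real.pi / 2 := by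
  rw [integral_Ioi_inv_one_add_sq, Real.arctan_zero, sub_zero]

theorem rayIntegral_poleDiff_imaginary {η : ℝ} {c : ℂ} (hc : Complex.exp (η * Complex.I) = c)
    (hc2 : c ^ 2 = -1) : rayIntegral η poleDiff = -(c * Real.pi) := by
  rw [rayIntegral, hc]
  have e : ∀ r : ℝ, c • poleDiff (r * c) = (-2 * c) * (((1 + r ^ 2)⁻¹ : ℝ) : ℂ) := by
    intro r
    rw [poleDiff_of_sq (r := r) (by rw [mul_pow, hc2]; ring), smul_eq_mul]
    ring
  simp only [e]
  rw [integral_const_mul, integral_complex_ofReal, integral_Ioi_inv_one_add_sq_zero]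
  push_cast
  ring

theorem contourIntegral_poleDiff {θ : ℝ} (h0 : 0 < θ) (hπ : θ < Real.pi) :
    ContourIntegrable θ poleDiff ∧ contourIntegral θ poleDiff = 1 := by
  have hp := Real.pi_pos
  have e1 : Complex.exp ((Real.pi / 2 : ℝ) * Complex.I) = Complex.I := by
    push_cast
    exact Complex.exp_pi_div_two_mul_I
  have e2 : Complex.exp ((-(Real.pi / 2) : ℝ) * Complex.I) = -Complex.I := by
    push_cast
    rw [neg_mul, Complex.exp_neg, Complex.exp_pi_div_two_mul_I, Complex.inv_I]
  have v1 := rayIntegral_poleDiff_imaginary e1 Complex.I_sq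
  have v2 := rayIntegral_poleDiff_imaginary e2 (by rw [neg_sq, Complex.I_sq])
  suffices h : (RayIntegrable (-θ) poleDiff ∧ RayIntegrable θ poleDiff) ∧
      rayIntegral (-θ) poleDiff = rayIntegral (-(Real.pi / 2)) poleDiff ∧
      rayIntegral θ poleDiff = rayIntegral (Real.pi / 2) poleDiff by
    obtain ⟨hi, h1, h2⟩ := h
    refine ⟨hi, ?_⟩
    rw [contourIntegral, h1, h2, v1, v2, smul_eq_mul]
    have : (Real.pi : ℂ) ≠ 0 := by exact_mod_cast hp.ne'
    have := Complex.I_ne_zero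
    field_simp
    ring
  rcases le_total θ (Real.pi / 2) with h | h
  · have hb : ∀ η ∈ Icc θ (Real.pi / 2), Real.cos (Real.pi - θ) ≤ Real.cos η ∧
        Real.cos η ≤ -Real.cos (Real.pi - θ) := by
      intro η hη
      rw [Real.cos_pi_sub, neg_neg]
      have hc : 0 ≤ Real.cos η := Real.cos_nonneg_of_mem_Icc ⟨by linarith [hη.1], hη.2⟩
      have hc2 : Real.cos η ≤ Real.cos θ :=
        Real.cos_le_cos_of_nonneg_of_le_pi h0.le (by linarith [hη.2]) hη.1
      exact ⟨by linarith, hc2⟩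
    have r1 := rayIntegral_poleDiff_eq (ψ := Real.pi - θ) (by linarith) (by linarith) h hb
    have r2 := rayIntegral_poleDiff_eq (ψ := Real.pi - θ) (α := -(Real.pi / 2)) (β := -θ)
      (by linarith) (by linarith) (by linarith) (fun η hη => by
        have := hb (-η) ⟨by linarith [hη.2], by linarith [hη.1]⟩
        rwa [Real.cos_neg] at this)
    exact ⟨⟨r2.2.1, r1.1⟩, r2.2.2.symm, r1.2.2⟩
  · have hb : ∀ η ∈ Icc (Real.pi / 2) θ, Real.cos θ ≤ Real.cos η ∧
        Real.cos η ≤ -Real.cos θ := by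
      intro η hη
      have hc : Real.cos η ≤ 0 :=
        Real.cos_nonpos_of_pi_div_two_le_of_le hη.1 (by linarith [hη.2])
      have hc2 : Real.cos θ ≤ Real.cos η :=
        Real.cos_le_cos_of_nonneg_of_le_pi (by linarith [hη.1]) hπ.le hη.2
      exact ⟨hc2, by linarith⟩
    have r1 := rayIntegral_poleDiff_eq (ψ := θ) h0.le hπ h hb
    have r2 := rayIntegral_poleDiff_eq (ψ := θ) (α := -θ) (β := -(Real.pi / 2))
      h0.le hπ (by linarith) (fun η hη => by
        have := hb (-η) ⟨by linarith [hη.2], by linarith [hη.1]⟩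
        rwa [Real.cos_neg] at this)
    exact ⟨⟨r2.1, r1.2.1⟩, r2.2.2, r1.2.2.symm⟩

/-! ### The holomorphic calculus -/

section Holomorphic

variable {X : Type*} [NormedAddCommGroup X] [NormedSpace ℂ X] {A : X →ₗ.[ℂ] X}

theorem norm_add_norm_eq {z : ℂ} : ‖z + (‖z‖ : ℂ)‖ ^ 2 = 2 * ‖z‖ * (‖z‖ + z.re) := by
  have h : ‖z‖ ^ 2 = z.re * z.re + z.im * z.im := by
    rw [← Complex.normSq_eq_norm_sq, Complex.normSq_apply]
  have h2 : ‖z + (‖z‖ : ℂ)‖ ^ 2 = (z.re + ‖z‖) * (z.re + ‖z‖) + z.im * z.im := by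
    rw [← Complex.normSq_eq_norm_sq, Complex.normSq_apply]
    simp
  rw [h2]
  linear_combination -h

theorem IsSectorial.exists_isSect [CompleteSpace X] (hA : IsSectorial A) :
    ∃ ω : ℝ, 0 < ω ∧ ω < Real.pi ∧ IsSect A ω := by
  obtain ⟨M, hM1, hM⟩ := hA.exists_norm_stRes_le
  set c : ℝ := 1 / (4 * M) with hc
  have hc0 : 0 < c := by positivity
  have hc1 : c < 1 := by
    rw [hc, div_lt_one (by positivity)]
    linarith
  have hacos : Real.cos (2 * Real.arccos c) = 2 * c ^ 2 - 1 := by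
    rw [Real.cos_two_mul, Real.cos_arccos (by linarith) hc1.le]
  have hω0 : 0 < 2 * Real.arccos c := by
    have := Real.arccos_pos.2 hc1
    linarith
  have hωπ : 2 * Real.arccos c < Real.pi := by
    have := Real.arccos_lt_pi_div_two.2 hc0
    linarith
  have key : ∀ z : ℂ, z ∉ closedSector (2 * Real.arccos c) →
      z ∈ resolventSet A ∧ ‖resolvent A z‖ ≤ 2 * (M / ‖z‖) := by
    intro z hz
    have hz0 : z ≠ 0 := by
      rintro rfl
      apply hz
      simp only [closedSector, mem_ofPred_eq, Complex.arg_zero, abs_zero]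
      exact hω0.le
    have hn : 0 < ‖z‖ := norm_pos_iff.2 hz0
    have h1 := (notMem_closedSector_iff hω0.le hωπ.le).1 hz
    rw [hacos] at h1
    have h2 : ‖z + (‖z‖ : ℂ)‖ ≤ 2 * c * ‖z‖ := by
      refine abs_le_of_sq_le_sq' ?_ (by positivity) |>.2
      rw [norm_add_norm_eq]
      nlinarith
    set s : ℝ≥0 := ⟨‖z‖⁻¹, by positivity⟩ with hs
    have hs0 : s ≠ 0 := by
      rw [Ne, ← NNReal.coe_eq_zero]
      exact (inv_pos.2 hn).ne'
    have hsz : (-((s : ℝ) : ℂ)⁻¹) = -(‖z‖ : ℂ) := by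
      have : (s : ℝ) = ‖z‖⁻¹ := rfl
      rw [this]
      simp
    have hmem := hA.neg_inv_mem hs0
    have hb := hM s
    rw [hA.stRes_eq hs0, norm_smul] at hb
    rw [hsz] at hmem hb
    rw [norm_neg, Complex.norm_real, Real.norm_of_nonneg hn.le, mul_comm,
      ← le_div_iff₀ hn] at hb
    have h3 := norm_resolvent_le_two_mul (w := z) hmem (by
      rw [sub_neg_eq_add]
      calc ‖z + (‖z‖ : ℂ)‖ * ‖resolvent A (-(‖z‖ : ℂ))‖ ≤ (2 * c * ‖z‖) * (M / ‖z‖) := by gcongr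
        _ = 1 / 2 := by rw [hc]; field_simp; norm_num)
    exact ⟨h3.1, h3.2.trans (by gcongr)⟩
  refine ⟨2 * Real.arccos c, hω0, hωπ, fun z hz => (key z hz).1, 2 * M, fun z hz => ?_⟩
  rw [norm_smul]
  by_cases hz0 : z = 0
  · rw [hz0, norm_zero, zero_mul]
    positivity
  have hn : 0 < ‖z‖ := norm_pos_iff.2 hz0
  calc ‖z‖ * ‖resolvent A z‖ ≤ ‖z‖ * (2 * (M / ‖z‖)) := by gcongr; exact (key z hz).2
    _ = 2 * M := by field_simp

/-- Angles for which the holomorphic calculus is defined. -/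
structure IsAdmissible (A : X →ₗ.[ℂ] X) (ω θ φ : ℝ) : Prop where
  pos : 0 < ω
  sect : IsSect A ω
  lt : ω < θ
  lt' : θ < φ
  lt_pi : φ < Real.pi

namespace IsAdmissible

variable {ω θ φ : ℝ}

theorem theta_pos (h : IsAdmissible A ω θ φ) : 0 < θ := h.pos.trans h.lt

theorem theta_lt_pi (h : IsAdmissible A ω θ φ) : θ < Real.pi := h.lt'.trans h.lt_pi

theorem phi_pos (h : IsAdmissible A ω θ φ) : 0 < φ := h.theta_pos.trans h.lt'

theorem ray_mem_sector (h : IsAdmissible A ω θ φ) {η r : ℝ} (hr : 0 < r)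
    (hη : η = θ ∨ η = -θ) : (r : ℂ) * Complex.exp (η * Complex.I) ∈ sector φ :=
  SectorialCalculus.ray_mem_sector h.phi_pos.le h.lt_pi.le hr (by
    rw [cos_eq_of_eq_or_eq_neg hη]
    exact Real.cos_lt_cos_of_nonneg_of_le_pi h.theta_pos.le h.lt_pi.le h.lt')

theorem ray_notMem_closedSector (h : IsAdmissible A ω θ φ) {η r : ℝ} (hr : 0 < r)
    (hη : Real.cos η ≤ Real.cos θ) : (r : ℂ) * Complex.exp (η * Complex.I) ∉ closedSector ω :=
  SectorialCalculus.ray_notMem_closedSector h.pos.le (h.lt.trans h.theta_lt_pi).le hr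
    (hη.trans_lt (Real.cos_lt_cos_of_nonneg_of_le_pi h.pos.le h.theta_lt_pi.le h.lt))

theorem ray_mem_resolventSet (h : IsAdmissible A ω θ φ) {η r : ℝ} (hr : 0 < r)
    (hη : Real.cos η ≤ Real.cos θ) :
    (r : ℂ) * Complex.exp (η * Complex.I) ∈ resolventSet A :=
  h.sect.1 _ (h.ray_notMem_closedSector hr hη)

theorem exists_norm_resolvent_le (h : IsAdmissible A ω θ φ) :
    ∃ M : ℝ, 0 ≤ M ∧ ∀ η r : ℝ, 0 < r → Real.cos η ≤ Real.cos θ →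
      r * ‖resolvent A (r * Complex.exp (η * Complex.I))‖ ≤ M := by
  obtain ⟨M, hM⟩ := h.sect.2
  refine ⟨max M 0, le_max_right _ _, fun η r hr hη => ?_⟩
  have := hM _ (h.ray_notMem_closedSector hr hη)
  rw [norm_smul, norm_ray hr] at this
  exact this.trans (le_max_left _ _)

theorem continuousAt_of_continuousOn (h : IsAdmissible A ω θ φ) {E : Type*}
    [TopologicalSpace E] {g : ℂ → E}
    (hg : ContinuousOn g (sector φ)) {η r : ℝ} (hr : 0 < r) (hη : η = θ ∨ η = -θ) :
    ContinuousAt g (r * Complex.exp (η * Complex.I)) :=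
  hg.continuousAt ((isOpen_sector h.phi_pos.le h.lt_pi.le).mem_nhds (h.ray_mem_sector hr hη))

end IsAdmissible

theorem holCalc_eq (A : X →ₗ.[ℂ] X) (θ : ℝ) (g : ℂ → ℂ) :
    holCalc A θ g = contourIntegral θ (fun z => g z • resolvent A z) := by
  have e : -((θ : ℂ) * Complex.I) = ((-θ : ℝ) : ℂ) * Complex.I := by push_cast; ring
  simp only [holCalc, contourIntegral, rayIntegral, e, smul_smul, mul_comm (g _)]

theorem holCalc_congr {ω θ φ : ℝ} (h : IsAdmissible A ω θ φ) {g k : ℂ → ℂ}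
    (hgk : ∀ z ∈ sector φ, g z = k z) : holCalc A θ g = holCalc A θ k := by
  rw [holCalc_eq, holCalc_eq]
  refine contourIntegral_congr fun r hr η hη => ?_
  simp only [hgk _ (h.ray_mem_sector hr hη)]

theorem IsSectorial.smul_resolvent_mul_stRes (hA : IsSectorial A) {z : ℂ}
    (hz : z ∈ resolventSet A) {s : ℝ≥0} (hne : 1 + z * ((s : ℝ) : ℂ) ≠ 0) :
    resolvent A z * stRes A s =
      resFun s z • resolvent A z + resFun s z • (((s : ℝ) : ℂ) • stRes A s) := by
  rw [← smul_add, ← hA.resolvent_mul_stRes hz s, smul_smul, resFun, one_div_mul_cancel hne,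
    one_smul]

theorem norm_resolvent_sub_pole_le {R J : X →L[ℂ] X} {z : ℂ} {M K c : ℝ} (hz : z ≠ 0)
    (hM0 : 0 ≤ M) (hK1 : 1 ≤ K) (hc : 0 < c)
    (hRJ : (1 + z) • (R * J) = R + J) (hM : ‖z‖ * ‖R‖ ≤ M) (hK : ‖J‖ ≤ K)
    (hz1 : c * (1 + ‖z‖) ≤ ‖z - 1‖) :
    ‖z‖ * ‖R * (J - J * J) - (1 / (z - 1)) • (J - J * J)‖ ≤
      ((M + 1) * (K + 1) ^ 2 * (1 + c⁻¹)) * min ‖z‖ ‖z‖⁻¹ := by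
  have hn : 0 < ‖z‖ := norm_pos_iff.2 hz
  have hzn : z - 1 ≠ 0 := norm_pos_iff.1 (lt_of_lt_of_le (by positivity) hz1)
  have hRJ' : z • (R * J) = R + J - R * J := by
    rw [← hRJ, add_smul, one_smul]; abel
  have hzR : ‖z • R‖ ≤ M := by rwa [norm_smul]
  have hD : ‖J - J * J‖ ≤ (K + 1) ^ 2 := by
    calc ‖J - J * J‖ ≤ ‖J‖ + ‖J‖ * ‖J‖ :=
          (norm_sub_le _ _).trans (add_le_add le_rfl (norm_mul_le _ _))
      _ ≤ K + K * K := by gcongr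
      _ ≤ _ := by nlinarith
  have h1 : R * (J - J * J) = (z • R) * (J * J) - J * J := by
    have : (z • R) * (J * J) = (z • (R * J)) * J := by
      rw [smul_mul_assoc, smul_mul_assoc, mul_assoc]
    rw [this, hRJ']
    noncomm_ring
  have h2 : z • (R * (J - J * J)) - (J - J * J) = R * ((1 - J) * (1 - J)) := by
    have : z • (R * (J - J * J)) = z • (R * J) - (z • (R * J)) * J := by
      rw [mul_sub, smul_sub, smul_mul_assoc, mul_assoc]
    rw [this, hRJ']
    noncomm_ring
  have hJJ : ‖J * J‖ ≤ (K + 1) ^ 2 := by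
    calc ‖J * J‖ ≤ ‖J‖ * ‖J‖ := norm_mul_le _ _
      _ ≤ K * K := by gcongr
      _ ≤ _ := by nlinarith
  have hp1 : ‖1 / (z - 1)‖ ≤ c⁻¹ := by
    rw [norm_div, norm_one, one_div]
    refine inv_anti₀ hc (le_trans ?_ hz1)
    nlinarith
  have hp2 : ‖z / (z - 1)‖ ≤ c⁻¹ := by
    rw [norm_div, div_le_iff₀ (norm_pos_iff.2 hzn)]
    calc ‖z‖ = c⁻¹ * (c * ‖z‖) := by field_simp
      _ ≤ c⁻¹ * ‖z - 1‖ := by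
        refine mul_le_mul_of_nonneg_left (le_trans ?_ hz1) (by positivity)
        nlinarith
  have hci : 0 < c⁻¹ := inv_pos.2 hc
  set G := R * (J - J * J) - (1 / (z - 1)) • (J - J * J) with hG
  have hG1 : ‖G‖ ≤ (M + 1) * (K + 1) ^ 2 * (1 + c⁻¹) := by
    calc ‖G‖ ≤ (‖z • R‖ * ‖J * J‖ + ‖J * J‖) + ‖1 / (z - 1)‖ * ‖J - J * J‖ := by
          rw [hG, h1]
          refine (norm_sub_le _ _).trans (add_le_add ?_ (norm_smul _ _).le)
          exact (norm_sub_le _ _).trans (add_le_add (norm_mul_le _ _) le_rfl)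
      _ ≤ (M * (K + 1) ^ 2 + (K + 1) ^ 2) + c⁻¹ * (K + 1) ^ 2 := by gcongr
      _ ≤ _ := by nlinarith [mul_nonneg (mul_nonneg hM0 (sq_nonneg (K + 1))) hci.le]
  have hz2G : (z * z) • G = (z • R) * ((1 - J) * (1 - J)) - (z / (z - 1)) • (J - J * J) := by
    have : (z • R) * ((1 - J) * (1 - J)) = z • (z • (R * (J - J * J)) - (J - J * J)) := by
      rw [h2, smul_mul_assoc]
    rw [this, hG]
    match_scalars <;> field_simp <;> ring
  have hQ : ‖(1 - J) * (1 - J)‖ ≤ (K + 1) ^ 2 := by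
    have h3 : ‖1 - J‖ ≤ K + 1 := by
      calc ‖1 - J‖ ≤ ‖(1 : X →L[ℂ] X)‖ + ‖J‖ := norm_sub_le _ _
        _ ≤ 1 + K := add_le_add ContinuousLinearMap.norm_id_le hK
        _ = _ := add_comm _ _
    rw [sq]
    exact (norm_mul_le _ _).trans (mul_le_mul h3 h3 (norm_nonneg _) (by linarith))
  have hG2 : ‖z‖ * ‖z‖ * ‖G‖ ≤ (M + 1) * (K + 1) ^ 2 * (1 + c⁻¹) := by
    rw [← norm_mul, ← norm_smul, hz2G]
    calc _ ≤ ‖z • R‖ * ‖(1 - J) * (1 - J)‖ + ‖z / (z - 1)‖ * ‖J - J * J‖ :=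
          (norm_sub_le _ _).trans (add_le_add (norm_mul_le _ _) (norm_smul _ _).le)
      _ ≤ M * (K + 1) ^ 2 + c⁻¹ * (K + 1) ^ 2 := by gcongr
      _ ≤ _ := by nlinarith [mul_nonneg (mul_nonneg hM0 (sq_nonneg (K + 1))) hci.le,
                  sq_nonneg (K + 1)]
  rw [mul_min_of_nonneg _ _ (by positivity)]
  refine le_min ?_ ?_
  · rw [mul_comm]
    gcongr
  · rw [← div_eq_mul_inv, le_div_iff₀ hn]
    linarith

variable [CompleteSpace X] {ω θ φ : ℝ}

theorem IsAdmissible.continuousAt_resolvent (h : IsAdmissible A ω θ φ) {η r : ℝ} (hr : 0 < r)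
    (hη : η = θ ∨ η = -θ) :
    ContinuousAt (resolvent A) (r * Complex.exp (η * Complex.I)) :=
  (differentiableAt_resolvent (h.ray_mem_resolventSet hr
    (cos_eq_of_eq_or_eq_neg hη).le)).continuousAt

theorem IsAdmissible.contourIntegrable (h : IsAdmissible A ω θ φ) {g : ℂ → ℂ} (hg : g ∈ H0 φ) :
    ContourIntegrable θ (fun z => g z • resolvent A z) := by
  obtain ⟨hd, C, ε, hε, hb⟩ := hg
  obtain ⟨M, hM0, hM⟩ := h.exists_norm_resolvent_le
  have key : ∀ η, (η = θ ∨ η = -θ) → RayIntegrable η (fun z => g z • resolvent A z) := by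
    intro η hη
    refine rayIntegrable_of_norm_le hε (C := C * M) (fun r hr => ?_) fun r hr => ?_
    · exact (h.continuousAt_of_continuousOn hd.continuousOn hr hη).smul
        (h.continuousAt_resolvent hr hη)
    · have h1 := hb _ (h.ray_mem_sector hr hη)
      have h2 := hM η r hr (cos_eq_of_eq_or_eq_neg hη).le
      rw [norm_ray hr] at h1
      rw [norm_smul]
      calc r * (‖g (r * Complex.exp (η * Complex.I))‖ *
            ‖resolvent A (r * Complex.exp (η * Complex.I))‖)
          = ‖g (r * Complex.exp (η * Complex.I))‖ *
            (r * ‖resolvent A (r * Complex.exp (η * Complex.I))‖) := by ring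
        _ ≤ (C * min (r ^ ε) (r ^ (-ε))) * M :=
            mul_le_mul h1 h2 (by positivity) ((norm_nonneg _).trans h1)
        _ = _ := by ring
  exact ⟨key _ (Or.inr rfl), key _ (Or.inl rfl)⟩

theorem holCalc_sub (h : IsAdmissible A ω θ φ) {g k : ℂ → ℂ} (hg : g ∈ H0 φ) (hk : k ∈ H0 φ) :
    holCalc A θ (fun z => g z - k z) = holCalc A θ g - holCalc A θ k := by
  simp only [holCalc_eq, sub_smul]
  exact contourIntegral_sub (h.contourIntegrable hg) (h.contourIntegrable hk)

theorem contourIntegral_mul_resFun_eq_zero (h0 : 0 < θ) (hθφ : θ < φ) (hπ : φ < Real.pi)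
    {g : ℂ → ℂ} (hg : g ∈ H0 φ) {s : ℝ≥0} (hs : s ≠ 0) :
    ContourIntegrable θ (fun z => g z * resFun s z) ∧
      contourIntegral θ (fun z => g z * resFun s z) = 0 := by
  have hφ := h0.trans hθφ
  obtain ⟨hd, C, ε, hε, hb⟩ := hg
  have hd' : DifferentiableOn ℂ (fun z => g z * resFun s z) (sector φ) :=
    hd.mul ((differentiableOn_resFun s).mono (sector_subset_slitPlane hπ.le))
  have hs' : (0 : ℝ) < s := by positivity
  have hc := cos_half_pos hφ.le hπ
  have hb' : ∀ z ∈ sector φ, ‖z‖ * ‖g z * resFun s z‖ ≤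
      (C * ((Real.cos (φ / 2))⁻¹ * (s : ℝ)⁻¹)) * min (‖z‖ ^ ε) (‖z‖ ^ (-ε)) := by
    intro z hz
    have hn : 0 < ‖z‖ := norm_pos_iff.2 hz.1
    have h1 := norm_resFun_le hφ.le hπ hz s
    have h2 : ‖z‖ * ‖resFun s z‖ ≤ (Real.cos (φ / 2))⁻¹ * (s : ℝ)⁻¹ := by
      calc ‖z‖ * ‖resFun s z‖
          ≤ ‖z‖ * ((Real.cos (φ / 2))⁻¹ * (‖z‖ * s)⁻¹) := by
            refine mul_le_mul_of_nonneg_left (h1.trans ?_) hn.le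
            refine mul_le_mul_of_nonneg_left (inv_anti₀ (by positivity) ?_) (by positivity)
            linarith
        _ = _ := by rw [mul_inv]; field_simp
    rw [norm_mul]
    calc ‖z‖ * (‖g z‖ * ‖resFun s z‖) = ‖g z‖ * (‖z‖ * ‖resFun s z‖) := by ring
      _ ≤ (C * min (‖z‖ ^ ε) (‖z‖ ^ (-ε))) * ((Real.cos (φ / 2))⁻¹ * (s : ℝ)⁻¹) :=
          mul_le_mul (hb z hz) h2 (by positivity) ((norm_nonneg _).trans (hb z hz))
      _ = _ := by ring
  exact ⟨contourIntegrable_of_norm_le h0 hθφ hπ.le hd'.continuousOn hε hb',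
    contourIntegral_eq_zero h0 hθφ hπ.le hd' hε hb'⟩

theorem holCalc_mul_stRes (hA : IsSectorial A) (h : IsAdmissible A ω θ φ) {g : ℂ → ℂ}
    (hg : g ∈ H0 φ) (s : ℝ≥0) :
    holCalc A θ g * stRes A s = holCalc A θ (fun z => g z * resFun s z) := by
  by_cases hs : s = 0
  · subst hs
    simp only [stRes_zero, resFun_zero, mul_one]
  obtain ⟨hi, h0⟩ := contourIntegral_mul_resFun_eq_zero h.theta_pos h.lt' h.lt_pi hg hs
  have hg' := h.contourIntegrable hg
  have e1 := contourIntegral_clm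
    ((ContinuousLinearMap.mul ℂ (X →L[ℂ] X)).flip (stRes A s)) hg'
  simp only [ContinuousLinearMap.flip_apply, ContinuousLinearMap.mul_apply'] at e1
  rw [holCalc_eq, ← e1, holCalc_eq]
  have e2 : contourIntegral θ (fun z => g z • resolvent A z * stRes A s) =
      contourIntegral θ (fun z => (g z * resFun s z) • resolvent A z +
        (g z * resFun s z) • (((s : ℝ) : ℂ) • stRes A s)) := by
    refine contourIntegral_congr fun r hr η hη => ?_
    have hz := h.ray_mem_resolventSet hr (cos_eq_of_eq_or_eq_neg hη).le
    have hne := one_add_mul_ne_zero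
      (sector_subset_slitPlane h.lt_pi.le (h.ray_mem_sector hr hη)) s
    rw [smul_mul_assoc, hA.smul_resolvent_mul_stRes hz hne, smul_add, smul_smul, smul_smul]
  rw [e2, contourIntegral_add (h.contourIntegrable (H0.mul_resFun h.phi_pos h.lt_pi hg s))
    (hi.smul_const _), contourIntegral_smul_const _ hi, h0, zero_smul, add_zero]

theorem holCalc_mul_stRes_pow (hA : IsSectorial A) (h : IsAdmissible A ω θ φ) {g : ℂ → ℂ}
    (hg : g ∈ H0 φ) (s : ℝ≥0) (m : ℕ) :
    holCalc A θ g * stRes A s ^ m = holCalc A θ (fun z => g z * resFun s z ^ m) := by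
  induction m with
  | zero => simp
  | succ m ih =>
    rw [pow_succ, ← mul_assoc, ih,
      holCalc_mul_stRes hA h (H0.mul_resFun_pow h.phi_pos h.lt_pi hg s m)]
    simp only [pow_succ, mul_assoc]

theorem holCalc_mul_one_sub_stRes (hA : IsSectorial A) (h : IsAdmissible A ω θ φ) {g : ℂ → ℂ}
    (hg : g ∈ H0 φ) (s : ℝ≥0) :
    holCalc A θ g * (1 - stRes A s) = holCalc A θ (fun z => g z * (1 - resFun s z)) := by
  rw [mul_sub, mul_one, holCalc_mul_stRes hA h hg,
    ← holCalc_sub h hg (H0.mul_resFun h.phi_pos h.lt_pi hg s)]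
  simp only [mul_sub, mul_one]

theorem H0.mul_one_sub_resFun_pow (h0 : 0 < φ) (hπ : φ < Real.pi) {g : ℂ → ℂ}
    (hg : g ∈ H0 φ) (s : ℝ≥0) (m : ℕ) : (fun z => g z * (1 - resFun s z) ^ m) ∈ H0 φ := by
  induction m with
  | zero => simpa using hg
  | succ m ih =>
    have := H0.mul_one_sub_resFun h0 hπ ih s
    simpa only [pow_succ, mul_assoc] using this

theorem holCalc_mul_one_sub_stRes_pow (hA : IsSectorial A) (h : IsAdmissible A ω θ φ)
    {g : ℂ → ℂ} (hg : g ∈ H0 φ) (s : ℝ≥0) (m : ℕ) :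
    holCalc A θ g * (1 - stRes A s) ^ m =
      holCalc A θ (fun z => g z * (1 - resFun s z) ^ m) := by
  induction m with
  | zero => simp
  | succ m ih =>
    rw [pow_succ, ← mul_assoc, ih, holCalc_mul_one_sub_stRes hA h
      (H0.mul_one_sub_resFun_pow h.phi_pos h.lt_pi hg s m)]
    simp only [pow_succ, mul_assoc]

/-! ### The value of `τ(A)` -/

theorem contourIntegral_resFun_sq (h0 : 0 < θ) (hθφ : θ < φ) (hπ : φ < Real.pi) :
    ContourIntegrable θ (fun z => resFun 1 z ^ 2) ∧
      contourIntegral θ (fun z => resFun 1 z ^ 2) = 0 := by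
  have hφ := h0.trans hθφ
  have hd' : DifferentiableOn ℂ (fun z => resFun 1 z ^ 2) (sector φ) :=
    ((differentiableOn_resFun 1).mono (sector_subset_slitPlane hπ.le)).pow 2
  have hb' : ∀ z ∈ sector φ, ‖z‖ * ‖resFun 1 z ^ 2‖ ≤
      ((Real.cos (φ / 2))⁻¹ ^ 2) * min (‖z‖ ^ (1 : ℝ)) (‖z‖ ^ (-1 : ℝ)) := by
    intro z hz
    have hn : 0 < ‖z‖ := norm_pos_iff.2 hz.1
    have h1 := norm_tau_le hφ hπ hz
    have e : tau z = z * resFun 1 z ^ 2 := by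
      rw [tau, resFun_one, div_pow, one_pow, mul_one_div]
    rw [e, norm_mul] at h1
    rwa [Real.rpow_one, Real.rpow_neg_one]
  exact ⟨contourIntegrable_of_norm_le h0 hθφ hπ.le hd'.continuousOn one_pos hb',
    contourIntegral_eq_zero h0 hθφ hπ.le hd' one_pos hb'⟩

theorem holCalc_tau (hA : IsSectorial A) (h : IsAdmissible A ω θ φ) :
    holCalc A θ tau = stRes A 1 * (1 - stRes A 1) := by
  set J := stRes A 1 with hJ
  obtain ⟨K, hK1, hK⟩ := hA.exists_norm_stRes_le
  obtain ⟨M, hM0, hM⟩ := h.exists_norm_resolvent_le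
  set c := Real.cos ((Real.pi - θ) / 2) with hc
  have hc0 : 0 < c := cos_half_pos (by linarith [h.theta_lt_pi]) (by linarith [h.theta_pos])
  set G : ℂ → X →L[ℂ] X := fun z => resolvent A z * (J - J * J) - (1 / (z - 1)) • (J - J * J)
  have hRJ : ∀ z ∈ resolventSet A, (1 + z) • (resolvent A z * J) = resolvent A z + J := by
    intro z hz
    have := hA.resolvent_mul_stRes hz 1
    simpa using this
  have hpole : ∀ η r : ℝ, 0 < r → Real.cos η ≤ Real.cos θ →
      c * (1 + ‖(r : ℂ) * Complex.exp (η * Complex.I)‖) ≤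
        ‖(r : ℂ) * Complex.exp (η * Complex.I) - 1‖ := fun η r hr hη =>
    norm_one_sub_ge h.theta_pos.le h.theta_lt_pi.le (by
      rw [norm_ray hr, re_ray]; gcongr)
  have hGd : ∀ η r : ℝ, 0 < r → Real.cos η ≤ Real.cos θ →
      DifferentiableAt ℂ G (r * Complex.exp (η * Complex.I)) := by
    intro η r hr hη
    have hne : (r : ℂ) * Complex.exp (η * Complex.I) - 1 ≠ 0 :=
      norm_pos_iff.1 (lt_of_lt_of_le (by positivity) (hpole η r hr hη))
    have d1 : Differentiable ℂ fun z : ℂ => z - 1 := by fun_prop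
    exact ((differentiableAt_resolvent (h.ray_mem_resolventSet hr hη)).mul_const _).sub
      (((differentiableAt_const _).div (d1 _) hne).smul_const _)
  have hGb : ∀ η r : ℝ, 0 < r → Real.cos η ≤ Real.cos θ →
      r * ‖G (r * Complex.exp (η * Complex.I))‖ ≤
        ((M + 1) * (K + 1) ^ 2 * (1 + c⁻¹)) * min (r ^ (1 : ℝ)) (r ^ (-1 : ℝ)) := by
    intro η r hr hη
    have hz0 : (r : ℂ) * Complex.exp (η * Complex.I) ≠ 0 :=
      norm_pos_iff.1 (by rw [norm_ray hr]; exact hr)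
    have := norm_resolvent_sub_pole_le hz0 hM0 hK1 hc0
      (hRJ _ (h.ray_mem_resolventSet hr hη)) (by rw [norm_ray hr]; exact hM η r hr hη) (hK 1)
      (hpole η r hr hη)
    rw [norm_ray hr] at this
    rwa [Real.rpow_one, Real.rpow_neg_one]
  have hG0 : contourIntegral θ G = 0 :=
    contourIntegral_eq_zero_of_compl h.theta_lt_pi.le one_pos
      (fun η hη r hr => hGd η r hr (cos_le_cos_of_mem_Icc_compl h.theta_pos.le hη))
      (fun η hη r hr => hGb η r hr (cos_le_cos_of_mem_Icc_compl h.theta_pos.le hη))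
  have hGi : ContourIntegrable θ G := by
    have key : ∀ η, (η = θ ∨ η = -θ) → RayIntegrable η G := fun η hη =>
      rayIntegrable_of_norm_le one_pos
        (fun r hr => (hGd η r hr (cos_eq_of_eq_or_eq_neg hη).le).continuousAt)
        (fun r hr => hGb η r hr (cos_eq_of_eq_or_eq_neg hη).le)
    exact ⟨key _ (Or.inr rfl), key _ (Or.inl rfl)⟩
  obtain ⟨hp, hp1⟩ := contourIntegral_poleDiff h.theta_pos h.theta_lt_pi
  obtain ⟨hr, hr0⟩ := contourIntegral_resFun_sq h.theta_pos h.lt' h.lt_pi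
  have e : contourIntegral θ (fun z => tau z • resolvent A z) =
      contourIntegral θ (fun z => (G z + poleDiff z • (J - J * J)) + resFun 1 z ^ 2 • J) := by
    refine contourIntegral_congr fun r hr η hη => ?_
    have hz := h.ray_mem_resolventSet hr (cos_eq_of_eq_or_eq_neg hη).le
    have hzs := h.ray_mem_sector hr hη
    generalize (r : ℂ) * Complex.exp (η * Complex.I) = z at hz hzs
    have hne := one_add_ne_zero_of_mem h.lt_pi.le hzs
    have hne' : 1 + z * (((1 : ℝ≥0) : ℝ) : ℂ) ≠ 0 := by simpa using hne
    have e1 := hA.smul_resolvent_mul_stRes hz hne'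
    simp only [NNReal.coe_one, Complex.ofReal_one, one_smul, ← hJ] at e1
    have e2 : resolvent A z * (J * J) = resFun 1 z • (resolvent A z * J) +
        resFun 1 z • (J * J) := by
      rw [← mul_assoc, e1, add_mul, smul_mul_assoc, smul_mul_assoc, e1]
    rw [tau_eq hne]
    simp only [G, poleDiff, mul_sub, e2, e1]
    module
  rw [holCalc_eq, e, contourIntegral_add (hGi.add (hp.smul_const _)) (hr.smul_const _),
    contourIntegral_add hGi (hp.smul_const _), hG0, contourIntegral_smul_const _ hp,
    contourIntegral_smul_const _ hr, hp1, hr0, one_smul, zero_smul, zero_add, add_zero, mul_sub,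
    mul_one]

theorem holCalc_tau_injective (hA : IsSectorial A) (hinj : Function.Injective A)
    (h : IsAdmissible A ω θ φ) : Function.Injective (holCalc A θ tau) := by
  rw [holCalc_tau hA h]
  exact (hA.stRes_injective 1).comp (hA.one_sub_stRes_injective hinj one_ne_zero)

end Holomorphic

/-! ### Integrals against complex Radon measures -/

instance (μ : ComplexRadon) (k : Fin 4) : IsLocallyFiniteMeasure (μ.part k) := μ.radon k

namespace ComplexRadon

variable {E : Type*} [NormedAddCommGroup E] [NormedSpace ℂ E]

theorem integral_clm {E' : Type*} [NormedAddCommGroup E'] [NormedSpace ℂ E'] [CompleteSpace E]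
    [CompleteSpace E'] (μ : ComplexRadon) (L : E →L[ℂ] E') {g : ℝ≥0 → E} (hg : μ.Integrable g) :
    μ.integral (fun s => L (g s)) = L (μ.integral g) := by
  simp only [ComplexRadon.integral, map_sum, map_smul]
  exact Finset.sum_congr rfl fun k _ => by rw [L.integral_comp_comm (hg k)]

theorem norm_integral_le (μ : ComplexRadon) {g : ℝ≥0 → E} {w : ℝ≥0 → ℝ} (hw : μ.Integrable w)
    {C : ℝ} (hg : ∀ s, ‖g s‖ ≤ C * w s) :
    ‖μ.integral g‖ ≤ C * ∑ k, ∫ s, w s ∂(μ.part k) := by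
  rw [ComplexRadon.integral, Finset.mul_sum]
  refine (norm_sum_le _ _).trans (Finset.sum_le_sum fun k _ => ?_)
  rw [norm_smul, norm_pow, Complex.norm_I, one_pow, one_mul, ← integral_const_mul]
  exact MeasureTheory.norm_integral_le_of_norm_le ((hw k).const_mul C) (Eventually.of_forall hg)

end ComplexRadon

/-! ### Fubini's theorem for the holomorphic calculus -/

section Fubini

variable {X : Type*} [NormedAddCommGroup X] [NormedSpace ℂ X] [CompleteSpace X]
  {A : X →ₗ.[ℂ] X} {ω θ φ : ℝ}

theorem integrable_ray_prod (h : IsAdmissible A ω θ φ) {η : ℝ} (hη : η = θ ∨ η = -θ)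
    (m : Measure ℝ≥0) [SFinite m] {G : ℂ → ℝ≥0 → ℂ}
    (hG : ContinuousOn (Function.uncurry G) (sector φ ×ˢ univ)) {C ε : ℝ} (hε : 0 < ε)
    {w : ℝ≥0 → ℝ} (hw : Integrable w m)
    (hb : ∀ z ∈ sector φ, ∀ s, ‖G z s‖ ≤ C * min (‖z‖ ^ ε) (‖z‖ ^ (-ε)) * w s) :
    Integrable (Function.uncurry fun (r : ℝ) (s : ℝ≥0) =>
      Complex.exp (η * Complex.I) • (G (r * Complex.exp (η * Complex.I)) s •
        resolvent A (r * Complex.exp (η * Complex.I)))) ((volume.restrict (Ioi 0)).prod m) := by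
  obtain ⟨M, hM0, hM⟩ := h.exists_norm_resolvent_le
  have hmeas : (volume.restrict (Ioi (0 : ℝ))).prod m =
      (volume.prod m).restrict (Ioi (0 : ℝ) ×ˢ univ) := by
    rw [← Measure.prod_restrict, Measure.restrict_univ]
  have hset : MeasurableSet (Ioi (0 : ℝ) ×ˢ (univ : Set ℝ≥0)) :=
    measurableSet_Ioi.prod MeasurableSet.univ
  have hbd : Integrable (fun p : ℝ × ℝ≥0 =>
      ((C * M) * (min (p.1 ^ ε) (p.1 ^ (-ε)) / p.1)) * w p.2)
      ((volume.restrict (Ioi 0)).prod m) :=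
    ((integrableOn_min_rpow_div hε).const_mul (C * M)).mul_prod hw
  refine hbd.mono' ?_ ?_
  · rw [hmeas]
    refine ContinuousOn.aestronglyMeasurable ?_ hset
    rintro ⟨r, s⟩ ⟨hr, -⟩
    refine ContinuousAt.continuousWithinAt ?_
    have hz := h.ray_mem_sector hr hη
    have c1 : ContinuousAt (fun p : ℝ × ℝ≥0 => G (p.1 * Complex.exp (η * Complex.I)) p.2)
        (r, s) := by
      have h1 : ContinuousAt (Function.uncurry G) (r * Complex.exp (η * Complex.I), s) :=
        hG.continuousAt (((isOpen_sector h.phi_pos.le h.lt_pi.le).prod isOpen_univ).mem_nhds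
          ⟨hz, trivial⟩)
      exact ContinuousAt.comp (g := Function.uncurry G)
        (f := fun p : ℝ × ℝ≥0 => ((p.1 : ℂ) * Complex.exp (η * Complex.I), p.2)) h1 (by fun_prop)
    have c2 : ContinuousAt
        (fun p : ℝ × ℝ≥0 => resolvent A (p.1 * Complex.exp (η * Complex.I))) (r, s) :=
      ContinuousAt.comp (g := resolvent A)
        (f := fun p : ℝ × ℝ≥0 => (p.1 : ℂ) * Complex.exp (η * Complex.I))
        (h.continuousAt_resolvent hr hη) (by fun_prop)
    exact (c1.smul c2).const_smul (Complex.exp (η * Complex.I))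
  · rw [hmeas]
    refine (ae_restrict_iff' hset).2 (Eventually.of_forall ?_)
    rintro ⟨r, s⟩ ⟨hr, -⟩
    have hr' : 0 < r := hr
    have h1 := hb _ (h.ray_mem_sector hr' hη) s
    have h2 := hM η r hr' (cos_eq_of_eq_or_eq_neg hη).le
    rw [norm_ray hr'] at h1
    simp only [Function.uncurry_apply_pair]
    rw [norm_smul, norm_smul, Complex.norm_exp_ofReal_mul_I, one_mul]
    calc ‖G (r * Complex.exp (η * Complex.I)) s‖ *
          ‖resolvent A (r * Complex.exp (η * Complex.I))‖
        = ‖G (r * Complex.exp (η * Complex.I)) s‖ *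
          (r * ‖resolvent A (r * Complex.exp (η * Complex.I))‖) / r := by field_simp
      _ ≤ (C * min (r ^ ε) (r ^ (-ε)) * w s) * M / r := by
          refine div_le_div_of_nonneg_right ?_ hr'.le
          exact mul_le_mul h1 h2 (by positivity) ((norm_nonneg _).trans h1)
      _ = _ := by ring

theorem rayIntegral_integral (h : IsAdmissible A ω θ φ) {η : ℝ} (hη : η = θ ∨ η = -θ)
    (m : Measure ℝ≥0) [SFinite m] {G : ℂ → ℝ≥0 → ℂ}
    (hG : ContinuousOn (Function.uncurry G) (sector φ ×ˢ univ)) {C ε : ℝ} (hε : 0 < ε)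
    {w : ℝ≥0 → ℝ} (hw : Integrable w m)
    (hb : ∀ z ∈ sector φ, ∀ s, ‖G z s‖ ≤ C * min (‖z‖ ^ ε) (‖z‖ ^ (-ε)) * w s) :
    RayIntegrable η (fun z => (∫ s, G z s ∂m) • resolvent A z) ∧
    Integrable (fun s => rayIntegral η (fun z => G z s • resolvent A z)) m ∧
    rayIntegral η (fun z => (∫ s, G z s ∂m) • resolvent A z) =
      ∫ s, rayIntegral η (fun z => G z s • resolvent A z) ∂m := by
  have hi := integrable_ray_prod h hη m hG hε hw hb
  refine ⟨?_, hi.integral_prod_right, ?_⟩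
  · have := hi.integral_prod_left
    simp only [Function.uncurry_apply_pair, integral_smul, integral_smul_const] at this
    exact this
  · have := integral_integral_swap hi
    simp only [integral_smul _ (_ : ℝ≥0 → X →L[ℂ] X), integral_smul_const] at this
    exact this

theorem holCalc_integral (h : IsAdmissible A ω θ φ) (ν : ComplexRadon) {G : ℂ → ℝ≥0 → ℂ}
    (hG : ContinuousOn (Function.uncurry G) (sector φ ×ˢ univ)) {C ε : ℝ} (hε : 0 < ε)
    {w : ℝ≥0 → ℝ} (hw : ν.Integrable w)
    (hb : ∀ z ∈ sector φ, ∀ s, ‖G z s‖ ≤ C * min (‖z‖ ^ ε) (‖z‖ ^ (-ε)) * w s) :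
    ν.Integrable (fun s => holCalc A θ (fun z => G z s)) ∧
    holCalc A θ (fun z => ν.integral (G z)) =
      ν.integral (fun s => holCalc A θ (fun z => G z s)) := by
  have h1 := fun k => rayIntegral_integral h (Or.inl rfl) (ν.part k) hG hε (hw k) hb
  have h2 := fun k => rayIntegral_integral h (Or.inr rfl) (ν.part k) hG hε (hw k) hb
  have key : ∀ η, (∀ k, RayIntegrable η (fun z => (∫ s, G z s ∂(ν.part k)) • resolvent A z)) →
      rayIntegral η (fun z => ν.integral (G z) • resolvent A z) =
        ∑ k : Fin 4, Complex.I ^ (k : ℕ) •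
          rayIntegral η (fun z => (∫ s, G z s ∂(ν.part k)) • resolvent A z) := by
    intro η hη
    simp only [rayIntegral, ComplexRadon.integral, Finset.sum_smul, Finset.smul_sum]
    rw [integral_finsetSum]
    · refine Finset.sum_congr rfl fun k _ => ?_
      rw [← integral_smul]
      congr 1
      funext r
      simp only [smul_eq_mul, mul_smul]
      rw [smul_comm]
    · intro k _
      have := (hη k).smul (Complex.I ^ (k : ℕ))
      refine this.congr (Eventually.of_forall fun r => ?_)
      simp only [Pi.smul_apply, smul_eq_mul, mul_smul]
      rw [smul_comm]
  constructor
  · intro k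
    simp only [holCalc_eq, contourIntegral]
    exact ((h2 k).2.1.sub (h1 k).2.1).smul (1 / (2 * Real.pi * Complex.I) : ℂ)
  · simp only [holCalc_eq, contourIntegral]
    rw [key _ fun k => (h2 k).1, key _ fun k => (h1 k).1, ComplexRadon.integral,
      ← Finset.sum_sub_distrib, Finset.smul_sum]
    refine Finset.sum_congr rfl fun k _ => ?_
    rw [integral_smul, integral_sub (h2 k).2.1 (h1 k).2.1, (h2 k).2.2, (h1 k).2.2, ← smul_sub,
      smul_comm]

end Fubini

/-! ### Bounded Stieltjes functions -/

theorem continuousOn_resFun :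
    ContinuousOn (fun p : ℂ × ℝ≥0 => resFun p.2 p.1) (Complex.slitPlane ×ˢ univ) := by
  unfold resFun
  exact continuousOn_const.div (by fun_prop) fun p hp => one_add_mul_ne_zero hp.1 p.2

theorem integral_resFun_eq (ν : ComplexRadon) (m : ℕ) (z : ℂ) :
    (ν.integral fun s => 1 / (1 + z * ((s : ℝ) : ℂ)) ^ m) = ν.integral fun s => resFun s z ^ m := by
  simp only [resFun, div_pow, one_pow]

theorem ComplexRadon.IsFinite.integrable_one {ν : ComplexRadon} (hν : ν.IsFinite) :
    ν.Integrable (fun _ => (1 : ℝ)) := fun k => by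
  have := hν k
  exact integrable_const _

theorem exists_stieltjesCalc_eq {X : Type*} [NormedAddCommGroup X] [NormedSpace ℂ X]
    {A : X →ₗ.[ℂ] X} {m : ℕ} (hm : 1 ≤ m) {g : ℂ → ℂ} (hg : g ∈ stieltjesB m) :
    ∃ m' ν, IsStieltjesRep m' g ν ∧ stieltjesCalc A g = stieltjesIntegral A m' ν := by
  obtain ⟨ν, hν⟩ := hg
  have hex : ∃ p : ℕ × ComplexRadon, 1 ≤ p.1 ∧ IsStieltjesRep p.1 g p.2 := ⟨(m, ν), hm, hν⟩
  refine ⟨_, _, hex.choose_spec.2, ?_⟩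
  rw [stieltjesCalc, dif_pos hex]

theorem norm_pow_le_of_le {X : Type*} [NormedAddCommGroup X] [NormedSpace ℂ X] {T : X →L[ℂ] X} {K : ℝ} (hK : ‖T‖ ≤ K) (n : ℕ) :
    ‖T ^ n‖ ≤ K ^ n := by
  induction n with
  | zero =>
    rw [pow_zero, pow_zero]
    exact ContinuousLinearMap.norm_id_le
  | succ n ih =>
    rw [pow_succ, pow_succ]
    exact (norm_mul_le _ _).trans
      (mul_le_mul ih hK (norm_nonneg _) (pow_nonneg ((norm_nonneg _).trans hK) _))

section StieltjesIntegral

variable {X : Type*} [NormedAddCommGroup X] [NormedSpace ℂ X] [CompleteSpace X]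
  {A : X →ₗ.[ℂ] X}

theorem IsSectorial.continuousAt_stRes (hA : IsSectorial A) {s : ℝ≥0} (hs : s ≠ 0) :
    ContinuousAt (stRes A) s := by
  have hs' : ((s : ℝ) : ℂ) ≠ 0 := by exact_mod_cast hs
  have he : stRes A =ᶠ[𝓝 s]
      fun s => (-((s : ℝ) : ℂ)⁻¹) • resolvent A (-((s : ℝ) : ℂ)⁻¹) := by
    filter_upwards [isOpen_ne.mem_nhds hs] with t ht
    exact hA.stRes_eq ht
  refine ContinuousAt.congr ?_ he.symm
  have c1 : ContinuousAt (fun t : ℝ≥0 => -((t : ℝ) : ℂ)⁻¹) s := by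
    have : Continuous fun t : ℝ≥0 => ((t : ℝ) : ℂ) := by fun_prop
    exact (this.continuousAt.inv₀ hs').neg
  have c2 : ContinuousAt (resolvent A) (-((s : ℝ) : ℂ)⁻¹) :=
    (differentiableAt_resolvent (hA.neg_inv_mem hs)).continuousAt
  exact c1.smul (ContinuousAt.comp (g := resolvent A) (f := fun t : ℝ≥0 => -((t : ℝ) : ℂ)⁻¹) c2 c1)

theorem IsSectorial.aestronglyMeasurable_stRes_pow (hA : IsSectorial A) (n : ℕ)
    (m : Measure ℝ≥0) : AEStronglyMeasurable (fun s => stRes A s ^ n) m := by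
  have h1 : AEStronglyMeasurable (fun s => stRes A s ^ n) (m.restrict {0}) := by
    refine (aestronglyMeasurable_const (b := stRes A 0 ^ n)).congr ?_
    refine (ae_restrict_iff' (measurableSet_singleton _)).2 (Eventually.of_forall ?_)
    rintro s rfl
    rfl
  have h2 : AEStronglyMeasurable (fun s => stRes A s ^ n) (m.restrict {0}ᶜ) :=
    ContinuousOn.aestronglyMeasurable
      (fun s hs => ((hA.continuousAt_stRes hs).pow n).continuousWithinAt)
      (measurableSet_singleton _).compl
  have := aestronglyMeasurable_union_iff.2 ⟨h1, h2⟩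
  rwa [union_compl_self, Measure.restrict_univ] at this

theorem IsSectorial.integrable_stRes_pow (hA : IsSectorial A) (m : ℕ) {ν : ComplexRadon}
    (hν : ν.IsFinite) : ν.Integrable (fun s => stRes A s ^ m) := by
  obtain ⟨M, hM1, hM⟩ := hA.exists_norm_stRes_le
  intro k
  have := hν k
  exact Integrable.of_bound (hA.aestronglyMeasurable_stRes_pow m _) (M ^ m)
    (Eventually.of_forall fun s => norm_pow_le_of_le (hM s) m)

theorem IsSectorial.commute_stieltjesIntegral (hA : IsSectorial A) (m : ℕ) {ν : ComplexRadon}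
    (hν : ν.IsFinite) (t : ℝ≥0) : Commute (stieltjesIntegral A m ν) (stRes A t) := by
  have hi := hA.integrable_stRes_pow m hν
  have e1 := ν.integral_clm ((ContinuousLinearMap.mul ℂ (X →L[ℂ] X)).flip (stRes A t)) hi
  have e2 := ν.integral_clm (ContinuousLinearMap.mul ℂ (X →L[ℂ] X) (stRes A t)) hi
  simp only [ContinuousLinearMap.flip_apply, ContinuousLinearMap.mul_apply'] at e1 e2
  rw [Commute, SemiconjBy, stieltjesIntegral, ← e1, ← e2]
  congr 1
  funext s
  exact ((hA.commute_stRes s t).pow_left m).eq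

variable {ω θ φ : ℝ}

theorem holCalc_tau_mul_stieltjesIntegral (hA : IsSectorial A) (h : IsAdmissible A ω θ φ)
    {m : ℕ} {g : ℂ → ℂ} {ν : ComplexRadon} (hg : IsStieltjesRep m g ν) :
    holCalc A θ tau * stieltjesIntegral A m ν = holCalc A θ (fun z => tau z * g z) := by
  have hτ := tau_mem_H0 h.phi_pos h.lt_pi
  have hsub := sector_subset_slitPlane h.lt_pi.le
  obtain ⟨hν, hg⟩ := hg
  have hc : ContinuousOn (Function.uncurry fun (z : ℂ) (s : ℝ≥0) => tau z * resFun s z ^ m)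
      (sector φ ×ˢ univ) := by
    refine ContinuousOn.mul ?_ ?_
    · exact hτ.1.continuousOn.comp continuousOn_fst fun p hp => hp.1
    · exact (continuousOn_resFun.mono (prod_mono hsub le_rfl)).pow m
  have hb : ∀ z ∈ sector φ, ∀ s : ℝ≥0, ‖tau z * resFun s z ^ m‖ ≤
      ((Real.cos (φ / 2))⁻¹ ^ 2 * (Real.cos (φ / 2))⁻¹ ^ m) *
        min (‖z‖ ^ (1 : ℝ)) (‖z‖ ^ (-1 : ℝ)) * 1 := by
    intro z hz s
    rw [Real.rpow_one, Real.rpow_neg_one, norm_mul, norm_pow]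
    have hcos := cos_half_pos h.phi_pos.le h.lt_pi
    calc ‖tau z‖ * ‖resFun s z‖ ^ m
        ≤ ((Real.cos (φ / 2))⁻¹ ^ 2 * min ‖z‖ ‖z‖⁻¹) * (Real.cos (φ / 2))⁻¹ ^ m := by
          refine mul_le_mul (norm_tau_le h.phi_pos h.lt_pi hz) ?_ (by positivity)
            (by positivity)
          exact pow_le_pow_left₀ (norm_nonneg _) (norm_resFun_le_inv_cos h.phi_pos.le h.lt_pi hz s) m
      _ = _ := by ring
  have hF := (holCalc_integral h ν hc one_pos hν.integrable_one hb).2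
  have hmul := ν.integral_clm (ContinuousLinearMap.mul ℂ (X →L[ℂ] X) (holCalc A θ tau))
    (hA.integrable_stRes_pow m hν)
  simp only [ContinuousLinearMap.mul_apply'] at hmul
  rw [stieltjesIntegral, ← hmul]
  simp only [holCalc_mul_stRes_pow hA h hτ]
  rw [← hF]
  refine holCalc_congr h fun z hz => ?_
  rw [hg z (hsub hz), integral_resFun_eq]
  simp only [ComplexRadon.integral, integral_const_mul, smul_eq_mul, Finset.mul_sum]
  exact Finset.sum_congr rfl fun k _ => by ring

theorem holCalc_tau_mul_stieltjesCalc (hA : IsSectorial A) (h : IsAdmissible A ω θ φ)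
    {m : ℕ} (hm : 1 ≤ m) {g : ℂ → ℂ} (hg : g ∈ stieltjesB m) :
    holCalc A θ tau * stieltjesCalc A g = holCalc A θ (fun z => tau z * g z) := by
  obtain ⟨m', ν, hν, e⟩ := exists_stieltjesCalc_eq (A := A) hm hg
  rw [e, holCalc_tau_mul_stieltjesIntegral hA h hν]

theorem IsSectorial.commute_stieltjesCalc (hA : IsSectorial A) {m : ℕ} (hm : 1 ≤ m) {g : ℂ → ℂ}
    (hg : g ∈ stieltjesB m) (t : ℝ≥0) : Commute (stieltjesCalc A g) (stRes A t) := by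
  obtain ⟨m', ν, hν, e⟩ := exists_stieltjesCalc_eq (A := A) hm hg
  rw [e]
  exact hA.commute_stieltjesIntegral m' hν.1 t

end StieltjesIntegral

/-! ### The space of bounded generalised Stieltjes functions of a fixed order -/

theorem exists_mem_sector {z : ℂ} (hz : z ∈ Complex.slitPlane) :
    ∃ φ, 0 < φ ∧ φ < Real.pi ∧ z ∈ sector φ := by
  obtain ⟨h1, h2⟩ := Complex.mem_slitPlane_iff_arg.1 hz
  have h3 : |z.arg| < Real.pi := by
    refine abs_lt.2 ⟨Complex.neg_pi_lt_arg z, lt_of_le_of_ne (Complex.arg_le_pi z) h1⟩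
  refine ⟨(|z.arg| + Real.pi) / 2, by positivity, by linarith, h2, by linarith⟩

theorem exists_norm_resFun_le {z : ℂ} (hz : z ∈ Complex.slitPlane) :
    ∃ K : ℝ, 0 ≤ K ∧ ∀ s, ‖resFun s z‖ ≤ K := by
  obtain ⟨φ, h0, hπ, hφ⟩ := exists_mem_sector hz
  exact ⟨_, (inv_pos.2 (cos_half_pos h0.le hπ)).le, norm_resFun_le_inv_cos h0.le hπ hφ⟩

theorem continuous_resFun_left {z : ℂ} (hz : z ∈ Complex.slitPlane) :
    Continuous fun s => resFun s z := by
  unfold resFun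
  exact continuous_const.div (by fun_prop) (one_add_mul_ne_zero hz)

theorem integrable_resFun_pow {z : ℂ} (hz : z ∈ Complex.slitPlane) {Ω : Type*}
    [MeasurableSpace Ω] (m : Measure Ω) [IsFiniteMeasure m] {H : Ω → ℝ≥0} (hH : Measurable H)
    (n : ℕ) : Integrable (fun ω => resFun (H ω) z ^ n) m := by
  obtain ⟨K, hK0, hK⟩ := exists_norm_resFun_le hz
  refine Integrable.of_bound ?_ (K ^ n) (Eventually.of_forall fun ω => ?_)
  · exact (((continuous_resFun_left hz).pow n).measurable.comp hH).aestronglyMeasurable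
  · rw [norm_pow]
    exact pow_le_pow_left₀ (norm_nonneg _) (hK _) n

theorem mem_stieltjesB_iff {m : ℕ} {g : ℂ → ℂ} :
    g ∈ stieltjesB m ↔ ∃ ν : ComplexRadon, ν.IsFinite ∧
      ∀ z ∈ Complex.slitPlane, g z = ν.integral fun s => resFun s z ^ m := by
  simp only [stieltjesB, IsStieltjesRep, integral_resFun_eq]
  rfl

theorem stieltjesB_congr {m : ℕ} {g k : ℂ → ℂ} (hg : g ∈ stieltjesB m)
    (h : ∀ z ∈ Complex.slitPlane, k z = g z) : k ∈ stieltjesB m := by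
  obtain ⟨ν, h1, h2⟩ := hg
  exact ⟨ν, h1, fun z hz => (h z hz).trans (h2 z hz)⟩

theorem add_mem_stieltjesB {m : ℕ} {g k : ℂ → ℂ} (hg : g ∈ stieltjesB m)
    (hk : k ∈ stieltjesB m) : (fun z => g z + k z) ∈ stieltjesB m := by
  rw [mem_stieltjesB_iff] at hg hk ⊢
  obtain ⟨ν, h1, h2⟩ := hg
  obtain ⟨ρ, h3, h4⟩ := hk
  refine ⟨⟨fun k => ν.part k + ρ.part k, fun k => ?_⟩, fun k => ?_, fun z hz => ?_⟩
  · have := h1 k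
    have := h3 k
    infer_instance
  · have := h1 k
    have := h3 k
    exact inferInstanceAs (IsFiniteMeasure (ν.part k + ρ.part k))
  · rw [h2 z hz, h4 z hz]
    simp only [ComplexRadon.integral]
    rw [← Finset.sum_add_distrib]
    refine Finset.sum_congr rfl fun k _ => ?_
    have := h1 k
    have := h3 k
    rw [integral_add_measure (f := fun s => resFun s z ^ m) (integrable_resFun_pow hz _ measurable_id m)
      (integrable_resFun_pow hz _ measurable_id m), smul_add]

theorem nnreal_smul_mem_stieltjesB {m : ℕ} {g : ℂ → ℂ} (c : ℝ≥0) (hg : g ∈ stieltjesB m) :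
    (fun z => ((c : ℝ) : ℂ) * g z) ∈ stieltjesB m := by
  rw [mem_stieltjesB_iff] at hg ⊢
  obtain ⟨ν, h1, h2⟩ := hg
  refine ⟨⟨fun k => c • ν.part k, fun k => ?_⟩, fun k => ?_, fun z hz => ?_⟩
  · have := h1 k
    infer_instance
  · have := h1 k
    exact inferInstanceAs (IsFiniteMeasure (c • ν.part k))
  · rw [h2 z hz]
    simp only [ComplexRadon.integral, Finset.mul_sum]
    refine Finset.sum_congr rfl fun k _ => ?_
    rw [integral_smul_nnreal_measure, NNReal.smul_def, Complex.real_smul, smul_eq_mul, smul_eq_mul]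
    ring

theorem I_smul_mem_stieltjesB {m : ℕ} {g : ℂ → ℂ} (hg : g ∈ stieltjesB m) :
    (fun z => Complex.I * g z) ∈ stieltjesB m := by
  rw [mem_stieltjesB_iff] at hg ⊢
  obtain ⟨ν, h1, h2⟩ := hg
  refine ⟨⟨fun k => ν.part (k - 1), fun k => ν.radon _⟩, fun k => h1 _, fun z hz => ?_⟩
  rw [h2 z hz]
  simp only [ComplexRadon.integral, Fin.sum_univ_four]
  have e0 : (0 - 1 : Fin 4) = 3 := rfl
  have e1 : (1 - 1 : Fin 4) = 0 := rfl
  have e2 : (2 - 1 : Fin 4) = 1 := rfl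
  have e3 : (3 - 1 : Fin 4) = 2 := rfl
  rw [e0, e1, e2, e3]
  simp only [Fin.val_zero, Fin.val_one, Fin.val_two, smul_eq_mul]
  have e4 : ((3 : Fin 4) : ℕ) = 3 := rfl
  rw [e4]
  linear_combination (∫ s, resFun s z ^ m ∂ν.part 3) * Complex.I_pow_four

theorem smul_mem_stieltjesB {m : ℕ} {g : ℂ → ℂ} (c : ℂ) (hg : g ∈ stieltjesB m) :
    (fun z => c * g z) ∈ stieltjesB m := by
  have h1 := nnreal_smul_mem_stieltjesB c.re.toNNReal hg
  have h2 := I_smul_mem_stieltjesB (nnreal_smul_mem_stieltjesB c.im.toNNReal hg)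
  have h3 := I_smul_mem_stieltjesB (I_smul_mem_stieltjesB
    (nnreal_smul_mem_stieltjesB (-c.re).toNNReal hg))
  have h4 := I_smul_mem_stieltjesB (I_smul_mem_stieltjesB (I_smul_mem_stieltjesB
    (nnreal_smul_mem_stieltjesB (-c.im).toNNReal hg)))
  refine stieltjesB_congr
    (add_mem_stieltjesB (add_mem_stieltjesB h1 h2) (add_mem_stieltjesB h3 h4)) fun z _ => ?_
  have e : ∀ x : ℝ, (x : ℂ) = ((x.toNNReal : ℝ) : ℂ) - (((-x).toNNReal : ℝ) : ℂ) := by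
    intro x
    rw [Real.coe_toNNReal', Real.coe_toNNReal', ← Complex.ofReal_sub]
    congr 1
    rcases le_total 0 x with h | h
    · rw [max_eq_left h, max_eq_right (by linarith), sub_zero]
    · rw [max_eq_right h, max_eq_left (by linarith), sub_neg_eq_add, zero_add]
  have hc : c = (((c.re).toNNReal : ℝ) : ℂ) - (((-c.re).toNNReal : ℝ) : ℂ) +
      ((((c.im).toNNReal : ℝ) : ℂ) - (((-c.im).toNNReal : ℝ) : ℂ)) * Complex.I := by
    rw [← e, ← e, Complex.re_add_im]
  linear_combination (g z) * hc + (-((((-c.re).toNNReal : ℝ) : ℂ) * g z) -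
    (((-c.im).toNNReal : ℝ) : ℂ) * Complex.I * g z) * Complex.I_sq

theorem sum_mem_stieltjesB {m : ℕ} {ι : Type*} (s : Finset ι) {g : ι → ℂ → ℂ}
    (hg : ∀ i ∈ s, g i ∈ stieltjesB m) : (fun z => ∑ i ∈ s, g i z) ∈ stieltjesB m := by
  classical
  induction s using Finset.induction_on with
  | empty =>
    rw [mem_stieltjesB_iff]
    refine ⟨⟨fun _ => 0, fun _ => inferInstance⟩, fun _ => ?_, fun z _ => ?_⟩
    · exact inferInstanceAs (IsFiniteMeasure (0 : Measure ℝ≥0))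
    · simp [ComplexRadon.integral]
  | insert i s hi ih =>
    have h1 := add_mem_stieltjesB (hg i (Finset.mem_insert_self _ _))
      (ih fun j hj => hg j (Finset.mem_insert_of_mem hj))
    exact stieltjesB_congr h1 fun z _ => Finset.sum_insert hi

theorem integral_mem_stieltjesB {m : ℕ} {Ω : Type*} [MeasurableSpace Ω] (P : Measure Ω)
    [IsFiniteMeasure P] {H : Ω → ℝ≥0} (hH : Measurable H) :
    (fun z => ∫ ω, resFun (H ω) z ^ m ∂P) ∈ stieltjesB m := by
  rw [mem_stieltjesB_iff]
  refine ⟨⟨fun k => if k = 0 then P.map H else 0, fun k => ?_⟩, fun k => ?_, fun z hz => ?_⟩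
  · split_ifs <;> infer_instance
  · change IsFiniteMeasure (if k = 0 then P.map H else 0)
    split_ifs <;> infer_instance
  · rw [ComplexRadon.integral, Finset.sum_eq_single 0]
    · simp only [Fin.val_zero, pow_zero, one_smul, if_true]
      rw [integral_map (f := fun s => resFun s z ^ m) hH.aemeasurable
        ((continuous_resFun_left hz).pow m).measurable.aestronglyMeasurable]
    · intro k _ hk
      simp [hk]
    · simp

/-! ### Feynman's formula -/

theorem one_add_convexComb (z : ℂ) {u : ℝ} (hu : u ∈ Icc (0 : ℝ) 1) (t h : ℝ≥0) :
    1 + z * (((u.toNNReal * t + (1 - u).toNNReal * h : ℝ≥0) : ℝ) : ℂ) =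
      u * (1 + z * ((t : ℝ) : ℂ)) + (1 - u) * (1 + z * ((h : ℝ) : ℂ)) := by
  push_cast
  rw [Real.coe_toNNReal _ hu.1, Real.coe_toNNReal _ (by linarith [hu.2])]
  push_cast
  ring

theorem integral_feynman {m : ℕ} (hm : m ≠ 0) {z : ℂ} (hz : z ∈ Complex.slitPlane) (t h : ℝ≥0) :
    ∫ u in (0 : ℝ)..1, ((m * u ^ (m - 1) : ℝ) : ℂ) *
      resFun (u.toNNReal * t + (1 - u).toNNReal * h) z ^ (m + 1) =
      resFun t z ^ m * resFun h z := by
  have hb := one_add_mul_ne_zero hz h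
  have ha := one_add_mul_ne_zero hz t
  set a := 1 + z * ((t : ℝ) : ℂ) with ha_def
  set b := 1 + z * ((h : ℝ) : ℂ) with hb_def
  have hw : ∀ u ∈ Icc (0 : ℝ) 1, (u : ℂ) * a + (1 - u) * b ≠ 0 := by
    intro u hu
    rw [← one_add_convexComb z hu]
    exact one_add_mul_ne_zero hz _
  have e1 : ∫ u in (0 : ℝ)..1, ((m * u ^ (m - 1) : ℝ) : ℂ) *
      resFun (u.toNNReal * t + (1 - u).toNNReal * h) z ^ (m + 1) =
      ∫ u in (0 : ℝ)..1, (m * (u : ℂ) ^ (m - 1)) / ((u : ℂ) * a + (1 - u) * b) ^ (m + 1) := by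
    refine intervalIntegral.integral_congr fun u hu => ?_
    rw [uIcc_of_le zero_le_one] at hu
    rw [resFun, one_add_convexComb z hu, div_pow, one_pow]
    push_cast
    rw [mul_one_div]
  rw [e1, intervalIntegral.integral_eq_sub_of_hasDerivAt
    (f := fun u : ℝ => ((u : ℂ) / ((u : ℂ) * a + (1 - u) * b)) ^ m * (1 / b))]
  · simp only [Complex.ofReal_one, Complex.ofReal_zero, sub_self, zero_mul, one_mul, add_zero,
      zero_div, zero_pow hm, sub_zero, resFun, ← ha_def, ← hb_def]
  · intro u hu
    rw [uIcc_of_le zero_le_one] at hu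
    have hne := hw u hu
    have d0 : HasDerivAt (fun u : ℝ => (u : ℂ)) 1 u := Complex.ofRealCLM.hasDerivAt
    have d1 : HasDerivAt (fun u : ℝ => (u : ℂ) * a + (1 - u) * b) (1 * a + (0 - 1) * b) u :=
      (d0.mul_const a).add (((hasDerivAt_const u (1 : ℂ)).sub d0).mul_const b)
    have d2 := ((d0.div d1 hne).pow m).mul_const (1 / b)
    refine d2.congr_deriv ?_
    obtain ⟨k, rfl⟩ := Nat.exists_eq_succ_of_ne_zero hm
    simp only [Nat.succ_eq_add_one, Nat.add_sub_cancel, Pi.div_apply]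
    rw [div_pow]
    field_simp
    ring
  · refine ContinuousOn.intervalIntegrable ?_
    rw [uIcc_of_le zero_le_one]
    exact ContinuousOn.div (by fun_prop) (by fun_prop) fun u hu => pow_ne_zero _ (hw u hu)

/-- The measure `m u ^ (m - 1) du` on `(0, 1]`. -/
def betaMeasure (m : ℕ) : Measure ℝ :=
  (volume.restrict (Ioc 0 1)).withDensity
    fun u => ((m * u.toNNReal ^ (m - 1) : ℝ≥0) : ENNReal)

theorem measurable_betaDensity (m : ℕ) :
    Measurable fun u : ℝ => (m * u.toNNReal ^ (m - 1) : ℝ≥0) := by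
  fun_prop

instance (m : ℕ) : IsFiniteMeasure (betaMeasure m) := by
  refine isFiniteMeasure_withDensity (ne_of_lt ?_)
  calc ∫⁻ u in Ioc (0 : ℝ) 1, ((m * u.toNNReal ^ (m - 1) : ℝ≥0) : ENNReal)
      ≤ ∫⁻ _ in Ioc (0 : ℝ) 1, (m : ENNReal) := by
        refine setLIntegral_mono measurable_const fun u hu => ?_
        have h1 : u.toNNReal ≤ 1 := Real.toNNReal_le_one.2 hu.2
        have h2 : (m * u.toNNReal ^ (m - 1) : ℝ≥0) ≤ m :=
          mul_le_of_le_one_right zero_le (pow_le_one₀ zero_le h1)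
        exact_mod_cast h2
    _ < ⊤ := by simp

theorem integral_betaMeasure (m : ℕ) (g : ℝ → ℂ) :
    ∫ u, g u ∂betaMeasure m = ∫ u in (0 : ℝ)..1, ((m * u ^ (m - 1) : ℝ) : ℂ) * g u := by
  rw [betaMeasure, integral_withDensity_eq_integral_smul (measurable_betaDensity m),
    intervalIntegral.integral_of_le zero_le_one]
  refine setIntegral_congr_fun measurableSet_Ioc fun u hu => ?_
  rw [NNReal.smul_def, Complex.real_smul]
  push_cast
  rw [Real.coe_toNNReal _ hu.1.le]

/-- The kernel `k(z, s)` is a mixture of the functions `(1 + z t)^(-N)`, with a mixing measure of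
bounded mass which depends measurably on `s`. -/
def IsMixture (N : ℕ) (k : ℂ → ℝ≥0 → ℂ) : Prop :=
  ∃ (Ω : Type) (_ : MeasurableSpace Ω) (P : Measure Ω) (_ : IsFiniteMeasure P)
    (H : ℝ≥0 × Ω → ℝ≥0), Measurable H ∧
      ∀ z ∈ Complex.slitPlane, ∀ s, k z s = ∫ ω, resFun (H (s, ω)) z ^ N ∂P

theorem isMixture_resFun {h : ℝ≥0 → ℝ≥0} (hh : Measurable h) :
    IsMixture 1 (fun z s => resFun (h s) z) := by
  refine ⟨Unit, inferInstance, Measure.dirac (), inferInstance, fun p => h p.1,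
    hh.comp measurable_fst, fun z _ s => ?_⟩
  simp

theorem IsMixture.mul_resFun {N : ℕ} (hN : N ≠ 0) {k : ℂ → ℝ≥0 → ℂ} (hk : IsMixture N k)
    {h : ℝ≥0 → ℝ≥0} (hh : Measurable h) :
    IsMixture (N + 1) (fun z s => k z s * resFun (h s) z) := by
  obtain ⟨Ω, mΩ, P, hP, H, hH, hk⟩ := hk
  refine ⟨Ω × ℝ, inferInstance, P.prod (betaMeasure N), inferInstance,
    fun p => p.2.2.toNNReal * H (p.1, p.2.1) + (1 - p.2.2).toNNReal * h p.1, by fun_prop,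
    fun z hz s => ?_⟩
  rw [integral_prod _ (integrable_resFun_pow hz _ (by fun_prop) _)]
  simp only [integral_betaMeasure, integral_feynman hN hz]
  rw [integral_mul_const, hk z hz]

theorem IsMixture.mul_resFun_pow {N : ℕ} (hN : N ≠ 0) {k : ℂ → ℝ≥0 → ℂ} (hk : IsMixture N k)
    {h : ℝ≥0 → ℝ≥0} (hh : Measurable h) (j : ℕ) :
    IsMixture (N + j) (fun z s => k z s * resFun (h s) z ^ j) := by
  induction j with
  | zero => simpa using hk
  | succ j ih =>
    have := IsMixture.mul_resFun (by omega) ih hh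
    simpa only [pow_succ, mul_assoc, add_assoc] using this

theorem isMixture_resFun_pow {h : ℝ≥0 → ℝ≥0} (hh : Measurable h) {n : ℕ} (hn : 1 ≤ n) :
    IsMixture n (fun z s => resFun (h s) z ^ n) := by
  obtain ⟨j, rfl⟩ := Nat.exists_eq_add_of_le hn
  have := (isMixture_resFun hh).mul_resFun_pow one_ne_zero hh j
  simpa only [pow_add, pow_one] using this

theorem isMixture_mul_pow {h h' : ℝ≥0 → ℝ≥0} (hh : Measurable h) (hh' : Measurable h') {n k : ℕ}
    (hn : 1 ≤ n) (hk : k ≤ n) :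
    IsMixture (2 * n) (fun z s => resFun (h s) z ^ n * resFun (h' s) z ^ k) := by
  have h1 := (isMixture_resFun_pow hh hn).mul_resFun_pow (by omega) hh' k
  have h2 := h1.mul_resFun_pow (by omega) (measurable_const (a := (0 : ℝ≥0))) (n - k)
  have e : n + k + (n - k) = 2 * n := by omega
  rw [e] at h2
  simpa only [resFun_zero, one_pow, mul_one] using h2

theorem IsMixture.integral_mem_stieltjesB {N : ℕ} {k : ℂ → ℝ≥0 → ℂ} (hk : IsMixture N k)
    (m : Measure ℝ≥0) {w : ℝ≥0 → ℝ≥0} (hw : Measurable w)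
    (hwi : Integrable (fun s => (w s : ℝ)) m) :
    (fun z => ∫ s, ((w s : ℝ) : ℂ) * k z s ∂m) ∈ stieltjesB N := by
  obtain ⟨Ω, mΩ, P, hP, H, hH, hk⟩ := hk
  have hfin : IsFiniteMeasure (m.withDensity fun s => (w s : ENNReal)) := by
    refine isFiniteMeasure_withDensity (ne_of_lt ?_)
    have := hwi.2
    simpa [HasFiniteIntegral] using this
  refine stieltjesB_congr (SectorialCalculus.integral_mem_stieltjesB
    ((m.withDensity fun s => (w s : ENNReal)).prod P) hH) fun z hz => ?_
  rw [integral_prod _ (integrable_resFun_pow hz _ hH _), integral_withDensity_eq_integral_smul hw]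
  congr 1
  funext s
  rw [hk z hz s, NNReal.smul_def, Complex.real_smul]

/-! ### The regularised function `f ψₙ` -/

theorem psi_eq (n : ℕ) (z : ℂ) : psi n z = resFun 1 z ^ n := by
  rw [psi, resFun_one, div_pow, one_pow]

theorem psi_mem_stieltjesB (n : ℕ) : psi n ∈ stieltjesB n := by
  refine stieltjesB_congr
    (integral_mem_stieltjesB (Measure.dirac (1 : ℝ≥0)) measurable_id (m := n)) fun z hz => ?_
  rw [integral_dirac, psi_eq]
  rfl

theorem psi_mem_stieltjesB_two_mul {n : ℕ} (hn : 1 ≤ n) : psi n ∈ stieltjesB (2 * n) := by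
  have h := isMixture_mul_pow (measurable_const (a := (1 : ℝ≥0)))
    (measurable_const (a := (0 : ℝ≥0))) hn le_rfl
  have h2 := h.integral_mem_stieltjesB (Measure.dirac 0) (measurable_const (a := (1 : ℝ≥0)))
    (integrable_const _)
  refine stieltjesB_congr h2 fun z _ => ?_
  simp [psi_eq, resFun_zero]

/-- The weight used for small `s`. -/
def smallWeight : ℝ≥0 → ℝ≥0 := (Iic 1).indicator fun _ => 1

/-- The weight used for large `s`. -/
def largeWeight (n : ℕ) : ℝ≥0 → ℝ≥0 := (Ioi 1).indicator fun s => s⁻¹ ^ n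

theorem measurable_smallWeight : Measurable smallWeight :=
  measurable_const.indicator measurableSet_Iic

theorem measurable_largeWeight (n : ℕ) : Measurable (largeWeight n) :=
  (measurable_id.inv.pow_const n).indicator measurableSet_Ioi

theorem smallWeight_le (n : ℕ) (s : ℝ≥0) :
    (smallWeight s : ℝ) ≤ 2 ^ n * (1 / (1 + (s : ℝ)) ^ n) := by
  have h0 : (0 : ℝ) ≤ s := s.coe_nonneg
  by_cases hs : s ≤ 1
  · rw [smallWeight, indicator_of_mem (show s ∈ Iic 1 from hs), NNReal.coe_one, mul_one_div,
      le_div_iff₀ (by positivity), one_mul]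
    have : (s : ℝ) ≤ 1 := hs
    exact pow_le_pow_left₀ (by positivity) (by linarith) n
  · rw [smallWeight, indicator_of_notMem (show s ∉ Iic 1 from hs), NNReal.coe_zero]
    positivity

theorem largeWeight_le (n : ℕ) (s : ℝ≥0) :
    (largeWeight n s : ℝ) ≤ 2 ^ n * (1 / (1 + (s : ℝ)) ^ n) := by
  have h0 : (0 : ℝ) ≤ s := s.coe_nonneg
  by_cases hs : 1 < s
  · have h1 : (1 : ℝ) < s := hs
    rw [largeWeight, indicator_of_mem (show s ∈ Ioi 1 from hs), mul_one_div, ← div_pow]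
    push_cast
    refine pow_le_pow_left₀ (by positivity) ?_ n
    rw [inv_eq_one_div, div_le_div_iff₀ (by positivity) (by positivity)]
    linarith
  · rw [largeWeight, indicator_of_notMem (show s ∉ Ioi 1 from hs), NNReal.coe_zero]
    positivity

theorem one_sub_pow_eq_sum (n : ℕ) (x : ℂ) :
    (1 - x) ^ n = ∑ k ∈ Finset.range (n + 1), ((-1) ^ k * (n.choose k : ℂ)) * x ^ k := by
  rw [sub_eq_neg_add, add_pow]
  refine Finset.sum_congr rfl fun k _ => ?_
  rw [neg_pow, one_pow]
  ring

theorem mul_resFun_one {z : ℂ} (hz : z ∈ Complex.slitPlane) :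
    z * resFun 1 z = 1 - resFun 1 z := by
  have h := one_add_mul_ne_zero hz 1
  rw [resFun_one]
  simp only [NNReal.coe_one, Complex.ofReal_one, mul_one] at h
  field_simp
  ring

theorem kernel_eq_sum {z : ℂ} (hz : z ∈ Complex.slitPlane) (n : ℕ) (s : ℝ≥0) :
    z ^ n / (1 + z * ((s : ℝ) : ℂ)) ^ n * psi n z =
      ∑ k ∈ Finset.range (n + 1), ((-1) ^ k * (n.choose k : ℂ)) *
        (((smallWeight s : ℝ) : ℂ) * (resFun s z ^ n * resFun 1 z ^ k) +
          ((largeWeight n s : ℝ) : ℂ) * (resFun 1 z ^ n * resFun s z ^ k)) := by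
  have hs0 := one_add_mul_ne_zero hz s
  rw [psi_eq]
  by_cases hs : s ≤ 1
  · have h1 : smallWeight s = 1 := indicator_of_mem (show s ∈ Iic 1 from hs) _
    have h2 : largeWeight n s = 0 := indicator_of_notMem (show s ∉ Ioi 1 from not_lt.2 hs) _
    have e : z ^ n / (1 + z * ((s : ℝ) : ℂ)) ^ n * resFun 1 z ^ n =
        resFun s z ^ n * (1 - resFun 1 z) ^ n := by
      rw [← mul_resFun_one hz, ← div_pow, ← mul_pow, ← mul_pow]
      congr 1
      simp only [resFun]
      ring
    rw [e, one_sub_pow_eq_sum, Finset.mul_sum]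
    refine Finset.sum_congr rfl fun k _ => ?_
    rw [h1, h2]
    push_cast
    ring
  · have hs' : 1 < s := not_le.1 hs
    have hsne : ((s : ℝ) : ℂ) ≠ 0 := by
      have : s ≠ 0 := (zero_lt_one.trans hs').ne'
      exact_mod_cast this
    have h1 : smallWeight s = 0 := indicator_of_notMem (show s ∉ Iic 1 from hs) _
    have h2 : largeWeight n s = s⁻¹ ^ n := indicator_of_mem (show s ∈ Ioi 1 from hs') _
    have e0 : z / (1 + z * ((s : ℝ) : ℂ)) = ((s : ℝ) : ℂ)⁻¹ * (1 - resFun s z) := by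
      rw [resFun]
      field_simp
      ring
    have e : z ^ n / (1 + z * ((s : ℝ) : ℂ)) ^ n * resFun 1 z ^ n =
        ((s : ℝ) : ℂ)⁻¹ ^ n * resFun 1 z ^ n * (1 - resFun s z) ^ n := by
      rw [← div_pow, e0, mul_pow]
      ring
    rw [e, one_sub_pow_eq_sum, Finset.mul_sum]
    refine Finset.sum_congr rfl fun k _ => ?_
    rw [h1, h2]
    push_cast
    ring

theorem integrable_weight_mul {z : ℂ} (hz : z ∈ Complex.slitPlane) {m : Measure ℝ≥0}
    {w : ℝ≥0 → ℝ≥0} (hwi : Integrable (fun s => (w s : ℝ)) m) (j k : ℕ) (t t' : ℝ≥0 → ℝ≥0)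
    (ht : Continuous t) (ht' : Continuous t') :
    Integrable (fun s => ((w s : ℝ) : ℂ) * (resFun (t s) z ^ j * resFun (t' s) z ^ k)) m := by
  obtain ⟨K, hK0, hK⟩ := exists_norm_resFun_le hz
  have hc := continuous_resFun_left hz
  refine hwi.ofReal.mul_bdd (c := K ^ j * K ^ k) ?_ (Eventually.of_forall fun s => ?_)
  · exact (((hc.comp ht).pow j).mul ((hc.comp ht').pow k)).aestronglyMeasurable
  · rw [norm_mul, norm_pow, norm_pow]
    exact mul_le_mul (pow_le_pow_left₀ (norm_nonneg _) (hK _) _)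
      (pow_le_pow_left₀ (norm_nonneg _) (hK _) _) (by positivity) (by positivity)

theorem kernel_integral_mem_stieltjesB {n : ℕ} (hn : 1 ≤ n) {m : Measure ℝ≥0}
    (hm : Integrable (fun s : ℝ≥0 => 1 / (1 + (s : ℝ)) ^ n) m) :
    (fun z => ∫ s, z ^ n / (1 + z * ((s : ℝ) : ℂ)) ^ n * psi n z ∂m) ∈ stieltjesB (2 * n) := by
  have hw1 : Integrable (fun s => (smallWeight s : ℝ)) m := by
    refine (hm.const_mul (2 ^ n)).mono'
      (measurable_smallWeight.coe_nnreal_real.aestronglyMeasurable)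
      (Eventually.of_forall fun s => ?_)
    rw [Real.norm_of_nonneg (NNReal.coe_nonneg _)]
    exact smallWeight_le n s
  have hw2 : Integrable (fun s => (largeWeight n s : ℝ)) m := by
    refine (hm.const_mul (2 ^ n)).mono'
      ((measurable_largeWeight n).coe_nnreal_real.aestronglyMeasurable)
      (Eventually.of_forall fun s => ?_)
    rw [Real.norm_of_nonneg (NNReal.coe_nonneg _)]
    exact largeWeight_le n s
  have hmem : (fun z => ∑ k ∈ Finset.range (n + 1), ((-1) ^ k * (n.choose k : ℂ)) *
      ((∫ s, ((smallWeight s : ℝ) : ℂ) * (resFun s z ^ n * resFun 1 z ^ k) ∂m) +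
        ∫ s, ((largeWeight n s : ℝ) : ℂ) * (resFun 1 z ^ n * resFun s z ^ k) ∂m)) ∈
      stieltjesB (2 * n) := by
    refine sum_mem_stieltjesB _ fun k hk => smul_mem_stieltjesB _ (add_mem_stieltjesB ?_ ?_)
    · exact (isMixture_mul_pow measurable_id measurable_const hn
        (Finset.mem_range_succ_iff.1 hk)).integral_mem_stieltjesB m measurable_smallWeight hw1
    · exact (isMixture_mul_pow measurable_const measurable_id hn
        (Finset.mem_range_succ_iff.1 hk)).integral_mem_stieltjesB m (measurable_largeWeight n) hw2
  refine stieltjesB_congr hmem fun z hz => ?_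
  have i1 := fun k => integrable_weight_mul hz hw1 n k (fun s => s) (fun _ => 1)
    continuous_id continuous_const
  have i2 := fun k => integrable_weight_mul hz hw2 n k (fun _ => 1) (fun s => s)
    continuous_const continuous_id
  simp only [kernel_eq_sum hz]
  rw [integral_finsetSum]
  · refine Finset.sum_congr rfl fun k _ => ?_
    rw [integral_const_mul, integral_add (i1 k) (i2 k)]
  · intro k _
    exact ((i1 k).add (i2 k)).const_mul _

theorem IsBernsteinRep.mul_psi_eq {n : ℕ} {f : ℂ → ℂ} {a : ℂ} {μ : ComplexRadon}
    (hf : IsBernsteinRep n f a μ) {z : ℂ} (hz : z ∈ Complex.slitPlane) :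
    f z * psi n z = a * psi n z +
      μ.integral fun s => z ^ n / (1 + z * ((s : ℝ) : ℂ)) ^ n * psi n z := by
  rw [hf.2 z hz, add_mul]
  simp only [ComplexRadon.integral, integral_mul_const, Finset.sum_mul, smul_eq_mul, mul_assoc]

theorem IsBernsteinRep.mul_psi_mem_stieltjesB {n : ℕ} (hn : 1 ≤ n) {f : ℂ → ℂ} {a : ℂ}
    {μ : ComplexRadon} (hf : IsBernsteinRep n f a μ) :
    (fun z => f z * psi n z) ∈ stieltjesB (2 * n) := by
  have h1 := smul_mem_stieltjesB a (psi_mem_stieltjesB_two_mul hn)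
  have h2 := sum_mem_stieltjesB (m := 2 * n) Finset.univ fun (k : Fin 4) _ =>
    smul_mem_stieltjesB (Complex.I ^ (k : ℕ)) (kernel_integral_mem_stieltjesB hn (hf.1 k))
  exact stieltjesB_congr (add_mem_stieltjesB h1 h2) fun z hz => hf.mul_psi_eq hz

/-! ### Bounded Stieltjes functions are bounded and holomorphic on sectors -/

theorem hasDerivAt_resFun {z : ℂ} (hz : z ∈ Complex.slitPlane) (s : ℝ≥0) :
    HasDerivAt (resFun s) (-((s : ℝ) : ℂ) * resFun s z ^ 2) z := by
  have h := one_add_mul_ne_zero hz s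
  have d1 : HasDerivAt (fun z : ℂ => 1 + z * ((s : ℝ) : ℂ)) (0 + 1 * ((s : ℝ) : ℂ)) z :=
    (hasDerivAt_const z (1 : ℂ)).add ((hasDerivAt_id z).mul_const _)
  refine ((hasDerivAt_const z (1 : ℂ)).div d1 h).congr_deriv ?_
  rw [resFun]
  field_simp
  ring

theorem mul_norm_resFun_le {φ : ℝ} (h0 : 0 ≤ φ) (hπ : φ < Real.pi) {z : ℂ} (hz : z ∈ sector φ)
    (s : ℝ≥0) : s * ‖resFun s z‖ ≤ (Real.cos (φ / 2))⁻¹ * ‖z‖⁻¹ := by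
  have hn : 0 < ‖z‖ := norm_pos_iff.2 hz.1
  have hc := cos_half_pos h0 hπ
  have h1 : (s : ℝ) * (1 + ‖z‖ * s)⁻¹ ≤ ‖z‖⁻¹ := by
    rw [← div_eq_mul_inv, ← one_div, div_le_div_iff₀ (by positivity) hn]
    linarith
  calc s * ‖resFun s z‖ ≤ s * ((Real.cos (φ / 2))⁻¹ * (1 + ‖z‖ * s)⁻¹) := by
        gcongr
        exact norm_resFun_le h0 hπ hz s
    _ = (Real.cos (φ / 2))⁻¹ * (s * (1 + ‖z‖ * s)⁻¹) := by ring
    _ ≤ _ := by gcongr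

theorem differentiableOn_integral_resFun_pow {φ : ℝ} (h0 : 0 < φ) (hπ : φ < Real.pi)
    (ν : Measure ℝ≥0) [IsFiniteMeasure ν] (m : ℕ) :
    DifferentiableOn ℂ (fun z => ∫ s, resFun s z ^ m ∂ν) (sector φ) := by
  intro z₀ hz₀
  have hsub := sector_subset_slitPlane hπ.le
  have hn : 0 < ‖z₀‖ := norm_pos_iff.2 hz₀.1
  have hc := cos_half_pos h0.le hπ
  set c := (Real.cos (φ / 2))⁻¹ with hc_def
  have hU : sector φ ∩ {z | ‖z₀‖ / 2 < ‖z‖} ∈ 𝓝 z₀ :=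
    ((isOpen_sector h0.le hπ.le).inter (isOpen_lt continuous_const continuous_norm)).mem_nhds
      ⟨hz₀, half_lt_self hn⟩
  have hcont := continuous_resFun_left (hsub hz₀)
  have key := hasDerivAt_integral_of_dominated_loc_of_deriv_le (μ := ν) (𝕜 := ℂ)
    (F := fun z s => resFun s z ^ m)
    (F' := fun z s => m * resFun s z ^ (m - 1) * (-((s : ℝ) : ℂ) * resFun s z ^ 2))
    (bound := fun _ => m * c ^ (m - 1) * (c * (‖z₀‖ / 2)⁻¹ * c)) hU
    (by
      filter_upwards [hU] with z hz
      exact ((continuous_resFun_left (hsub hz.1)).pow m).aestronglyMeasurable)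
    (integrable_resFun_pow (hsub hz₀) ν measurable_id m)
    (Continuous.aestronglyMeasurable (by fun_prop))
    (Eventually.of_forall fun s z hz => by
      have b1 := norm_resFun_le_inv_cos h0.le hπ hz.1 s
      have b2 := mul_norm_resFun_le h0.le hπ hz.1 s
      have b3 : ‖z‖⁻¹ ≤ (‖z₀‖ / 2)⁻¹ := inv_anti₀ (by positivity) (le_of_lt hz.2)
      have e : ‖(m : ℂ) * resFun s z ^ (m - 1) * (-((s : ℝ) : ℂ) * resFun s z ^ 2)‖ =
          m * ‖resFun s z‖ ^ (m - 1) * ((s * ‖resFun s z‖) * ‖resFun s z‖) := by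
        simp only [norm_mul, norm_pow, norm_neg, Complex.norm_natCast, Complex.norm_real,
          Real.norm_of_nonneg s.coe_nonneg]
        ring
      rw [e]
      have hc0 : 0 ≤ c := (inv_pos.2 hc).le
      have b4 : s * ‖resFun s z‖ ≤ c * (‖z₀‖ / 2)⁻¹ := b2.trans (by gcongr)
      gcongr)
    (integrable_const _)
    (Eventually.of_forall fun s z hz => (hasDerivAt_resFun (hsub hz.1) s).pow m)
  exact key.2.differentiableAt.differentiableWithinAt

theorem differentiableOn_of_mem_stieltjesB {φ : ℝ} (h0 : 0 < φ) (hπ : φ < Real.pi) {m : ℕ}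
    {g : ℂ → ℂ} (hg : g ∈ stieltjesB m) : DifferentiableOn ℂ g (sector φ) := by
  obtain ⟨ν, hν, hg⟩ := mem_stieltjesB_iff.1 hg
  have h : DifferentiableOn ℂ (fun z => ν.integral fun s => resFun s z ^ m) (sector φ) := by
    simp only [ComplexRadon.integral]
    refine DifferentiableOn.fun_sum fun k _ => ?_
    have := hν k
    exact (differentiableOn_integral_resFun_pow h0 hπ (ν.part k) m).const_smul
      (Complex.I ^ (k : ℕ))
  exact h.congr fun z hz => hg z (sector_subset_slitPlane hπ.le hz)

theorem exists_norm_le_of_mem_stieltjesB {φ : ℝ} (h0 : 0 < φ) (hπ : φ < Real.pi) {m : ℕ}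
    {g : ℂ → ℂ} (hg : g ∈ stieltjesB m) : ∃ K : ℝ, ∀ z ∈ sector φ, ‖g z‖ ≤ K := by
  obtain ⟨ν, hν, hg⟩ := mem_stieltjesB_iff.1 hg
  refine ⟨(Real.cos (φ / 2))⁻¹ ^ m * ∑ k, ∫ _, (1 : ℝ) ∂(ν.part k), fun z hz => ?_⟩
  rw [hg z (sector_subset_slitPlane hπ.le hz)]
  refine ν.norm_integral_le hν.integrable_one (C := (Real.cos (φ / 2))⁻¹ ^ m) fun s => ?_
  rw [norm_pow, mul_one]
  exact pow_le_pow_left₀ (norm_nonneg _) (norm_resFun_le_inv_cos h0.le hπ hz s) m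

theorem tau_mul_mem_H0 {φ : ℝ} (h0 : 0 < φ) (hπ : φ < Real.pi) {m : ℕ}
    {g : ℂ → ℂ} (hg : g ∈ stieltjesB m) : (fun z => tau z * g z) ∈ H0 φ := by
  obtain ⟨K, hK⟩ := exists_norm_le_of_mem_stieltjesB h0 hπ hg
  exact H0.mul_bounded h0 (tau_mem_H0 h0 hπ) (differentiableOn_of_mem_stieltjesB h0 hπ hg) hK

theorem H0_congr {φ : ℝ} {g k : ℂ → ℂ} (hg : g ∈ H0 φ) (h : ∀ z ∈ sector φ, k z = g z) :
    k ∈ H0 φ := by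
  obtain ⟨hd, C, ε, hε, hb⟩ := hg
  exact ⟨hd.congr h, C, ε, hε, fun z hz => by rw [h z hz]; exact hb z hz⟩

theorem tau_pow_mul_eq {φ : ℝ} (hπ : φ ≤ Real.pi) (n : ℕ) (f : ℂ → ℂ) {z : ℂ}
    (hz : z ∈ sector φ) :
    tau z ^ (n + 1) * f z = (tau z * (f z * psi n z)) * (1 - resFun 1 z) ^ n := by
  have e : tau z = resFun 1 z * (1 - resFun 1 z) := by
    rw [tau_eq (one_add_ne_zero_of_mem hπ hz)]
    ring
  have e2 : tau z ^ n = resFun 1 z ^ n * (1 - resFun 1 z) ^ n := by rw [e, mul_pow]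
  rw [pow_succ, e2, psi_eq]
  ring

theorem norm_one_sub_mul_resFun_le {φ : ℝ} (h0 : 0 ≤ φ) (hπ : φ < Real.pi) {z : ℂ}
    (hz : z ∈ sector φ) (s : ℝ≥0) :
    ‖(1 - resFun 1 z) * resFun s z‖ ≤ (Real.cos (φ / 2))⁻¹ ^ 2 * (1 / (1 + (s : ℝ))) := by
  have hc := cos_half_pos h0 hπ
  have b1 := norm_resFun_le h0 hπ hz 1
  have b2 := norm_resFun_le h0 hπ hz s
  rw [NNReal.coe_one, mul_one] at b1
  have hs := s.coe_nonneg
  rw [← mul_resFun_one (sector_subset_slitPlane hπ.le hz), norm_mul, norm_mul]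
  calc ‖z‖ * ‖resFun 1 z‖ * ‖resFun s z‖
      ≤ ‖z‖ * ((Real.cos (φ / 2))⁻¹ * (1 + ‖z‖)⁻¹) *
        ((Real.cos (φ / 2))⁻¹ * (1 + ‖z‖ * s)⁻¹) := by gcongr
    _ = (Real.cos (φ / 2))⁻¹ ^ 2 * (‖z‖ / ((1 + ‖z‖) * (1 + ‖z‖ * s))) := by
        rw [div_eq_mul_inv ‖z‖, mul_inv (1 + ‖z‖)]
        generalize (1 + ‖z‖)⁻¹ = p
        generalize (1 + ‖z‖ * s)⁻¹ = q
        ring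
    _ ≤ _ := by
        refine mul_le_mul_of_nonneg_left ?_ (by positivity)
        rw [div_le_div_iff₀ (by positivity) (by positivity)]
        nlinarith [norm_nonneg z, mul_nonneg (norm_nonneg z) (mul_nonneg (norm_nonneg z) hs)]

/-! ### Graphs -/

section Graph

variable {X : Type*} [NormedAddCommGroup X] [NormedSpace ℂ X]

theorem mem_graph_opComp_inverse {S B : X →L[ℂ] X} (hS : Function.Injective S) {x y : X} :
    (x, y) ∈ (opComp (ofBdd S).inverse (ofBdd B)).graph ↔ B x = S y := by
  have hker : LinearMap.ker (ofBdd S).toFun = ⊥ := by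
    rw [LinearMap.ker_eq_bot]
    intro u v huv
    exact Subtype.ext (hS huv)
  have hrange : ∀ u : X, u ∈ (ofBdd S).inverse.domain ↔ ∃ v, S v = u := by
    intro u
    rw [LinearPMap.inverse_domain]
    constructor
    · rintro ⟨v, rfl⟩
      exact ⟨v, rfl⟩
    · rintro ⟨v, rfl⟩
      exact ⟨⟨v, trivial⟩, rfl⟩
  rw [LinearPMap.mem_graph_iff]
  constructor
  · rintro ⟨w, hw, hy⟩
    obtain ⟨h1, h2⟩ := mem_opComp_domain.1 w.2
    obtain ⟨v, hv⟩ := (hrange _).1 h2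
    rw [opComp_apply w h1 h2,
      LinearPMap.inverse_apply_eq hker (x := ⟨v, trivial⟩) (y := ⟨_, h2⟩) hv] at hy
    simp only at hy hw
    rw [← hy, ← hw]
    exact hv.symm
  · intro h
    have h2 : ofBdd B ⟨x, trivial⟩ ∈ (ofBdd S).inverse.domain := (hrange _).2 ⟨y, h.symm⟩
    refine ⟨⟨x, mem_opComp_domain.2 ⟨trivial, h2⟩⟩, rfl, ?_⟩
    refine (opComp_apply (B := (ofBdd S).inverse) (A := ofBdd B) ⟨x, _⟩ trivial h2).trans ?_
    exact LinearPMap.inverse_apply_eq hker (x := ⟨y, trivial⟩) (y := ⟨_, h2⟩) h.symm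

theorem isClosed_opComp_inverse {S B : X →L[ℂ] X} (hS : Function.Injective S) :
    (opComp (ofBdd S).inverse (ofBdd B)).IsClosed := by
  have : ((opComp (ofBdd S).inverse (ofBdd B)).graph : Set (X × X)) =
      {p | B p.1 = S p.2} := by
    ext ⟨x, y⟩
    exact mem_graph_opComp_inverse hS
  rw [LinearPMap.IsClosed, this]
  exact isClosed_eq (by fun_prop) (by fun_prop)

end Graph

/-! ### The three functional calculi -/

section Main

variable {X : Type*} [NormedAddCommGroup X] [NormedSpace ℂ X]
  {A : X →ₗ.[ℂ] X} {ω θ φ : ℝ}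

theorem stRes_pow_injective (hA : IsSectorial A) (s : ℝ≥0) (n : ℕ) :
    Function.Injective ⇑(stRes A s ^ n) := by
  rw [FunLike.coe_pow_eq_iterate]
  exact (hA.stRes_injective s).iterate n

theorem holCalc_const_mul (c : ℂ) (g : ℂ → ℂ) :
    holCalc A θ (fun z => c * g z) = c • holCalc A θ g := by
  simp only [holCalc_eq, contourIntegral, rayIntegral]
  have : ∀ e z : ℂ, e • ((c * g z) • resolvent A z) = c • (e • (g z • resolvent A z)) := by
    intro e z
    simp only [smul_smul]
    ring_nf
  simp only [this, integral_smul, ← smul_sub]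
  rw [smul_comm]

theorem stRes_pow_hirschIntegrand (hA : IsSectorial A) (n : ℕ) (s : ℝ≥0)
    (x : (opPow A n).domain) :
    (stRes A 1 ^ n) (hirschIntegrand A n s x) = ((1 - stRes A 1) ^ n * stRes A s ^ n) (x : X) := by
  have h1 := hA.stRes_pow_opPow one_ne_zero n x x.2
  simp only [NNReal.coe_one, Complex.ofReal_one, one_pow, one_smul, Subtype.coe_eta] at h1
  have hc : Commute (stRes A 1 ^ n) (stRes A s ^ n) := (hA.commute_stRes 1 s).pow_pow n n
  have hc' : Commute ((1 - stRes A 1) ^ n) (stRes A s ^ n) :=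
    (((Commute.one_left _).sub_left (hA.commute_stRes 1 s))).pow_pow n n
  rw [hA.hirschIntegrand_eq, ← mul_apply_eq_comp, hc.eq, mul_apply_eq_comp, h1, hc'.eq,
    mul_apply_eq_comp]

variable [CompleteSpace X]

theorem stieltjesCalc_psi (hA : IsSectorial A) (hinj : Function.Injective A) {n : ℕ}
    (hn : 1 ≤ n) : stieltjesCalc A (psi n) = stRes A 1 ^ n := by
  obtain ⟨ω, h0, hπ, hω⟩ := hA.exists_isSect
  have h : IsAdmissible A ω ((2 * ω + Real.pi) / 3) ((ω + 2 * Real.pi) / 3) :=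
    ⟨h0, hω, by linarith, by linarith, by linarith⟩
  have e1 := holCalc_tau_mul_stieltjesCalc hA h hn (psi_mem_stieltjesB n)
  have e2 := holCalc_mul_stRes_pow hA h (tau_mem_H0 h.phi_pos h.lt_pi) 1 n
  simp only [psi_eq] at e1
  rw [← e2] at e1
  ext x
  exact holCalc_tau_injective hA hinj h (DFunLike.congr_fun e1 x)

theorem holCalc_tau_pow_mul (hA : IsSectorial A) (h : IsAdmissible A ω θ φ) {n : ℕ} (hn : 1 ≤ n)
    {f : ℂ → ℂ} (hf : (fun z => f z * psi n z) ∈ stieltjesB (2 * n)) :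
    (fun z => tau z ^ (n + 1) * f z) ∈ H0 φ ∧
    holCalc A θ (fun z => tau z ^ (n + 1) * f z) =
      holCalc A θ tau * stieltjesCalc A (fun z => f z * psi n z) * (1 - stRes A 1) ^ n := by
  have hu := tau_mul_mem_H0 h.phi_pos h.lt_pi hf
  have e := fun z hz => tau_pow_mul_eq h.lt_pi.le n f (z := z) hz
  refine ⟨H0_congr (H0.mul_one_sub_resFun_pow h.phi_pos h.lt_pi hu 1 n) e, ?_⟩
  rw [holCalc_congr h e, ← holCalc_mul_one_sub_stRes_pow hA h hu,
    holCalc_tau_mul_stieltjesCalc hA h (by omega) hf]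

theorem stieltjesOp_eq_holOp (hA : IsSectorial A) (hinj : Function.Injective A)
    (h : IsAdmissible A ω θ φ) {n : ℕ} (hn : 1 ≤ n)
    {f : ℂ → ℂ} (hf : (fun z => f z * psi n z) ∈ stieltjesB (2 * n)) :
    stieltjesOp A n f = holOp A θ n f := by
  have hJ := stRes_pow_injective hA 1 n
  have hT := holCalc_tau_injective hA hinj h
  have hTn : Function.Injective ⇑(holCalc A θ tau ^ (n + 1)) := by
    rw [FunLike.coe_pow_eq_iterate]
    exact hT.iterate _
  have hQ : Function.Injective ⇑((1 - stRes A 1) ^ n) := by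
    rw [FunLike.coe_pow_eq_iterate]
    exact (hA.one_sub_stRes_injective hinj one_ne_zero).iterate _
  have hF := (holCalc_tau_pow_mul hA h hn hf).2
  have hcomm : Commute (stieltjesCalc A fun z => f z * psi n z) ((1 - stRes A 1) ^ n) :=
    ((Commute.one_right _).sub_right
      (hA.commute_stieltjesCalc (by omega) hf 1)).pow_right n
  have hF' : holCalc A θ (fun z => tau z ^ (n + 1) * f z) =
      holCalc A θ tau * ((1 - stRes A 1) ^ n * stieltjesCalc A (fun z => f z * psi n z)) := by
    rw [hF, mul_assoc, hcomm.eq]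
  have hTn' : holCalc A θ tau ^ (n + 1) =
      holCalc A θ tau * ((1 - stRes A 1) ^ n * stRes A 1 ^ n) := by
    have hc : Commute (1 - stRes A 1) (stRes A 1) := (Commute.one_left _).sub_left (Commute.refl _)
    rw [pow_succ', holCalc_tau hA h, ← hc.mul_pow, hc.eq]
  refine LinearPMap.eq_of_eq_graph (SetLike.ext ?_)
  rintro ⟨x, y⟩
  rw [stieltjesOp, holOp, stieltjesCalc_psi hA hinj hn, mem_graph_opComp_inverse hJ,
    mem_graph_opComp_inverse hTn, hF', hTn']
  simp only [mul_apply_eq_comp]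
  rw [hT.eq_iff, hQ.eq_iff]

/-! ### Hirsch's definition -/

theorem one_add_pow_le_max {s : ℝ} (hs : 0 ≤ s) (n : ℕ) : (1 + s) ^ n ≤ 2 ^ n * max 1 s ^ n := by
  rw [← mul_pow]
  refine pow_le_pow_left₀ (by positivity) ?_ n
  linarith [le_max_left 1 s, le_max_right 1 s]

theorem integrable_hirschIntegrand (hA : IsSectorial A) {n : ℕ} {μ : ComplexRadon}
    (hμ : μ.Integrable fun s => 1 / (1 + (s : ℝ)) ^ n) (x : (opPow A n).domain) :
    μ.Integrable fun s => hirschIntegrand A n s x := by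
  obtain ⟨M, hM1, hM⟩ := hA.exists_norm_stRes_le
  intro k
  simp only [hA.hirschIntegrand_eq]
  set y := opPow A n x with hy
  refine ((hμ k).const_mul (2 ^ n * (M ^ n * ‖y‖ + (1 + M) ^ n * ‖(x : X)‖))).mono' ?_
    (Eventually.of_forall fun s => ?_)
  · exact (ContinuousLinearMap.apply ℂ X y).continuous.comp_aestronglyMeasurable
      (hA.aestronglyMeasurable_stRes_pow n (μ.part k))
  have hs0 := s.coe_nonneg
  have h1 : ‖(stRes A s ^ n) y‖ ≤ M ^ n * ‖y‖ :=
    ((stRes A s ^ n).le_opNorm y).trans (by gcongr; exact norm_pow_le_of_le (hM s) n)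
  have h2 : (s : ℝ) ^ n * ‖(stRes A s ^ n) y‖ ≤ M ^ n * ‖y‖ + (1 + M) ^ n * ‖(x : X)‖ := by
    by_cases hs : s = 0
    · have h3 : (s : ℝ) ^ n ≤ 1 := by
        rw [hs, NNReal.coe_zero]
        exact pow_le_one₀ le_rfl zero_le_one
      have h4 : 0 ≤ (1 + M) ^ n * ‖(x : X)‖ := by positivity
      nlinarith [norm_nonneg ((stRes A s ^ n) y)]
    · have h3 := hA.stRes_pow_opPow hs n x x.2
      have h4 : (s : ℝ) ^ n * ‖(stRes A s ^ n) y‖ = ‖((1 - stRes A s) ^ n) (x : X)‖ := by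
        rw [← h3, norm_smul, norm_pow, Complex.norm_real, Real.norm_of_nonneg hs0]
      have h5 : ‖1 - stRes A s‖ ≤ 1 + M :=
        (norm_sub_le _ _).trans (add_le_add ContinuousLinearMap.norm_id_le (hM s))
      rw [h4]
      have h6 : ‖((1 - stRes A s) ^ n) (x : X)‖ ≤ (1 + M) ^ n * ‖(x : X)‖ :=
        (((1 - stRes A s) ^ n).le_opNorm _).trans (by gcongr; exact norm_pow_le_of_le h5 n)
      have h7 : 0 ≤ M ^ n * ‖y‖ := by positivity
      linarith
  have h8 : max 1 (s : ℝ) ^ n * ‖(stRes A s ^ n) y‖ ≤ M ^ n * ‖y‖ + (1 + M) ^ n * ‖(x : X)‖ := by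
    rcases max_choice 1 (s : ℝ) with h | h <;> rw [h]
    · rw [one_pow, one_mul]
      have : 0 ≤ (1 + M) ^ n * ‖(x : X)‖ := by positivity
      linarith
    · exact h2
  rw [mul_one_div, le_div_iff₀ (by positivity)]
  calc ‖(stRes A s ^ n) y‖ * (1 + (s : ℝ)) ^ n
      ≤ ‖(stRes A s ^ n) y‖ * (2 ^ n * max 1 (s : ℝ) ^ n) := by
        gcongr
        exact one_add_pow_le_max hs0 n
    _ = 2 ^ n * (max 1 (s : ℝ) ^ n * ‖(stRes A s ^ n) y‖) := by ring
    _ ≤ _ := by gcongr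

theorem hirschOp_domain (hA : IsSectorial A) {n : ℕ} {μ : ComplexRadon} (a : ℂ)
    (hμ : μ.Integrable fun s => 1 / (1 + (s : ℝ)) ^ n) :
    (hirschOp A n a μ).domain = (opPow A n).domain :=
  Submodule.ext fun _ => ⟨fun hx => hx.1, fun hx => ⟨hx, integrable_hirschIntegrand hA hμ ⟨_, hx⟩⟩⟩

theorem holCalc_tau_mul_stieltjesCalc_eq (hA : IsSectorial A) (h : IsAdmissible A ω θ φ) {n : ℕ}
    (hn : 1 ≤ n) {f : ℂ → ℂ} {a : ℂ} {μ : ComplexRadon} (hf : IsBernsteinRep n f a μ) :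
    (μ.Integrable fun s => holCalc A θ tau * ((1 - stRes A 1) ^ n * stRes A s ^ n)) ∧
    holCalc A θ tau * stieltjesCalc A (fun z => f z * psi n z) =
      a • (holCalc A θ tau * stRes A 1 ^ n) +
        μ.integral fun s => holCalc A θ tau * ((1 - stRes A 1) ^ n * stRes A s ^ n) := by
  have hτ := tau_mem_H0 h.phi_pos h.lt_pi
  have hsub := sector_subset_slitPlane h.lt_pi.le
  have hmem := hf.mul_psi_mem_stieltjesB hn
  have hcos := cos_half_pos h.phi_pos.le h.lt_pi
  have hop : ∀ s : ℝ≥0, holCalc A θ (fun z => tau z * (1 - resFun 1 z) ^ n * resFun s z ^ n) =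
      holCalc A θ tau * ((1 - stRes A 1) ^ n * stRes A s ^ n) := by
    intro s
    rw [← holCalc_mul_stRes_pow hA h (H0.mul_one_sub_resFun_pow h.phi_pos h.lt_pi hτ 1 n) s n,
      ← holCalc_mul_one_sub_stRes_pow hA h hτ, mul_assoc]
  have hc : ContinuousOn (Function.uncurry fun (z : ℂ) (s : ℝ≥0) =>
      tau z * (1 - resFun 1 z) ^ n * resFun s z ^ n) (sector φ ×ˢ univ) := by
    refine ContinuousOn.mul ?_ ?_
    · exact (H0.mul_one_sub_resFun_pow h.phi_pos h.lt_pi hτ 1 n).1.continuousOn.comp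
        continuousOn_fst fun p hp => hp.1
    · exact (continuousOn_resFun.mono (prod_mono hsub le_rfl)).pow n
  have hb : ∀ z ∈ sector φ, ∀ s : ℝ≥0, ‖tau z * (1 - resFun 1 z) ^ n * resFun s z ^ n‖ ≤
      ((Real.cos (φ / 2))⁻¹ ^ 2 * ((Real.cos (φ / 2))⁻¹ ^ 2) ^ n) *
        min (‖z‖ ^ (1 : ℝ)) (‖z‖ ^ (-1 : ℝ)) * (1 / (1 + (s : ℝ)) ^ n) := by
    intro z hz s
    have b1 := norm_tau_le h.phi_pos h.lt_pi hz
    have b2 := norm_one_sub_mul_resFun_le h.phi_pos.le h.lt_pi hz s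
    rw [mul_assoc, ← mul_pow, norm_mul, norm_pow, Real.rpow_one, Real.rpow_neg_one]
    calc ‖tau z‖ * ‖(1 - resFun 1 z) * resFun s z‖ ^ n
        ≤ ((Real.cos (φ / 2))⁻¹ ^ 2 * min ‖z‖ ‖z‖⁻¹) *
          ((Real.cos (φ / 2))⁻¹ ^ 2 * (1 / (1 + (s : ℝ)))) ^ n := by gcongr
      _ = _ := by rw [mul_pow, one_div_pow]; ring
  obtain ⟨hi, hF⟩ := holCalc_integral h μ hc one_pos hf.1 hb
  simp only [hop] at hi hF
  refine ⟨hi, ?_⟩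
  have hψ : (fun z => a * (tau z * resFun 1 z ^ n)) ∈ H0 φ := by
    have := H0.mul_bounded h.phi_pos (H0.mul_resFun_pow h.phi_pos h.lt_pi hτ 1 n)
      (differentiableOn_const a) (K := ‖a‖) fun _ _ => le_rfl
    exact H0_congr this fun z _ => mul_comm _ _
  have e1 := holCalc_sub h (tau_mul_mem_H0 h.phi_pos h.lt_pi hmem) hψ
  rw [holCalc_const_mul, ← holCalc_mul_stRes_pow hA h hτ,
    ← holCalc_tau_mul_stieltjesCalc hA h (by omega) hmem] at e1
  rw [← hF, ← sub_eq_iff_eq_add', ← e1]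
  refine holCalc_congr h fun z hz => ?_
  rw [hf.mul_psi_eq (hsub hz), psi_eq, mul_add, mul_left_comm, add_sub_cancel_left]
  have e2 : ∀ s : ℝ≥0, tau z * (1 - resFun 1 z) ^ n * resFun s z ^ n =
      tau z * (z ^ n / (1 + z * ((s : ℝ) : ℂ)) ^ n * resFun 1 z ^ n) := by
    intro s
    rw [← mul_resFun_one (hsub hz), ← div_pow, mul_assoc, ← mul_pow, ← mul_pow]
    simp only [resFun]
    ring
  simp only [ComplexRadon.integral, e2, integral_const_mul, Finset.mul_sum, smul_eq_mul]
  exact Finset.sum_congr rfl fun k _ => by ring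

theorem stieltjesCalc_apply_eq (hA : IsSectorial A) (hinj : Function.Injective A)
    (h : IsAdmissible A ω θ φ) {n : ℕ}
    (hn : 1 ≤ n) {f : ℂ → ℂ} {a : ℂ} {μ : ComplexRadon} (hf : IsBernsteinRep n f a μ)
    (x : (hirschOp A n a μ).domain) :
    stieltjesCalc A (fun z => f z * psi n z) (x : X) =
      (stRes A 1 ^ n) (hirschOp A n a μ x) := by
  obtain ⟨hi, e⟩ := holCalc_tau_mul_stieltjesCalc_eq hA h hn hf
  set T := holCalc A θ tau with hT
  set y : (opPow A n).domain := ⟨x, x.2.1⟩ with hy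
  have e2 : hirschOp A n a μ x = a • (x : X) + μ.integral fun s => hirschIntegrand A n s y := rfl
  have e3 := μ.integral_clm (ContinuousLinearMap.apply ℂ X (x : X)) hi
  have e4 := μ.integral_clm (T * stRes A 1 ^ n) (integrable_hirschIntegrand hA hf.1 y)
  have e5 : ∀ s, (T * stRes A 1 ^ n) (hirschIntegrand A n s y) =
      (T * ((1 - stRes A 1) ^ n * stRes A s ^ n)) (x : X) := by
    intro s
    rw [mul_apply_eq_comp, stRes_pow_hirschIntegrand hA, mul_apply_eq_comp T]
  simp only [e5] at e4
  simp only [ContinuousLinearMap.apply_apply] at e3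
  apply holCalc_tau_injective hA hinj h
  change (T * stieltjesCalc A fun z => f z * psi n z) (x : X) =
    (T * stRes A 1 ^ n) (hirschOp A n a μ x)
  rw [e, e2, map_add, map_smul, ← e4, e3]
  rfl

theorem hirschOp_graph_le (hA : IsSectorial A) (hinj : Function.Injective A)
    (h : IsAdmissible A ω θ φ) {n : ℕ}
    (hn : 1 ≤ n) {f : ℂ → ℂ} {a : ℂ} {μ : ComplexRadon} (hf : IsBernsteinRep n f a μ) :
    (hirschOp A n a μ).graph ≤ (stieltjesOp A n f).graph := by
  rintro ⟨x, y⟩ hxy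
  rw [LinearPMap.mem_graph_iff] at hxy
  obtain ⟨w, hw, hy⟩ := hxy
  simp only at hw hy
  rw [stieltjesOp, stieltjesCalc_psi hA hinj hn, mem_graph_opComp_inverse
    (stRes_pow_injective hA 1 n), ← hw, ← hy]
  exact stieltjesCalc_apply_eq hA hinj h hn hf w

theorem isClosed_stieltjesOp (hA : IsSectorial A) (hinj : Function.Injective A) {n : ℕ}
    (hn : 1 ≤ n) (f : ℂ → ℂ) : (stieltjesOp A n f).IsClosed := by
  rw [stieltjesOp, stieltjesCalc_psi hA hinj hn]
  exact isClosed_opComp_inverse (stRes_pow_injective hA 1 n)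

theorem hirschOp_isClosable (hA : IsSectorial A) (hinj : Function.Injective A)
    (h : IsAdmissible A ω θ φ) {n : ℕ}
    (hn : 1 ≤ n) {f : ℂ → ℂ} {a : ℂ} {μ : ComplexRadon} (hf : IsBernsteinRep n f a μ) :
    (hirschOp A n a μ).IsClosable :=
  (isClosed_stieltjesOp hA hinj hn f).isClosable.leIsClosable
    (LinearPMap.le_of_le_graph (hirschOp_graph_le hA hinj h hn hf))

theorem stieltjesOp_eq_closure (hA : IsSectorial A) (hinj : Function.Injective A)
    (h : IsAdmissible A ω θ φ) {n : ℕ}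
    (hn : 1 ≤ n) {f : ℂ → ℂ} {a : ℂ} {μ : ComplexRadon} (hf : IsBernsteinRep n f a μ) :
    stieltjesOp A n f = (hirschOp A n a μ).closure := by
  refine LinearPMap.eq_of_eq_graph ?_
  rw [← (hirschOp_isClosable hA hinj h hn hf).graph_closure_eq_closure_graph]
  have hle := hirschOp_graph_le hA hinj h hn hf
  have hJ := stRes_pow_injective hA 1 n
  refine le_antisymm ?_ (Submodule.topologicalClosure_minimal _ hle
    (isClosed_stieltjesOp hA hinj hn f))
  rintro ⟨x, y⟩ hxy
  rw [stieltjesOp, stieltjesCalc_psi hA hinj hn, mem_graph_opComp_inverse hJ] at hxy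
  set s : ℕ → ℝ≥0 := fun k => 1 / ((k : ℝ≥0) + 1) with hs
  have hs0 : ∀ k, s k ≠ 0 := fun k => by positivity
  have hlim : Tendsto s atTop (𝓝 0) := tendsto_one_div_add_atTop_nhds_zero_nat
  have ht := (hA.tendsto_stRes_pow hs0 hlim n x).prodMk_nhds
    (hA.tendsto_stRes_pow hs0 hlim n y)
  refine mem_closure_of_tendsto ht (Eventually.of_forall fun k => ?_)
  have hmem : (stRes A (s k) ^ n) x ∈ (hirschOp A n a μ).domain := by
    rw [hirschOp_domain hA a hf.1]
    exact hA.stRes_pow_mem_opPow (hs0 k) n x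
  have h1 := stieltjesCalc_apply_eq hA hinj h hn hf ⟨_, hmem⟩
  have hc1 : Commute (stieltjesCalc A fun z => f z * psi n z) (stRes A (s k) ^ n) :=
    (hA.commute_stieltjesCalc (by omega) (hf.mul_psi_mem_stieltjesB hn) (s k)).pow_right n
  have hc2 : Commute (stRes A (s k) ^ n) (stRes A 1 ^ n) := (hA.commute_stRes _ _).pow_pow n n
  have h2 : (stRes A (s k) ^ n) y = hirschOp A n a μ ⟨_, hmem⟩ := by
    apply hJ
    rw [← h1, ← mul_apply_eq_comp, ← mul_apply_eq_comp, hc1.eq, ← hc2.eq, mul_apply_eq_comp,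
      mul_apply_eq_comp, hxy]
  exact (LinearPMap.mem_graph_iff _).2 ⟨⟨_, hmem⟩, rfl, h2.symm⟩

end Main

end SectorialCalculus

end

/-- The three definitions of `f(A)` are meaningful and coincide as (unbounded) operators. -/
theorem theorem4p9 {X : Type*} [NormedAddCommGroup X] [NormedSpace ℂ X] [CompleteSpace X]
    (A : X →ₗ.[ℂ] X) (hA : IsSectorial A) (hinj : Function.Injective A)
    (n : ℕ) (hn : 1 ≤ n) (f : ℂ → ℂ) (a : ℂ) (μ : ComplexRadon) (hf : IsBernsteinRep n f a μ) :
    -- `ψₙ` is a regulariser of `f` in the Stieltjes calculus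
    (psi n ∈ stieltjesB n ∧ (fun z => f z * psi n z) ∈ stieltjesB (2 * n) ∧
      Function.Injective (stieltjesCalc A (psi n))) ∧
    -- the Hirsch operator is defined on all of `dom (A ^ n)`, and it is closable
    ((hirschOp A n a μ).domain = (opPow A n).domain ∧ (hirschOp A n a μ).IsClosable) ∧
    -- some sector is available for the holomorphic calculus
    (∃ ω : ℝ, 0 < ω ∧ ω < Real.pi ∧ IsSect A ω) ∧
    ∀ ω θ φ : ℝ, 0 < ω → IsSect A ω → ω < θ → θ < φ → φ < Real.pi →
      -- `τ ^ (n + 1)` is a regulariser of `f` in the holomorphic calculus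
      (tau ∈ H0 φ ∧ (fun z => tau z ^ (n + 1) * f z) ∈ H0 φ ∧
        Function.Injective (holCalc A θ tau)) ∧
      -- the three operators coincide
      stieltjesOp A n f = holOp A θ n f ∧ holOp A θ n f = (hirschOp A n a μ).closure := by

  have hmem := hf.mul_psi_mem_stieltjesB hn
  obtain ⟨ω₀, h0, hπ, hω₀⟩ := hA.exists_isSect
  have hadm : IsAdmissible A ω₀ ((2 * ω₀ + Real.pi) / 3) ((ω₀ + 2 * Real.pi) / 3) :=
    ⟨h0, hω₀, by linarith, by linarith, by linarith⟩
  refine ⟨⟨psi_mem_stieltjesB n, hmem, ?_⟩,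
    ⟨hirschOp_domain hA a hf.1, hirschOp_isClosable hA hinj hadm hn hf⟩,
    ⟨ω₀, h0, hπ, hω₀⟩, fun ω θ φ hω hsect hωθ hθφ hφπ => ?_⟩
  · rw [stieltjesCalc_psi hA hinj hn]
    exact stRes_pow_injective hA 1 n
  have h : IsAdmissible A ω θ φ := ⟨hω, hsect, hωθ, hθφ, hφπ⟩
  have e := stieltjesOp_eq_holOp hA hinj h hn hmem
  exact ⟨⟨tau_mem_H0 h.phi_pos hφπ, (holCalc_tau_pow_mul hA h hn hmem).1,
    holCalc_tau_injective hA hinj h⟩, e, e.symm.trans (stieltjesOp_eq_closure hA hinj h hn hf)⟩
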